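/- Let $q\ge 3$ be an integer and let $0\le\beta<1$ be a real number. **Potts instances.** An instance of the $q$-state Potts model with activity $\beta$ is a triple $\Omega=(G,\Lambda,\sigma)$ with $G=(V,E)$ a finite simple graph, $\Lambda\subseteq V$ and $\sigma\in[q]^\Lambda$. A configuration $\pi\in[q]^V$ has weight $w_\Omega(\pi)=\beta^{\#\{uw\in E:\ \pi(u)=\pi(w)\}}$ (with $0^0=1$) if $\pi$ agrees with $\sigma$ on $\Lambda$, and $w_\Omega(\pi)=0$ otherwise. The instance is feasible if some configuration has positive weight, and then $\Pr_\Omega[c(v)=x]=\sum_{\pi:\,\pi(v)=x}w_\Omega(\pi)\big/\sum_\pi w_\Omega(\pi)$. **Contraction function.** Let $$\delta(d)=\begin{cases}\dfrac{2(1-\beta)}{q-1-(1-\beta)d} & \text{if } d\le\frac{q-1}{1-\beta}-2,\\[2mm] 1 & \text{otherwise.}\end{cases}$$ The function $\delta$ is a contraction function for a family $\mathcal G$ of finite graphs if there are constants $C>0$ and $0<\gamma<1$ such that for every $G=(V,E)\in\mathcal G$ with $n=|V|$, every $v\in V$ and every $\ell\ge1$, $$\sum_{(v,v_1,\dots,v_\ell)}\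 \prod_{i=1}^{\ell}\delta(\deg_G v_i)<n^C\gamma^\ell,$$ where the sum is over the self-avoiding walks of length $\ell$ in $G$ that start at $v$. **Local sparsity.** A vertex is low-degree if its degree is less than $\frac{q-1}{1-\beta}-2$. For $S\subseteq V$, let $B(S)$ be the smallest set $B\supseteq S$ such that every vertex outside $B$ with a neighbor in $B$ is low-degree. The family $\mathcal G$ is locally sparse if there is a constant $C>0$ such that for every $G=(V,E)\in\mathcal G$ with $|V|\ge2$ and every path $P$ in $G$ of length $\ell$ we have $|B(P)|\le C(\ell+\log|V|)$. **Theorem.** Let $\mathcal G$ be a family of finite graphs such that * $\delta$ is a contraction function for $\mathcal G$; * if $\beta=0$, then every graph in $\mathcal G$ is $q$-colorable; * $\mathcal G$ is locally sparse. Then there are an algorithm, a polynomial $T$ and a constant $C>0$ (all depending only on $q$, $\beta$ and $\mathcal G$) such that for every feasible instance $\Omega=(G,\Lambda,\sigma)$ with $G=(V,E)\in\mathcal G$ and $|V|=n$, every vertex $v\in V$ and every color $x\in[q]$, the algorithm on input $(\Omega,v,x)$ outputs within $T(n)$ steps a rational number $\hat p$ with $$\left(1-\frac{C}{n^3}\right)\Pr_\Omega[c(v)=x]\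 \le\ \hat p\ \le\ \left(1+\frac{C}{n^3}\right)\Pr_\Omega[c(v)=x].$$ Steps are counted as bit operations up to polynomial factors (arithmetic on integers is charged by their bit length), and the algorithm may read the first $k$ binary digits of the real constant $\beta$ at cost $k$. -/

import Mathlib

/-! ## The Potts model with boundary conditions -/

namespace Potts

/-- Number of monochromatic edges of `G` under the configuration `c`. -/
noncomputable def numMono {V : Type*} {q : ℕ} (G : SimpleGraph V) (c : V → Fin q) : ℕ :=
  {e ∈ G.edgeSet | (e.map c).IsDiag}.ncard

/-- An instance `(G, Λ, σ)` of the `q`-state Potts model on the vertex set `Fin n`. -/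
structure Instance (q n : ℕ) where
  graph : SimpleGraph (Fin n)
  fixedSet : Finset (Fin n)
  boundary : fixedSet → Fin q

/-- The weight `w_Ω(c)`: it is `β ^ #mon(c)` if `c` extends `σ`, and `0` otherwise. -/
noncomputable def Instance.weight {q n : ℕ} (Ω : Instance q n) (β : ℝ) (c : Fin n → Fin q) : ℝ :=
  open Classical in
  if ∀ u : Ω.fixedSet, c u = Ω.boundary u then β ^ numMono Ω.graph c else 0

/-- The partition function. -/
noncomputable def Instance.partitionFunction {q n : ℕ} (Ω : Instance q n) (β : ℝ) : ℝ :=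
  ∑ c : Fin n → Fin q, Ω.weight β c

/-- An instance is feasible if some configuration has positive weight. -/
def Instance.Feasible {q n : ℕ} (Ω : Instance q n) (β : ℝ) : Prop :=
  ∃ c : Fin n → Fin q, 0 < Ω.weight β c

/-- The probability that the vertex `v` has color `x` under the Gibbs measure. -/
noncomputable def Instance.marginal {q n : ℕ} (Ω : Instance q n) (β : ℝ)
    (v : Fin n) (x : Fin q) : ℝ :=
  ∑ c : Fin n → Fin q with c v = x, Ω.weight β c / Ω.partitionFunction β

/-! ## Families of graphs: contraction functions and local sparsity -/

/-- A family of finite graphs, each of them presented on a vertex set `Fin n`. -/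
abbrev GraphFamily : Type := ∀ n : ℕ, Set (SimpleGraph (Fin n))

open Classical in
/-- `∑ ∏_{i=1}^ℓ δ(deg v_i)` over the self-avoiding walks `(v, v_1, …, v_ℓ)` in `G`. -/
noncomputable def sawSum {n : ℕ} (δ : ℕ → ℝ) (G : SimpleGraph (Fin n)) (v : Fin n) (ℓ : ℕ) : ℝ :=
  ∑ w : Fin n, ∑ p ∈ (G.finsetWalkLength ℓ v w).filter (fun p => p.IsPath),
    ∏ i ∈ Finset.Icc 1 ℓ, δ (G.degree (p.getVert i))

/-- `δ` is a contraction function for the family `𝒢`. -/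
def IsContractionFunction (δ : ℕ → ℝ) (𝒢 : GraphFamily) : Prop :=
  ∃ C γ : ℝ, 0 < C ∧ 0 < γ ∧ γ < 1 ∧
    ∀ n : ℕ, ∀ G ∈ 𝒢 n, ∀ v : Fin n, ∀ ℓ : ℕ, 1 ≤ ℓ → sawSum δ G v ℓ < (n : ℝ) ^ C * γ ^ ℓ

/-- The function `δ` of the `q`-state Potts model with activity `β`. -/
noncomputable def delta (q : ℕ) (β : ℝ) (d : ℕ) : ℝ :=
  open Classical in
  if (d : ℝ) ≤ ((q : ℝ) - 1) / (1 - β) - 2 then 2 * (1 - β) / ((q : ℝ) - 1 - (1 - β) * d) else 1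

open Classical in
/-- A vertex is low-degree if its degree is less than `(q - 1) / (1 - β) - 2`. -/
def IsLowDegree {n : ℕ} (q : ℕ) (β : ℝ) (G : SimpleGraph (Fin n)) (u : Fin n) : Prop :=
  (G.degree u : ℝ) < ((q : ℝ) - 1) / (1 - β) - 2

/-- `B ⊆ V \ Λ` is a permissive block if every vertex outside `B ∪ Λ` with a neighbor in `B` is
low-degree. -/
def IsPermissiveBlock {n : ℕ} (q : ℕ) (β : ℝ) (G : SimpleGraph (Fin n)) (Λ B : Set (Fin n)) :
    Prop :=
  Disjoint B Λ ∧ ∀ u, u ∉ B → u ∉ Λ → (∃ w ∈ B, G.Adj u w) → IsLowDegree q β G u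

/-- The minimal permissive block containing `S`, as the intersection of all of them. -/
def minBlock {n : ℕ} (q : ℕ) (β : ℝ) (G : SimpleGraph (Fin n)) (Λ S : Set (Fin n)) :
    Set (Fin n) :=
  ⋂₀ {B | IsPermissiveBlock q β G Λ B ∧ S ⊆ B}

theorem minBlock_isLeast {n : ℕ} (q : ℕ) (β : ℝ) (G : SimpleGraph (Fin n)) (Λ S : Set (Fin n))
    (hS : Disjoint S Λ) :
    IsLeast {B | IsPermissiveBlock q β G Λ B ∧ S ⊆ B} (minBlock q β G Λ S) := by
  have hc : Λᶜ ∈ {B | IsPermissiveBlock q β G Λ B ∧ S ⊆ B} :=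
    ⟨⟨disjoint_compl_left, fun u h1 h2 _ => absurd h2 h1⟩, hS.subset_compl_right⟩
  refine ⟨⟨⟨?_, ?_⟩, ?_⟩, fun B hB => Set.sInter_subset_of_mem hB⟩
  · exact Disjoint.mono_left (Set.sInter_subset_of_mem hc) disjoint_compl_left
  · rintro u hu hΛ ⟨w, hw, hadj⟩
    simp only [minBlock, Set.mem_sInter, not_forall] at hu
    obtain ⟨B, hB, huB⟩ := hu
    exact hB.1.2 u huB hΛ ⟨w, Set.mem_sInter.1 hw B hB, hadj⟩
  · exact Set.subset_sInter fun B hB => hB.2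

/-- The family `𝒢` is locally sparse: in every graph of the family (with at least two vertices, so
that the logarithm is positive) `|B(P)| ≤ C (ℓ + log |V|)` for every path `P` of length `ℓ`. The
blocks `B(P)` are those of the instance without fixed vertices; fixing vertices only makes them
smaller. -/
def LocallySparse (q : ℕ) (β : ℝ) (𝒢 : GraphFamily) : Prop :=
  ∃ C : ℝ, 0 < C ∧ ∀ n : ℕ, 2 ≤ n → ∀ G ∈ 𝒢 n, ∀ (u w : Fin n) (p : G.Walk u w), p.IsPath →
    ((minBlock q β G ∅ {y | y ∈ p.support}).ncard : ℝ) ≤ C * (p.length + Real.log n)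

end Potts

/-! ## The model of computation

A first-order functional language with recursion, whose data are binary trees with natural numbers
at the leaves. Elementary tree operations have unit cost and arithmetic has logarithmic cost (the
bit length of the operands), so that polynomial time is that of Turing machines. A real parameter
`β` can be read through its binary expansion, `k` binary digits at cost `k`. -/

namespace Cost

/-- Data. Lists are right-nested pairs that end in `nat 0`. -/
inductive Val : Type
  | nat (a : ℕ) : Val
  | pair (a b : Val) : Val

namespace Val

def toNat : Val → ℕ
  | nat a => a
  | pair _ _ => 0

def fst : Val → Val
  | nat _ => nat 0
  | pair a _ => a

def snd : Val → Val
  | nat _ => nat 0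
  | pair _ b => b

def ofList : List Val → Val
  | [] => nat 0
  | a :: l => pair a (ofList l)

end Val

/-- Arithmetic operations on natural numbers (truncated subtraction, division with floor). -/
inductive Op : Type
  | add | sub | mul | div

def Op.apply : Op → ℕ → ℕ → ℕ
  | .add, a, b => a + b
  | .sub, a, b => a - b
  | .mul, a, b => a * b
  | .div, a, b => a / b

/-- Program terms; variables are de Bruijn indices. `digits e` reads the parameter `β`, and
`call f e` calls the `f`-th function of the program with argument `e`. -/
inductive Term : Type
  | var (i : ℕ) : Term
  | lit (a : ℕ) : Term
  | arith (o : Op) (e₁ e₂ : Term) : Term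
  | digits (e : Term) : Term
  | pair (e₁ e₂ : Term) : Term
  | fst (e : Term) : Term
  | snd (e : Term) : Term
  | ite (c e₁ e₂ : Term) : Term
  | bind (e₁ e₂ : Term) : Term
  | call (f : ℕ) (e : Term) : Term

/-- A program is a finite list of bodies of unary functions; the first one is the main function. -/
abbrev Program : Type := List Term

/-- `Eval P β env e v t`: in the program `P` with real parameter `β`, the term `e` evaluates in the
environment `env` to the value `v` in exactly `t` steps. -/
inductive Eval (P : Program) (β : ℝ) : List Val → Term → Val → ℕ → Prop
  | var {env : List Val} {i : ℕ} {v : Val} :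
      env[i]? = some v → Eval P β env (.var i) v 1
  | lit {env : List Val} {a : ℕ} :
      Eval P β env (.lit a) (.nat a) 1
  | arith {env : List Val} {o : Op} {e₁ e₂ : Term} {v₁ v₂ : Val} {t₁ t₂ : ℕ} :
      Eval P β env e₁ v₁ t₁ → Eval P β env e₂ v₂ t₂ →
      Eval P β env (.arith o e₁ e₂) (.nat (o.apply v₁.toNat v₂.toNat))
        (t₁ + t₂ + v₁.toNat.size + v₂.toNat.size + 1)
  | digits {env : List Val} {e : Term} {v : Val} {t : ℕ} :
      Eval P β env e v t →
      Eval P β env (.digits e) (.nat ⌊β * 2 ^ v.toNat⌋₊) (t + v.toNat + 1)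
  | pair {env : List Val} {e₁ e₂ : Term} {v₁ v₂ : Val} {t₁ t₂ : ℕ} :
      Eval P β env e₁ v₁ t₁ → Eval P β env e₂ v₂ t₂ →
      Eval P β env (.pair e₁ e₂) (.pair v₁ v₂) (t₁ + t₂ + 1)
  | fst {env : List Val} {e : Term} {v : Val} {t : ℕ} :
      Eval P β env e v t → Eval P β env (.fst e) v.fst (t + 1)
  | snd {env : List Val} {e : Term} {v : Val} {t : ℕ} :
      Eval P β env e v t → Eval P β env (.snd e) v.snd (t + 1)
  | iteTrue {env : List Val} {c e₁ e₂ : Term} {b v : Val} {s t : ℕ} :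
      Eval P β env c b s → b ≠ .nat 0 → Eval P β env e₁ v t →
      Eval P β env (.ite c e₁ e₂) v (s + t + 1)
  | iteFalse {env : List Val} {c e₁ e₂ : Term} {b v : Val} {s t : ℕ} :
      Eval P β env c b s → b = .nat 0 → Eval P β env e₂ v t →
      Eval P β env (.ite c e₁ e₂) v (s + t + 1)
  | bind {env : List Val} {e₁ e₂ : Term} {u v : Val} {s t : ℕ} :
      Eval P β env e₁ u s → Eval P β (u :: env) e₂ v t →
      Eval P β env (.bind e₁ e₂) v (s + t + 1)
  | call {env : List Val} {f : ℕ} {e body : Term} {u v : Val} {s t : ℕ} :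
      Eval P β env e u s → P[f]? = some body → Eval P β [u] body v t →
      Eval P β env (.call f e) v (s + t + 1)

/-- Evaluation is deterministic: value and running time are determined. -/
theorem Eval.det {P : Program} {β : ℝ} {env : List Val} {e : Term} {v v' : Val} {t t' : ℕ}
    (h : Eval P β env e v t) (h' : Eval P β env e v' t') : v = v' ∧ t = t' := by
  induction h generalizing v' t' with
  | var h => cases h'; simp_all
  | lit => cases h'; simp
  | arith _ _ ih₁ ih₂ =>
    cases h' with
    | arith a b =>
      obtain ⟨rfl, rfl⟩ := ih₁ a
      obtain ⟨rfl, rfl⟩ := ih₂ b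
      simp
  | digits _ ih =>
    cases h' with
    | digits a =>
      obtain ⟨rfl, rfl⟩ := ih a
      simp
  | pair _ _ ih₁ ih₂ =>
    cases h' with
    | pair a b =>
      obtain ⟨rfl, rfl⟩ := ih₁ a
      obtain ⟨rfl, rfl⟩ := ih₂ b
      simp
  | fst _ ih =>
    cases h' with
    | fst a =>
      obtain ⟨rfl, rfl⟩ := ih a
      simp
  | snd _ ih =>
    cases h' with
    | snd a =>
      obtain ⟨rfl, rfl⟩ := ih a
      simp
  | iteTrue _ hb _ ih₁ ih₂ =>
    cases h' with
    | iteTrue a _ b =>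
      obtain ⟨rfl, rfl⟩ := ih₁ a
      obtain ⟨rfl, rfl⟩ := ih₂ b
      simp
    | iteFalse a hb' _ => exact absurd ((ih₁ a).1.trans hb') hb
  | iteFalse _ hb _ ih₁ ih₂ =>
    cases h' with
    | iteTrue a hb' _ => exact absurd ((ih₁ a).1.symm.trans hb) hb'
    | iteFalse a _ b =>
      obtain ⟨rfl, rfl⟩ := ih₁ a
      obtain ⟨rfl, rfl⟩ := ih₂ b
      simp
  | bind _ _ ih₁ ih₂ =>
    cases h' with
    | bind a b =>
      obtain ⟨rfl, rfl⟩ := ih₁ a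
      obtain ⟨rfl, rfl⟩ := ih₂ b
      simp
  | call _ hf _ ih₁ ih₂ =>
    cases h' with
    | call a hf' b =>
      obtain ⟨rfl, rfl⟩ := ih₁ a
      rw [hf] at hf'
      obtain rfl := Option.some.inj hf'
      obtain ⟨rfl, rfl⟩ := ih₂ b
      simp

/-- On the given input, the program halts after exactly `t` steps with the given output. -/
def Program.RunsIn (P : Program) (β : ℝ) (input output : Val) (t : ℕ) : Prop :=
  Eval P β [input] (.call 0 (.var 0)) output t

end Cost

open Classical in
/-- The input to an algorithm: the number of vertices, the rows of the adjacency matrix, the list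
that has for each vertex `i` the entry `σ(i) + 1` if `i ∈ Λ` and `0` otherwise, the vertex `v`,
and the color `x`. -/
noncomputable def Potts.Instance.encode {q n : ℕ} (Ω : Potts.Instance q n) (v : Fin n)
    (x : Fin q) : Cost.Val :=
  .pair (.nat n) <|
  .pair (.ofList (List.ofFn fun i : Fin n => .ofList (List.ofFn fun j : Fin n =>
    .nat (if Ω.graph.Adj i j then 1 else 0)))) <|
  .pair (.ofList (List.ofFn fun i : Fin n =>
    .nat (if h : i ∈ Ω.fixedSet then (Ω.boundary ⟨i, h⟩ : ℕ) + 1 else 0))) <|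
  .pair (.nat v) (.nat x)

/-! Deleting the vertices `D` and keeping their influence as unary fields (a field `(w, a)` costs a
factor `β` when `w` has color `a`) makes the model self-reducible. Giving `w` the color `y` amounts
to deleting `w` and putting the field `y` on each surviving neighbor (`mul_fieldZAt_eq`).
Conversely, adding one field `(w, a)` multiplies the partition function by `1 - (1 - β) p`, where
`p` is the marginal of `a` at `w` (`fieldZ_cons`). A marginal is thus a ratio of partition functions
with fields on the neighbors, and these telescope into marginals at the neighbors in a smaller
graph.

At a low-degree vertex put `X = q - 1 - (1 - β) deg`. A Bernoulli estimate (`mul_fieldZAt_le`)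
bounds the marginal, so the map from `log p` to `log (1 - (1 - β) p)` has slope at most `(1 - β) /
X` in absolute value on the relevant range, and clamping the estimate keeps it in that range
(`near_clamp`). The marginal is a quotient whose numerator and denominator both carry the error of
the recursion. This doubles the error, and the product is `δ = 2 (1 - β) / X`. At a high-degree
vertex nothing contracts; there all colors of the vertex are summed, its neighbors join the pending
vertices, and the error passes through with factor 1, as `δ = 1` records. By `val_near` the
recursion computes the partition function up to this error and an unknown factor that does not
depend on the colors of the pending fields, so the factor cancels in every quotient.

The recursion is cut off after `L` deletions, with `L` logarithmic in `n`: from then on a low-degree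
vertex gets the trivial estimate 1, while high-degree vertices are still expanded. Every pending
vertex is reached by a self-avoiding path whose block contains all vertices deleted so far
(`Entry`). By local sparsity a path of length `h` has a block of size `O(h + log n)`, so at the
cut-off `h` is at least a large multiple of `log n`. Charging the error to the self-avoiding walks
(`err_le`, `err_init_le`) leaves a sum of `∏ δ` over walks of logarithmic length, which the
contraction hypothesis makes polynomially small, plus rounding errors that are exponentially small.

For the running time, the same block argument bounds the number of deletions on a branch by `O(log
n)` (`Covered`). The branching is charged to walks of that length. Since `δ` is bounded below by a
positive constant, their number is at most exponential in the length times the contraction sum,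
hence polynomial (`cost_le`, `cost_init_le`).

All quantities are integers in units of `1 / 2 ^ (n + c₀)` and have polynomial bit length (`val_le`,
`size_numBound_le`). The concrete program computes exactly this integer recursion within the bound
`cost` (`val_runs`). The boundary condition enters as deleted vertices with the fields they exert
(`Instance.Feasible.marginal_of_free`). -/

namespace Potts

/-! ### Partition functions with unary fields -/

section Fields

variable {n q : ℕ} (G : SimpleGraph (Fin n)) [DecidableRel G.Adj] (β : ℝ)

/-- The neighbors of `w` that are not in `D`. -/
def aliveNbrs (D : List (Fin n)) (w : Fin n) : List (Fin n) :=
  (List.finRange n).filter fun i => G.Adj w i ∧ i ∉ D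

@[simp] theorem mem_aliveNbrs {D : List (Fin n)} {w i : Fin n} :
    i ∈ aliveNbrs G D w ↔ G.Adj w i ∧ i ∉ D := by
  simp [aliveNbrs]

theorem nodup_aliveNbrs (D : List (Fin n)) (w : Fin n) : (aliveNbrs G D w).Nodup :=
  (List.nodup_finRange n).filter _

theorem aliveNbrs_cons_self (D : List (Fin n)) (w : Fin n) :
    aliveNbrs G (w :: D) w = aliveNbrs G D w := by
  refine List.filter_congr fun i _ => ?_
  by_cases h : G.Adj w i
  · simp [h, h.ne']
  · simp [h]

/-- The weight of the edges that avoid `D`. -/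
noncomputable def edgeWeight (D : List (Fin n)) (c : Fin n → Fin q) : ℝ :=
  ∏ i, ∏ j, if i < j ∧ G.Adj i j ∧ i ∉ D ∧ j ∉ D ∧ c i = c j then β else 1

/-- The weight of the unary fields `F` at vertices outside `D`. -/
noncomputable def fieldWeight (D : List (Fin n)) (F : List (Fin n × Fin q)) (c : Fin n → Fin q) :
    ℝ :=
  (F.map fun p => if p.1 ∉ D ∧ c p.1 = p.2 then β else 1).prod

noncomputable def fullWeight (D : List (Fin n)) (F : List (Fin n × Fin q)) (c : Fin n → Fin q) :
    ℝ :=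
  edgeWeight G β D c * fieldWeight β D F c

/-- The partition function of `G - D` with the fields `F`, times `q ^ |D|`. -/
noncomputable def fieldZ (D : List (Fin n)) (F : List (Fin n × Fin q)) : ℝ :=
  ∑ c, fullWeight G β D F c

/-- The part of `fieldZ` in which `w` has color `y`. -/
noncomputable def fieldZAt (D : List (Fin n)) (F : List (Fin n × Fin q)) (w : Fin n) (y : Fin q) :
    ℝ :=
  ∑ c with c w = y, fullWeight G β D F c

/-- The colors that the fields and the neighbors of `w` show to `w`. -/
def seenColors (D : List (Fin n)) (F : List (Fin n × Fin q)) (w : Fin n) (c : Fin n → Fin q) :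
    List (Fin q) :=
  (F.filter (fun p => p.1 = w)).map Prod.snd ++ (aliveNbrs G D w).map c

variable {β}

theorem fullWeight_nonneg (hβ : 0 ≤ β) (D : List (Fin n)) (F : List (Fin n × Fin q))
    (c : Fin n → Fin q) : 0 ≤ fullWeight G β D F c := by
  refine mul_nonneg (Finset.prod_nonneg fun i _ => Finset.prod_nonneg fun j _ => ?_)
    (List.prod_nonneg ?_)
  · split_ifs <;> simp [hβ]
  · simp only [List.mem_map]
    rintro _ ⟨p, _, rfl⟩
    split_ifs <;> simp [hβ]

theorem fieldZ_nonneg (hβ : 0 ≤ β) (D : List (Fin n)) (F : List (Fin n × Fin q)) :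
    0 ≤ fieldZ G β D F :=
  Finset.sum_nonneg fun c _ => fullWeight_nonneg G hβ D F c

theorem fieldZAt_nonneg (hβ : 0 ≤ β) (D : List (Fin n)) (F : List (Fin n × Fin q)) (w : Fin n)
    (y : Fin q) : 0 ≤ fieldZAt G β D F w y :=
  Finset.sum_nonneg fun c _ => fullWeight_nonneg G hβ D F c

theorem fieldZ_eq_sum (D : List (Fin n)) (F : List (Fin n × Fin q)) (w : Fin n) :
    fieldZ G β D F = ∑ y, fieldZAt G β D F w y := by
  simp only [fieldZ, fieldZAt]
  rw [← Finset.sum_fiberwise (s := Finset.univ) (g := fun c : Fin n → Fin q => c w)]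

theorem pow_count_eq_prod {α : Type*} [DecidableEq α] (y : α) (l : List α) :
    (l.map fun z => if z = y then β else 1).prod = β ^ l.count y := by
  induction l with
  | nil => simp
  | cons a l ih =>
    rw [List.map_cons, List.prod_cons, ih, List.count_cons]
    by_cases h : a = y <;> simp [h, pow_succ']

theorem prod_ite_list {l : List (Fin n)} (p : Fin n → Prop) [DecidablePred p] (f : Fin n → ℝ) :
    ((l.filter fun i => p i).map f).prod = (l.map fun i => if p i then f i else 1).prod := by
  induction l with
  | nil => simp
  | cons a l ih => by_cases h : p a <;> simp [h, ih]

theorem pow_count_aliveNbrs (D : List (Fin n)) (w : Fin n) (c : Fin n → Fin q) (y : Fin q) :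
    β ^ ((aliveNbrs G D w).map c).count y =
      ∏ i, if G.Adj w i ∧ i ∉ D ∧ c i = y then β else 1 := by
  rw [← pow_count_eq_prod, List.map_map, aliveNbrs, prod_ite_list, ← List.ofFn_eq_map,
    List.prod_ofFn]
  refine Finset.prod_congr rfl fun i _ => ?_
  by_cases h : G.Adj w i <;> by_cases h' : i ∈ D <;> simp [h, h']

theorem fieldWeight_cons_dead {D : List (Fin n)} {w : Fin n} (hw : w ∉ D)
    (F : List (Fin n × Fin q)) (c : Fin n → Fin q) :
    fieldWeight β D F c =
      β ^ ((F.filter (fun p => p.1 = w)).map Prod.snd).count (c w) * fieldWeight β (w :: D) F c := by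
  induction F with
  | nil => simp [fieldWeight]
  | cons p F ih =>
    have h1 : ∀ D' : List (Fin n), fieldWeight β D' (p :: F) c =
        (if p.1 ∉ D' ∧ c p.1 = p.2 then β else 1) * fieldWeight β D' F c := fun D' => by
      simp [fieldWeight]
    rw [h1, h1, ih]
    by_cases hp : p.1 = w
    · by_cases hc : c p.1 = p.2
      · have : c w = p.2 := hp ▸ hc
        simp [hp, hw, this, pow_succ]
        ring
      · have : ¬ c w = p.2 := hp ▸ hc
        simp [hp, this, Ne.symm this]
    · by_cases hc : c p.1 = p.2 ∧ p.1 ∉ D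
      · simp [hp, hc.1, hc.2]; ring
      · have : ¬ (p.1 ∉ D ∧ c p.1 = p.2) := fun h => hc ⟨h.2, h.1⟩
        have h2 : ¬ (p.1 ∉ w :: D ∧ c p.1 = p.2) := fun h => this ⟨by simp_all, h.2⟩
        rw [if_neg this, if_neg h2]
        simp [hp]

theorem edgeWeight_cons_dead {D : List (Fin n)} {w : Fin n} (hw : w ∉ D) (c : Fin n → Fin q) :
    edgeWeight G β D c =
      β ^ ((aliveNbrs G D w).map c).count (c w) * edgeWeight G β (w :: D) c := by
  -- Each ordered pair contributes to one of three products: pairs that start at `w`, pairs that end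
  -- at `w`, and pairs that avoid `w`. The first two see the neighbors above and below `w` and merge
  -- into one product over all neighbors.
  have h1 : ∀ i j, (if i < j ∧ G.Adj i j ∧ i ∉ D ∧ j ∉ D ∧ c i = c j then β else 1) =
      (if i = w then (if w < j ∧ G.Adj w j ∧ j ∉ D ∧ c j = c w then β else 1) else 1) *
      (if j = w then (if i < w ∧ G.Adj w i ∧ i ∉ D ∧ c i = c w then β else 1) else 1) *
      (if i < j ∧ G.Adj i j ∧ i ∉ w :: D ∧ j ∉ w :: D ∧ c i = c j then β else 1) := by
    intro i j
    by_cases hi : i = w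
    · by_cases hj : j = w
      · simp [hi, hj]
      · simp [hi, hj, hw, eq_comm]
    · by_cases hj : j = w
      · simp [hi, hj, hw, G.adj_comm]
      · simp [hi, hj]
  have h2 : β ^ ((aliveNbrs G D w).map c).count (c w) =
      ∏ i, if G.Adj w i ∧ i ∉ D ∧ c i = c w then β else 1 :=
    pow_count_aliveNbrs G D w c (c w)
  rw [edgeWeight, edgeWeight, h2]
  simp_rw [h1, Finset.prod_mul_distrib]
  congr 1
  rw [Finset.prod_comm (f := fun i j => if j = w then _ else _)]
  have h3 : ∀ f : Fin n → Fin n → ℝ, (∏ i, ∏ j, if i = w then f i j else 1) = ∏ j, f w j := by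
    intro f
    rw [Finset.prod_eq_single w]
    · simp
    · intro b _ hb; simp [hb]
    · simp
  rw [h3 (fun i j => if w < j ∧ G.Adj w j ∧ j ∉ D ∧ c j = c w then β else 1),
    h3 (fun j i => if i < w ∧ G.Adj w i ∧ i ∉ D ∧ c i = c w then β else 1),
    ← Finset.prod_mul_distrib]
  refine Finset.prod_congr rfl fun i _ => ?_
  by_cases h : G.Adj w i
  · rcases lt_or_gt_of_ne h.ne with h' | h'
    · simp [h', h'.not_gt]
    · simp [h', h'.not_gt]
  · simp [h]

theorem fullWeight_cons_dead {D : List (Fin n)} {w : Fin n} (hw : w ∉ D)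
    (F : List (Fin n × Fin q)) (c : Fin n → Fin q) :
    fullWeight G β D F c = β ^ (seenColors G D F w c).count (c w) * fullWeight G β (w :: D) F c := by
  rw [fullWeight, fullWeight, edgeWeight_cons_dead G hw, fieldWeight_cons_dead hw, seenColors,
    List.count_append, pow_add]
  ring

theorem edgeWeight_update {D : List (Fin n)} {w : Fin n} (hw : w ∈ D) (c : Fin n → Fin q)
    (z : Fin q) : edgeWeight G β D (Function.update c w z) = edgeWeight G β D c := by
  refine Finset.prod_congr rfl fun i _ => Finset.prod_congr rfl fun j _ => ?_
  by_cases hi : i = w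
  · simp [hi, hw]
  · by_cases hj : j = w
    · simp [hj, hw]
    · simp [hi, hj]

theorem fieldWeight_update {D : List (Fin n)} {w : Fin n} (hw : w ∈ D) (F : List (Fin n × Fin q))
    (c : Fin n → Fin q) (z : Fin q) :
    fieldWeight β D F (Function.update c w z) = fieldWeight β D F c := by
  refine congrArg List.prod (List.map_congr_left fun p _ => ?_)
  by_cases hp : p.1 = w
  · simp [hp, hw]
  · simp [hp]

theorem fullWeight_update {D : List (Fin n)} {w : Fin n} (hw : w ∈ D) (F : List (Fin n × Fin q))
    (c : Fin n → Fin q) (z : Fin q) :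
    fullWeight G β D F (Function.update c w z) = fullWeight G β D F c := by
  rw [fullWeight, edgeWeight_update G hw, fieldWeight_update hw, fullWeight]

theorem seenColors_update (D : List (Fin n)) (w : Fin n) (F : List (Fin n × Fin q))
    (c : Fin n → Fin q) (z : Fin q) :
    seenColors G D F w (Function.update c w z) = seenColors G D F w c := by
  rw [seenColors, seenColors]
  congr 1
  refine List.map_congr_left fun i hi => ?_
  rw [mem_aliveNbrs] at hi
  simp [hi.1.ne']

/-- Resetting the coordinate `w` is a bijection between the color classes of `w`, so each of the `q`
classes carries the same share of the sum. -/
theorem mul_sum_color_eq {w : Fin n} (h : (Fin n → Fin q) → ℝ)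
    (hh : ∀ c z, h (Function.update c w z) = h c) (y : Fin q) :
    q * ∑ c with c w = y, h c = ∑ c, h c := by
  have key : ∀ z : Fin q, ∑ c with c w = z, h c = ∑ c with c w = y, h c := by
    intro z
    refine Finset.sum_nbij' (fun c => Function.update c w y) (fun c => Function.update c w z)
      ?_ ?_ ?_ ?_ ?_
    · simp
    · simp
    · intro c hc
      simp only [Finset.mem_filter, Finset.mem_univ, true_and] at hc
      simp [← hc]
    · intro c hc
      simp only [Finset.mem_filter, Finset.mem_univ, true_and] at hc
      simp [← hc]
    · intro c _
      rw [hh]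
  rw [← Finset.sum_fiberwise (s := Finset.univ) (g := fun c : Fin n → Fin q => c w)]
  simp [key]

/-- Once the factors at `w` are pulled out, the remaining weight no longer sees the color of `w`.
The factor `q` is the price for keeping deleted vertices as free coordinates of a configuration. -/
theorem mul_fieldZAt {D : List (Fin n)} {w : Fin n} (hw : w ∉ D) (F : List (Fin n × Fin q))
    (y : Fin q) : q * fieldZAt G β D F w y =
      ∑ c, β ^ (seenColors G D F w c).count y * fullWeight G β (w :: D) F c := by
  rw [← mul_sum_color_eq (w := w) _ _ y, fieldZAt]
  · congr 1
    refine Finset.sum_congr rfl fun c hc => ?_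
    simp only [Finset.mem_filter, Finset.mem_univ, true_and] at hc
    rw [fullWeight_cons_dead G hw, hc]
  · intro c z
    rw [seenColors_update, fullWeight_update G (by simp)]

/-- The product of the field factors at `w` for the color `y`. -/
noncomputable def fieldFactor (β : ℝ) (F : List (Fin n × Fin q)) (w : Fin n) (y : Fin q) : ℝ :=
  (F.map fun p => if p.1 = w then (if p.2 = y then β else 1) else 1).prod

theorem fieldFactor_eq_pow (F : List (Fin n × Fin q)) (w : Fin n) (y : Fin q) :
    fieldFactor β F w y = β ^ ((F.filter (fun p => p.1 = w)).map Prod.snd).count y := by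
  rw [← pow_count_eq_prod, fieldFactor, List.map_map]
  induction F with
  | nil => simp
  | cons p F ih =>
    by_cases hp : p.1 = w <;> simp [hp, ih]

theorem fieldFactor_append (F F' : List (Fin n × Fin q)) (w : Fin n) (y : Fin q) :
    fieldFactor β (F ++ F') w y = fieldFactor β F w y * fieldFactor β F' w y := by
  simp [fieldFactor]

theorem fieldWeight_append (D : List (Fin n)) (F F' : List (Fin n × Fin q)) (c : Fin n → Fin q) :
    fieldWeight β D (F ++ F') c = fieldWeight β D F c * fieldWeight β D F' c := by
  simp [fieldWeight]

theorem fieldWeight_aliveNbrs (D : List (Fin n)) (w : Fin n) (c : Fin n → Fin q) (y : Fin q) :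
    fieldWeight β D ((aliveNbrs G D w).map (·, y)) c =
      β ^ ((aliveNbrs G D w).map c).count y := by
  rw [← pow_count_eq_prod, fieldWeight, List.map_map, List.map_map]
  refine congrArg List.prod (List.map_congr_left fun i hi => ?_)
  rw [mem_aliveNbrs] at hi
  simp [hi.2]

/-- The basic reduction: an edge from `w` to a surviving neighbor acts, once `w` has color `y`,
exactly like a field `y` on that neighbor. -/
theorem mul_fieldZAt_eq {D : List (Fin n)} {w : Fin n} (hw : w ∉ D) (F : List (Fin n × Fin q))
    (y : Fin q) : q * fieldZAt G β D F w y = fieldFactor β F w y *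
      fieldZ G β (w :: D) ((aliveNbrs G (w :: D) w).map (·, y) ++ F) := by
  rw [mul_fieldZAt G hw, fieldZ, Finset.mul_sum]
  refine Finset.sum_congr rfl fun c _ => ?_
  rw [seenColors, List.count_append, pow_add, fullWeight, fullWeight, fieldWeight_append,
    fieldWeight_aliveNbrs, aliveNbrs_cons_self, fieldFactor_eq_pow]
  ring

theorem fieldZ_cons_of_mem {D : List (Fin n)} {w : Fin n} (hw : w ∈ D) (F : List (Fin n × Fin q))
    (a : Fin q) : fieldZ G β D ((w, a) :: F) = fieldZ G β D F := by
  simp [fieldZ, fullWeight, fieldWeight, hw]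

/-- A field multiplies a weight by `1 - (1 - β)` times the indicator of its color. Divided by the
old partition function this is the factor `1 - (1 - β) p`, through which products of fields
telescope. -/
theorem fieldZ_cons {D : List (Fin n)} {w : Fin n} (hw : w ∉ D) (F : List (Fin n × Fin q))
    (a : Fin q) :
    fieldZ G β D ((w, a) :: F) = fieldZ G β D F - (1 - β) * fieldZAt G β D F w a := by
  rw [fieldZ, fieldZ, fieldZAt, Finset.sum_filter, Finset.mul_sum, ← Finset.sum_sub_distrib]
  refine Finset.sum_congr rfl fun c _ => ?_
  by_cases h : c w = a
  · simp [fullWeight, fieldWeight, hw, h]; ring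
  · simp [fullWeight, fieldWeight, h]

theorem fullWeight_le_cons (hβ : 0 ≤ β) (hβ1 : β ≤ 1) {D : List (Fin n)} {w : Fin n} (hw : w ∉ D)
    (F : List (Fin n × Fin q)) (c : Fin n → Fin q) :
    fullWeight G β D F c ≤ fullWeight G β (w :: D) F c := by
  rw [fullWeight_cons_dead G hw]
  exact mul_le_of_le_one_left (fullWeight_nonneg G hβ _ _ _) (pow_le_one₀ hβ hβ1)

/-- Deletion only drops factors that are at most 1. Positivity is therefore inherited by all
subproblems, including those with `β = 0`. -/
theorem fieldZ_le_cons (hβ : 0 ≤ β) (hβ1 : β ≤ 1) {D : List (Fin n)} {w : Fin n} (hw : w ∉ D)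
    (F : List (Fin n × Fin q)) : fieldZ G β D F ≤ fieldZ G β (w :: D) F :=
  Finset.sum_le_sum fun c _ => fullWeight_le_cons G hβ hβ1 hw F c

/-- The marginal probability of a color at a vertex with few fields and neighbors is small. -/
theorem mul_fieldZAt_le (hβ : 0 ≤ β) (hβ1 : β ≤ 1) {D : List (Fin n)} {w : Fin n} (hw : w ∉ D)
    (F : List (Fin n × Fin q)) (a : Fin q) {m : ℝ}
    (hm : (((F.filter (fun p => p.1 = w)).length + (aliveNbrs G D w).length : ℕ) : ℝ) ≤ m)
    (hq : 0 ≤ q - (1 - β) * m) :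
    (q - (1 - β) * m) * fieldZAt G β D F w a ≤ fieldZ G β D F := by
  have hq0 : (0 : ℝ) < q := by exact_mod_cast a.pos
  -- Bernoulli's inequality gives `β ^ j ≥ 1 - (1 - β) j`. Summed over the colors, the
  -- multiplicities `j` add up to the number of fields and neighbors at `w`.
  have h1 : ∀ c, q - (1 - β) * m ≤ ∑ y, β ^ (seenColors G D F w c).count y := by
    intro c
    have h2 : ∀ y, 1 - (1 - β) * ((seenColors G D F w c).count y : ℝ) ≤
        β ^ (seenColors G D F w c).count y := by
      intro y
      have := one_add_mul_le_pow (a := β - 1) (by linarith) ((seenColors G D F w c).count y)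
      have h3 : 1 + (β - 1) = β := by ring
      rw [h3] at this
      linarith
    refine le_trans ?_ (Finset.sum_le_sum fun y _ => h2 y)
    rw [Finset.sum_sub_distrib, ← Finset.mul_sum]
    have h4 : ∑ y, ((seenColors G D F w c).count y : ℝ) ≤ m := by
      refine le_trans (le_of_eq ?_) hm
      rw [← Nat.cast_sum]
      congr 1
      have := Multiset.sum_count_eq_card (s := Finset.univ) (m := (↑(seenColors G D F w c) : Multiset (Fin q)))
        (by simp)
      simp only [Multiset.coe_count, Multiset.coe_card] at this
      rw [this]
      simp [seenColors]
    have h5 := mul_le_mul_of_nonneg_left h4 (sub_nonneg.2 hβ1)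
    simp only [Finset.sum_const, Finset.card_univ, Fintype.card_fin, nsmul_eq_mul, mul_one]
    linarith
  have h6 : q * fieldZ G β D F =
      ∑ c, (∑ y, β ^ (seenColors G D F w c).count y) * fullWeight G β (w :: D) F c := by
    rw [fieldZ_eq_sum G D F w, Finset.mul_sum]
    simp_rw [mul_fieldZAt G hw, Finset.sum_mul]
    rw [Finset.sum_comm]
  have h7 : q * fieldZAt G β D F w a ≤ ∑ c, fullWeight G β (w :: D) F c := by
    rw [mul_fieldZAt G hw]
    exact Finset.sum_le_sum fun c _ => mul_le_of_le_one_left (fullWeight_nonneg G hβ _ _ _)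
      (pow_le_one₀ hβ hβ1)
  have h8 : (q - (1 - β) * m) * ∑ c, fullWeight G β (w :: D) F c ≤ q * fieldZ G β D F := by
    rw [h6, Finset.mul_sum]
    exact Finset.sum_le_sum fun c _ =>
      mul_le_mul_of_nonneg_right (h1 c) (fullWeight_nonneg G hβ _ _ _)
  have h9 := mul_le_mul_of_nonneg_left h7 hq
  nlinarith

end Fields

end Potts


namespace Potts

/-! ### Multiplicative approximation -/

/-- `x` approximates `y` up to the factor `exp E`. -/
def Near (E x y : ℝ) : Prop := Real.exp (-E) * y ≤ x ∧ x ≤ Real.exp E * y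

namespace Near

variable {E E' x y x' y' : ℝ}

theorem refl (x : ℝ) : Near 0 x x := by simp [Near]

theorem mono (h : Near E x y) (hy : 0 ≤ y) (hE : E ≤ E') : Near E' x y :=
  ⟨(mul_le_mul_of_nonneg_right (Real.exp_le_exp.2 (neg_le_neg hE)) hy).trans h.1,
    h.2.trans (mul_le_mul_of_nonneg_right (Real.exp_le_exp.2 hE) hy)⟩

theorem nonneg (h : Near E x y) (hy : 0 ≤ y) : 0 ≤ x :=
  (mul_nonneg (Real.exp_nonneg _) hy).trans h.1

theorem pos (h : Near E x y) (hy : 0 < y) : 0 < x :=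
  (mul_pos (Real.exp_pos _) hy).trans_le h.1

theorem symm (h : Near E x y) : Near E y x := by
  constructor
  · have := mul_le_mul_of_nonneg_left h.2 (Real.exp_nonneg (-E))
    rwa [← mul_assoc, ← Real.exp_add, neg_add_cancel, Real.exp_zero, one_mul] at this
  · have := mul_le_mul_of_nonneg_left h.1 (Real.exp_nonneg E)
    rwa [← mul_assoc, ← Real.exp_add, add_neg_cancel, Real.exp_zero, one_mul] at this

theorem mul (h : Near E x y) (h' : Near E' x' y') (hy : 0 ≤ y) (hy' : 0 ≤ y') :
    Near (E + E') (x * x') (y * y') := by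
  constructor
  · have := mul_le_mul h.1 h'.1 (mul_nonneg (Real.exp_nonneg _) hy') (h.nonneg hy)
    rw [neg_add, Real.exp_add]
    linarith
  · have := mul_le_mul h.2 h'.2 (h'.nonneg hy') (mul_nonneg (Real.exp_nonneg _) hy)
    rw [Real.exp_add]
    linarith

theorem const_mul (h : Near E x y) {c : ℝ} (hc : 0 ≤ c) : Near E (c * x) (c * y) := by
  constructor
  · have := mul_le_mul_of_nonneg_left h.1 hc
    linarith
  · have := mul_le_mul_of_nonneg_left h.2 hc
    linarith

/-- Summation does not increase a relative error. This is why summing over the colors of a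
high-degree vertex is harmless. -/
theorem sum {ι : Type*} (s : Finset ι) {f g : ι → ℝ} (h : ∀ i ∈ s, Near E (f i) (g i)) :
    Near E (∑ i ∈ s, f i) (∑ i ∈ s, g i) := by
  constructor
  · rw [Finset.mul_sum]
    exact Finset.sum_le_sum fun i hi => (h i hi).1
  · rw [Finset.mul_sum]
    exact Finset.sum_le_sum fun i hi => (h i hi).2

theorem div (h : Near E x y) (h' : Near E' x' y') (hy : 0 ≤ y) (hy' : 0 < y') :
    Near (E + E') (x / x') (y / y') := by
  have h1 : Near E' x'⁻¹ y'⁻¹ := by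
    have hx' := h'.pos hy'
    constructor
    · rw [Real.exp_neg, ← mul_inv]
      exact inv_anti₀ hx' h'.2
    · have h2 := h'.1
      have h3 := inv_anti₀ (mul_pos (Real.exp_pos _) hy') h2
      rwa [mul_inv, Real.exp_neg, inv_inv] at h3
  exact h.mul h1 hy (inv_nonneg.2 hy'.le)

end Near

/-! ### The recursive estimate -/

section Estimate

variable {n q : ℕ} (G : SimpleGraph (Fin n)) [DecidableRel G.Adj]
  (one b : ℕ) (cl : Fin n → ℕ)

/-- The product of the field factors at `w` for the color `y`, in units of `1 / one`. -/
def intFactor (F : List (Fin n × Fin q)) (w : Fin n) (y : Fin q) : ℕ :=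
  (F.map fun p => if p.1 = w then (if p.2 = y then b else one) else 1).prod

variable (rec : ℕ → List (Fin n) → List (Fin n × Fin q) → List (Fin n × Fin q) → ℕ)

/-- The contribution of the color `y` at `w`; the neighbors of `w` get pending fields. -/
def colorStep (k : ℕ) (D : List (Fin n)) (F Q : List (Fin n × Fin q)) (w : Fin n) (y : Fin q) : ℕ :=
  intFactor one b F w y * intFactor one b Q w y *
    rec (k - 1) (w :: D) F ((aliveNbrs G (w :: D) w).map (·, y) ++ Q)

/-- Estimate of `1 - (1 - β) p` for the probability `p` of the color `a` at `w`, clamped from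
below. -/
def estStep (k : ℕ) (D : List (Fin n)) (F : List (Fin n × Fin q)) (w : Fin n) (a : Fin q) : ℕ :=
  if k = 0 then one else
    max (cl w) (one - (one - b) * colorStep G one b rec k D F [] w a /
      ∑ y, colorStep G one b rec k D F [] w y)

/-- Elimination of the pending fields: at a low-degree vertex by an estimate, at a high-degree
vertex (for which `cl` is zero) by a sum over its colors. -/
def valStep (k : ℕ) (D : List (Fin n)) (F : List (Fin n × Fin q)) : List (Fin n × Fin q) → ℕ
  | [] => 1
  | (w, a) :: Q =>
    if w ∈ D then valStep k D F Q
    else if cl w = 0 then ∑ y, colorStep G one b rec k D F ((w, a) :: Q) w y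
    else estStep G one b cl rec k D (Q ++ F) w a * valStep k D F Q

omit rec in
/-- The recursion, for graphs with fewer than `N` vertices outside `D`. -/
def val : ℕ → ℕ → List (Fin n) → List (Fin n × Fin q) → List (Fin n × Fin q) → ℕ
  | 0 => fun _ _ _ _ => 1
  | N + 1 => valStep G one b cl (val N)

end Estimate

/-! ### The error of the estimate -/

section Error

variable {n q : ℕ} (G : SimpleGraph (Fin n)) [DecidableRel G.Adj]

/-- The error of `valStep`, as a function of the pending vertices. -/
noncomputable def errStep (cl : Fin n → ℕ) (δ : Fin n → ℝ) (r : ℝ)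
    (rec : ℕ → List (Fin n) → List (Fin n) → ℝ) (k : ℕ) (D : List (Fin n)) : List (Fin n) → ℝ
  | [] => 0
  | w :: s =>
    if w ∈ D then errStep cl δ r rec k D s
    else if cl w = 0 then r + rec (k - 1) (w :: D) (aliveNbrs G (w :: D) w ++ (w :: s))
    else (if k = 0 then δ w else δ w * (r + rec (k - 1) (w :: D) (aliveNbrs G (w :: D) w)) + r) +
      errStep cl δ r rec k D s

/-- The error of `val`. -/
noncomputable def err (cl : Fin n → ℕ) (δ : Fin n → ℝ) (r : ℝ) :
    ℕ → ℕ → List (Fin n) → List (Fin n) → ℝ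
  | 0 => fun _ _ _ => 0
  | N + 1 => errStep G cl δ r (err cl δ r N)

/-- The number of vertices outside `D`. -/
def alive (D : List (Fin n)) : ℕ := (Finset.univ.filter (· ∉ D)).card

theorem alive_cons_lt {D : List (Fin n)} {w : Fin n} (hw : w ∉ D) : alive (w :: D) < alive D := by
  refine Finset.card_lt_card (Finset.ssubset_iff_of_subset ?_ |>.2 ⟨w, by simp [hw], by simp⟩)
  intro i
  simp

/-- Every vertex sees at most as many fields and neighbors as it has neighbors in `G`. -/
def DegreeInv (deg : Fin n → ℕ) (D f s : List (Fin n)) : Prop :=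
  ∀ w, w ∉ D → f.count w + s.count w + (aliveNbrs G D w).length ≤ deg w

variable {G} {β : ℝ} {one b : ℕ} {cl deg : Fin n → ℕ} {δ : Fin n → ℝ} {r ρ : ℝ}

theorem DegreeInv.tail {D f s : List (Fin n)} {w : Fin n} (h : DegreeInv G deg D f (w :: s)) :
    DegreeInv G deg D f s := fun v hv => by
  have := h v hv
  rw [List.count_cons] at this
  omega

theorem length_aliveNbrs_cons {D : List (Fin n)} {w i : Fin n} (hw : w ∉ D) (hi : i ∉ w :: D) :
    (aliveNbrs G D i).length =
      (aliveNbrs G (w :: D) i).length + (aliveNbrs G (w :: D) w).count i := by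
  rw [aliveNbrs_cons_self, List.Nodup.count (nodup_aliveNbrs G D w)]
  rw [List.mem_cons, not_or] at hi
  have h : ∀ D' : List (Fin n), (aliveNbrs G D' i).length = (aliveNbrs G D' i).toFinset.card :=
    fun D' => (List.toFinset_card_of_nodup (nodup_aliveNbrs G D' i)).symm
  rw [h, h]
  by_cases hadj : G.Adj w i
  · rw [if_pos (by simp [hadj, hi.2]), ← Finset.card_insert_of_notMem (a := w) (by simp)]
    congr 1
    ext j
    by_cases hj : j = w
    · simp [hj, hadj.symm, hw]
    · simp [hj]
  · rw [if_neg (by simp [hadj]), add_zero]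
    congr 1
    ext j
    by_cases hj : j = w
    · simp [hj, G.adj_comm, hadj]
    · simp [hj]

/-- Deleting `w` trades each edge into `w` for one pending field at the other end, so the total seen
by a surviving vertex does not grow. -/
theorem DegreeInv.cons {D f s : List (Fin n)} {w : Fin n} (h : DegreeInv G deg D f s)
    (hw : w ∉ D) : DegreeInv G deg (w :: D) f (aliveNbrs G (w :: D) w ++ s) := fun i hi => by
  have h1 := h i (fun h' => hi (List.mem_cons_of_mem _ h'))
  rw [length_aliveNbrs_cons hw hi] at h1
  rw [List.count_append]
  omega

theorem DegreeInv.append {D f s : List (Fin n)} (h : DegreeInv G deg D f s) :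
    DegreeInv G deg D (s ++ f) [] := fun w hw => by
  have := h w hw
  rw [List.count_append, List.count_nil]
  omega

theorem fieldFactor_nonneg (hβ : 0 ≤ β) (F : List (Fin n × Fin q)) (w : Fin n) (y : Fin q) :
    0 ≤ fieldFactor β F w y := by
  rw [fieldFactor_eq_pow]
  positivity

/-- Every field at `w` carries one factor `one`, whether or not its color matches. The scale is thus
a power that depends only on the positions of the fields and not on `y`. -/
theorem intFactor_near (hβ : 0 ≤ β) (hb : Near ρ b (one * β)) (hρ : 0 ≤ ρ)
    (F : List (Fin n × Fin q)) (w : Fin n) (y : Fin q) :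
    Near ((F.map Prod.fst).count w * ρ) (intFactor one b F w y)
      (one ^ (F.map Prod.fst).count w * fieldFactor β F w y) := by
  induction F with
  | nil => simpa [intFactor, fieldFactor] using Near.refl 1
  | cons p F ih =>
    have hnn : (0 : ℝ) ≤ one ^ (F.map Prod.fst).count w * fieldFactor β F w y :=
      mul_nonneg (by positivity) (fieldFactor_nonneg hβ F w y)
    by_cases hp : p.1 = w
    · have h1 : Near ρ ((if p.2 = y then b else one : ℕ) : ℝ) (one * if p.2 = y then β else 1) := by
        split_ifs
        · exact hb
        · simpa using (Near.refl (one : ℝ)).mono (by positivity) hρ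
      have h2 := h1.mul ih (by split_ifs <;> positivity) hnn
      have e1 : ρ + ((F.map Prod.fst).count w : ℝ) * ρ =
          (((p :: F).map Prod.fst).count w : ℕ) * ρ := by
        simp [hp]; ring
      have e2 : ((intFactor one b (p :: F) w y : ℕ) : ℝ) =
          ((if p.2 = y then b else one : ℕ) : ℝ) * (intFactor one b F w y : ℝ) := by
        simp [intFactor, hp]
      have e3 : (one : ℝ) ^ ((p :: F).map Prod.fst).count w * fieldFactor β (p :: F) w y =
          (one * if p.2 = y then β else 1) *
            (one ^ (F.map Prod.fst).count w * fieldFactor β F w y) := by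
        simp [fieldFactor, hp, pow_succ]; ring_nf
      rw [← e1, e2, e3]
      exact h2
    · have e2 : intFactor one b (p :: F) w y = intFactor one b F w y := by
        simp [intFactor, hp]
      have e3 : fieldFactor β (p :: F) w y = fieldFactor β F w y := by
        simp [fieldFactor, hp]
      have e1 : ((p :: F).map Prod.fst).count w = (F.map Prod.fst).count w := by
        simp [hp]
      rw [e1, e2, e3]
      exact ih

/-- The error of an estimate of `1 - g p` that is clamped at `φ`. -/
theorem near_clamp {g X φ p p' ε τ t : ℝ} (hg : 0 < g) (hX : 0 < X)
    (hφ1 : X ≤ φ * (X + g)) (hφ2 : φ * (X + 1 + g) ≤ X + 1) (hφ : 1 / 2 ≤ φ)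
    (hp0 : 0 ≤ p) (hp : (X + 1 + g) * p ≤ 1) (hε : 0 ≤ ε) (hp' : Near ε p' p)
    (ht : |t - (1 - g * p')| ≤ τ) :
    Near (g / X * ε + 2 * τ) (max φ t) (1 - g * p) := by
  -- The bound on the marginal places the true value above the clamp, so clamping can only move the
  -- estimate towards it.
  have hf : φ ≤ 1 - g * p := by
    have h1 : φ * (X + 1 + g) ≤ (1 - g * p) * (X + 1 + g) := by nlinarith
    exact le_of_mul_le_mul_right h1 (by positivity)
  set f := 1 - g * p with hf_def
  set m := max φ (1 - g * p') with hm_def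
  have hp'0 : 0 ≤ p' := hp'.nonneg hp0
  have hτ : 0 ≤ τ := (abs_nonneg _).trans ht
  have hmM : |max φ t - m| ≤ τ := (abs_max_sub_max_le_max _ _ _ _).trans (max_le (by simpa using hτ) ht)
  have hm : φ ≤ m := le_max_left _ _
  have hM : φ ≤ max φ t := le_max_left _ _
  have hm1 : m ≤ 1 := max_le (hf.trans (by nlinarith)) (by nlinarith)
  rw [abs_le] at hmM
  -- The ratio `(1 - z) / z` is the logarithmic slope of `p ↦ 1 - g p` at the value `z`, up to sign.
  -- The lower bound `X / (X + g)` on the clamp is what makes it at most `g / X`.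
  have hκ : ∀ z, φ ≤ z → 1 - z ≤ g / X * z := by
    intro z hz
    have h2 : g / X * z = g * z / X := by ring
    rw [h2, le_div_iff₀ hX]
    nlinarith
  have hκ0 : 0 ≤ g / X * ε := by positivity
  have e1 : m ≤ Real.exp (g / X * ε) * f := by
    refine le_trans ?_ (mul_le_mul_of_nonneg_right (Real.add_one_le_exp _) (by linarith))
    refine max_le (by nlinarith) ?_
    have h1 := hp'.1
    have h2 := Real.add_one_le_exp (-ε)
    have h3 : (1 - ε) * p ≤ p' := by nlinarith
    have h4 := mul_le_mul_of_nonneg_right (hκ f hf) hε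
    have h5 := mul_le_mul_of_nonneg_left h3 hg.le
    have h6 : 1 - f = g * p := by rw [hf_def]; ring
    rw [h6] at h4
    nlinarith
  have e2 : f ≤ Real.exp (g / X * ε) * m := by
    refine le_trans ?_ (mul_le_mul_of_nonneg_right (Real.add_one_le_exp _) (by linarith))
    have h1 : (1 - m) / g ≤ p' := by
      rw [div_le_iff₀ hg]
      have := le_max_right φ (1 - g * p')
      linarith
    have h2 : (1 - m) / g * (1 - ε) ≤ p := by
      have h3 := hp'.symm.1
      have h4 := Real.add_one_le_exp (-ε)
      have h5 : Real.exp (-ε) * ((1 - m) / g) ≤ p :=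
        (mul_le_mul_of_nonneg_left h1 (Real.exp_nonneg _)).trans h3
      have h6 : 0 ≤ (1 - m) / g := div_nonneg (by linarith) hg.le
      nlinarith
    have h7 : (1 - m) * (1 - ε) ≤ g * p := by
      have := mul_le_mul_of_nonneg_left h2 hg.le
      have h8 : g * ((1 - m) / g * (1 - ε)) = (1 - m) * (1 - ε) := by field_simp
      linarith
    have h4 := mul_le_mul_of_nonneg_right (hκ m hm) hε
    nlinarith
  -- The additive error `τ` becomes the factor `exp (2 τ)` because both quantities are at least `1 /
  -- 2`.
  have e3 : max φ t ≤ Real.exp (2 * τ) * m := by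
    have := Real.add_one_le_exp (2 * τ)
    nlinarith [mul_le_mul_of_nonneg_right this (show 0 ≤ m by linarith)]
  have e4 : m ≤ Real.exp (2 * τ) * max φ t := by
    have := Real.add_one_le_exp (2 * τ)
    nlinarith [mul_le_mul_of_nonneg_right this (show 0 ≤ max φ t by linarith)]
  have e5 : max φ t ≤ Real.exp (g / X * ε + 2 * τ) * f := by
    rw [add_comm, Real.exp_add, mul_assoc]
    exact e3.trans (mul_le_mul_of_nonneg_left e1 (Real.exp_nonneg _))
  have e6 : f ≤ Real.exp (g / X * ε + 2 * τ) * max φ t := by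
    rw [Real.exp_add, mul_assoc]
    exact e2.trans (mul_le_mul_of_nonneg_left e4 (Real.exp_nonneg _))
  refine ⟨?_, e5⟩
  have := mul_le_mul_of_nonneg_left e6 (Real.exp_nonneg (-(g / X * ε + 2 * τ)))
  rwa [← mul_assoc, ← Real.exp_add, neg_add_cancel, Real.exp_zero, one_mul] at this

/-- There are two roundings, `b` and the integer quotient. They push the result in opposite
directions, so together they stay within one unit. -/
theorem abs_scaled_sub_le {one b num den : ℕ} {β : ℝ} (hone' : 0 < one) (hβ1 : β ≤ 1)
    (hb : one * β < b + 1) (hb' : b ≤ one * β) (hle : num ≤ den) (hden' : 0 < den) :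
    |((one - (one - b) * num / den : ℕ) : ℝ) / one - (1 - (1 - β) * ((num : ℝ) / den))| ≤
      1 / one := by
  have hone : (0 : ℝ) < one := by exact_mod_cast hone'
  have hden : (0 : ℝ) < den := by exact_mod_cast hden'
  have hb1 : b ≤ one := by
    have : (b : ℝ) ≤ one := hb'.trans (by nlinarith)
    exact_mod_cast this
  set m := (one - b) * num / den with hm
  have hm1 : m ≤ one := by
    calc m ≤ (one - b) * den / den := Nat.div_le_div_right (Nat.mul_le_mul_left _ hle)
      _ = one - b := Nat.mul_div_cancel _ hden'
      _ ≤ one := Nat.sub_le _ _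
  have hm2 : (m : ℝ) * den ≤ (one - b) * num := by
    have := Nat.div_mul_le_self ((one - b) * num) den
    have h3 : ((m * den : ℕ) : ℝ) ≤ (((one - b) * num : ℕ) : ℝ) := by exact_mod_cast this
    push_cast [Nat.cast_sub hb1] at h3
    exact h3
  have hm3 : ((one : ℝ) - b) * num < (m + 1) * den := by
    have := Nat.lt_div_mul_add hden' (a := (one - b) * num)
    have h3 : (((one - b) * num : ℕ) : ℝ) < ((m * den + den : ℕ) : ℝ) := by exact_mod_cast this
    push_cast [Nat.cast_sub hb1] at h3
    linarith
  set p' : ℝ := (num : ℝ) / den with hp'def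
  have hnum' : (num : ℝ) = p' * den := by rw [hp'def]; field_simp
  have hp'1 : p' ≤ 1 := by
    rw [hp'def, div_le_one hden]
    exact_mod_cast hle
  have hp'0 : 0 ≤ p' := by positivity
  have hm4 : (m : ℝ) ≤ (one - b) * p' := by
    rw [hnum', ← mul_assoc] at hm2
    exact le_of_mul_le_mul_right hm2 hden
  have hm5 : ((one : ℝ) - b) * p' < m + 1 := by
    rw [hnum', ← mul_assoc] at hm3
    exact lt_of_mul_lt_mul_right hm3 hden.le
  rw [Nat.cast_sub hm1]
  have e1 : ((one : ℝ) - m) / one - (1 - (1 - β) * p') =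
      (((1 - β) * one) * p' - m) / one := by field_simp; ring
  rw [e1, abs_div, abs_of_pos hone]
  refine div_le_div_of_nonneg_right ?_ hone.le
  rw [abs_le]
  constructor <;> nlinarith

/-- Assumptions on the scaled parameters of the recursion. -/
structure ScaleOK (β : ℝ) (q one b : ℕ) (cl deg : Fin n → ℕ) (δ : Fin n → ℝ) (r ρ : ℝ) : Prop where
  beta_nonneg : 0 ≤ β
  beta_lt : β < 1
  one_pos : 0 < one
  le_b : one * β < b + 1
  b_le : b ≤ one * β
  near_b : Near ρ b (one * β)
  rho_nonneg : 0 ≤ ρ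
  rho_le : ∀ w, deg w * ρ ≤ r
  inv_le : 2 / (one : ℝ) ≤ r
  delta_nonneg : ∀ w, 0 ≤ δ w
  denom_pos : ∀ w, cl w ≠ 0 → 0 < (q : ℝ) - 1 - (1 - β) * deg w
  delta_eq : ∀ w, cl w ≠ 0 → δ w = 2 * (1 - β) / ((q : ℝ) - 1 - (1 - β) * deg w)
  le_cl : ∀ w, cl w ≠ 0 → one * ((q : ℝ) - 1 - (1 - β) * deg w) ≤
    cl w * ((q : ℝ) - 1 - (1 - β) * deg w + (1 - β))
  cl_le : ∀ w, cl w ≠ 0 → cl w * ((q : ℝ) - 1 - (1 - β) * deg w + 1 + (1 - β)) ≤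
    one * ((q : ℝ) - 1 - (1 - β) * deg w + 1)
  half_le : ∀ w, cl w ≠ 0 → (one : ℝ) ≤ 2 * cl w

variable {rec : ℕ → List (Fin n) → List (Fin n × Fin q) → List (Fin n × Fin q) → ℕ}

/-- The constant in front of `fieldZAt` is the same for all colors `y`. The degree invariant allows
at most `deg w` fields at `w`, so their rounding errors `ρ` sum to at most `r`. -/
theorem colorStep_near (h : ScaleOK β q one b cl deg δ r ρ) {k : ℕ} {D : List (Fin n)}
    {F Q : List (Fin n × Fin q)} {w : Fin n} (hw : w ∉ D) {E κ : ℝ} (hκ : 0 < κ)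
    (hinv : DegreeInv G deg D (F.map Prod.fst) (Q.map Prod.fst))
    (hrec : ∀ Q', Q'.map Prod.fst = aliveNbrs G (w :: D) w ++ Q.map Prod.fst →
      DegreeInv G deg (w :: D) (F.map Prod.fst) (Q'.map Prod.fst) →
      Near E (rec (k - 1) (w :: D) F Q') (κ * fieldZ G β (w :: D) (Q' ++ F))) (y : Fin q) :
    Near (r + E) (colorStep G one b rec k D F Q w y)
      (κ * one ^ (F.map Prod.fst).count w * one ^ (Q.map Prod.fst).count w * q *
        fieldZAt G β D (Q ++ F) w y) := by
  have hβ := h.beta_nonneg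
  have h1 := hrec ((aliveNbrs G (w :: D) w).map (·, y) ++ Q) (by simp [Function.comp_def])
    (by simpa [Function.comp_def] using hinv.cons hw)
  have h2 := intFactor_near hβ h.near_b h.rho_nonneg F w y
  have h3 := intFactor_near hβ h.near_b h.rho_nonneg Q w y
  have nF : (0 : ℝ) ≤ one ^ (F.map Prod.fst).count w * fieldFactor β F w y :=
    mul_nonneg (by positivity) (fieldFactor_nonneg hβ F w y)
  have nQ : (0 : ℝ) ≤ one ^ (Q.map Prod.fst).count w * fieldFactor β Q w y :=
    mul_nonneg (by positivity) (fieldFactor_nonneg hβ Q w y)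
  have nZ := mul_nonneg hκ.le (fieldZ_nonneg G hβ (w :: D)
    ((aliveNbrs G (w :: D) w).map (·, y) ++ Q ++ F))
  have h4 := ((h2.mul h3 nF nQ).mul h1 (mul_nonneg nF nQ) nZ).mono
    (mul_nonneg (mul_nonneg nF nQ) nZ) (E' := r + E) (by
      have h5 : (((F.map Prod.fst).count w + (Q.map Prod.fst).count w : ℕ) : ℝ) ≤ deg w := by
        exact_mod_cast (Nat.le_add_right _ _).trans (hinv w hw)
      have h6 := mul_le_mul_of_nonneg_right h5 h.rho_nonneg
      have := h.rho_le w
      push_cast at h6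
      linarith)
  have h7 := mul_fieldZAt_eq G (β := β) hw (Q ++ F) y
  rw [fieldFactor_append, ← List.append_assoc] at h7
  have h8 : κ * one ^ (F.map Prod.fst).count w * one ^ (Q.map Prod.fst).count w * q *
      fieldZAt G β D (Q ++ F) w y = one ^ (F.map Prod.fst).count w * fieldFactor β F w y *
        (one ^ (Q.map Prod.fst).count w * fieldFactor β Q w y) *
          (κ * fieldZ G β (w :: D) ((aliveNbrs G (w :: D) w).map (·, y) ++ Q ++ F)) := by
    calc _ = κ * one ^ (F.map Prod.fst).count w * one ^ (Q.map Prod.fst).count w *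
          (q * fieldZAt G β D (Q ++ F) w y) := by ring
      _ = _ := by rw [h7]; ring
  rw [h8]
  convert h4 using 1
  simp [colorStep]

/-- The ratio of the contributions of the colors approximates the marginal probability. -/
theorem ratio_near (h : ScaleOK β q one b cl deg δ r ρ) {k : ℕ} {D : List (Fin n)}
    {F : List (Fin n × Fin q)} {w : Fin n} (hw : w ∉ D) {E κ : ℝ} (hκ : 0 < κ)
    (hZ : 0 < fieldZ G β D F) (hinv : DegreeInv G deg D (F.map Prod.fst) [])
    (hrec : ∀ Q', Q'.map Prod.fst = aliveNbrs G (w :: D) w →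
      DegreeInv G deg (w :: D) (F.map Prod.fst) (Q'.map Prod.fst) →
      Near E (rec (k - 1) (w :: D) F Q') (κ * fieldZ G β (w :: D) (Q' ++ F))) (a : Fin q) :
    (0 : ℝ) < (∑ y, colorStep G one b rec k D F [] w y : ℕ) ∧
    Near (2 * (r + E)) ((colorStep G one b rec k D F [] w a : ℝ) /
      (∑ y, colorStep G one b rec k D F [] w y : ℕ)) (fieldZAt G β D F w a / fieldZ G β D F) := by
  have hq0 : (0 : ℝ) < q := by exact_mod_cast a.pos
  have hone : (0 : ℝ) < one := by exact_mod_cast h.one_pos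
  have h1 : ∀ y, _ := colorStep_near h hw (Q := []) hκ (k := k) hinv (by simpa using hrec)
  simp only [List.nil_append, List.map_nil, List.count_nil, pow_zero, mul_one] at h1
  set c : ℝ := κ * one ^ (F.map Prod.fst).count w * q with hc
  have hc0 : 0 < c := by positivity
  have h2 := Near.sum Finset.univ fun y _ => h1 y
  rw [← Finset.mul_sum, ← fieldZ_eq_sum] at h2
  have hcZ : 0 < c * fieldZ G β D F := by positivity
  push_cast
  refine ⟨h2.pos hcZ, ?_⟩
  -- The common constant cancels, but numerator and denominator both carry the error `r + E`. This
  -- is the origin of the 2 in `δ`.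
  have h3 := (h1 a).div h2 (mul_nonneg hc0.le (fieldZAt_nonneg G h.beta_nonneg _ _ _ _)) hcZ
  rw [mul_div_mul_left _ _ hc0.ne', ← two_mul] at h3
  exact h3

/-- The slope `(1 - β) / X` of `near_clamp` meets the doubled error of `ratio_near`, and the product
is `δ w * (r + E)`. The final `r` absorbs the rounding of the quotient. -/
theorem estStep_near (h : ScaleOK β q one b cl deg δ r ρ) {k : ℕ} {D : List (Fin n)}
    {F : List (Fin n × Fin q)} {w : Fin n} (hw : w ∉ D) (hcl : cl w ≠ 0) {E κ : ℝ} (hE : 0 ≤ E)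
    (hκ : 0 < κ) (a : Fin q) (hZ : 0 < fieldZ G β D F)
    (hinv : DegreeInv G deg D ((w :: F.map Prod.fst)) [])
    (hrec : k ≠ 0 → ∀ Q', Q'.map Prod.fst = aliveNbrs G (w :: D) w →
      DegreeInv G deg (w :: D) (F.map Prod.fst) (Q'.map Prod.fst) →
      Near E (rec (k - 1) (w :: D) F Q') (κ * fieldZ G β (w :: D) (Q' ++ F))) :
    Near (if k = 0 then δ w else δ w * (r + E) + r) (estStep G one b cl rec k D F w a)
      (one * (1 - (1 - β) * (fieldZAt G β D F w a / fieldZ G β D F))) := by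
  have hg : 0 < 1 - β := sub_pos.2 h.beta_lt
  have hone : (0 : ℝ) < one := by exact_mod_cast h.one_pos
  have hX := h.denom_pos w hcl
  set X : ℝ := (q : ℝ) - 1 - (1 - β) * deg w with hXdef
  set p := fieldZAt G β D F w a / fieldZ G β D F with hp
  have hp0 : 0 ≤ p := div_nonneg (fieldZAt_nonneg G h.beta_nonneg _ _ _ _) hZ.le
  have hp1 : (X + 1 + (1 - β)) * p ≤ 1 := by
    rw [hp, ← mul_div_assoc, div_le_one hZ]
    -- The field under elimination occupies a slot of the invariant at `w` but is not part of `F`;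
    -- this gives the `- 1`.
    have h1 : (((F.filter (fun p => p.1 = w)).length + (aliveNbrs G D w).length : ℕ) : ℝ) ≤
        deg w - 1 := by
      have h2 := hinv w hw
      have h3 : (F.filter (fun p => p.1 = w)).length = (F.map Prod.fst).count w := by
        rw [List.count, List.countP_map, List.countP_eq_length_filter]
        rfl
      rw [le_sub_iff_add_le]
      rw [List.count_cons_self, List.count_nil, ← h3] at h2
      exact_mod_cast (by omega :
        (F.filter (fun p => p.1 = w)).length + (aliveNbrs G D w).length + 1 ≤ deg w)
    have h4 := mul_fieldZAt_le G h.beta_nonneg h.beta_lt.le hw F a h1 (by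
      have : (q : ℝ) - (1 - β) * (deg w - 1) = X + 1 + (1 - β) := by rw [hXdef]; ring
      rw [this]; positivity)
    have e : X + 1 + (1 - β) = (q : ℝ) - (1 - β) * (deg w - 1) := by rw [hXdef]; ring
    rwa [e]
  set φ : ℝ := cl w / one with hφ
  have hφ1 : X ≤ φ * (X + (1 - β)) := by
    rw [hφ, div_mul_eq_mul_div, le_div_iff₀ hone]
    have := h.le_cl w hcl
    linarith
  have hφ2 : φ * (X + 1 + (1 - β)) ≤ X + 1 := by
    rw [hφ, div_mul_eq_mul_div, div_le_iff₀ hone]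
    have := h.cl_le w hcl
    linarith
  have hφ3 : 1 / 2 ≤ φ := by
    rw [hφ, le_div_iff₀ hone]
    have := h.half_le w hcl
    linarith
  have hδ : (1 - β) / X * 2 = δ w := by
    rw [h.delta_eq w hcl]; ring
  have hone0 : (one : ℝ) ≠ 0 := hone.ne'
  by_cases hk : k = 0
  · rw [if_pos hk, estStep, if_pos hk]
    -- At the cut-off the estimate is 1. The true value lies between `X / (X + 1 - β)` and 1, hence
    -- within a factor `1 + (1 - β) / X`.
    have h1 : Near (δ w) 1 (1 - (1 - β) * p) := by
      have hf : X ≤ (1 - (1 - β) * p) * (X + (1 - β)) := by nlinarith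
      have hf1 : (1 - β) * p ≤ (1 - β) / X * (1 - (1 - β) * p) := by
        rw [div_mul_eq_mul_div, le_div_iff₀ hX]
        nlinarith
      have hf0 : 0 ≤ 1 - (1 - β) * p := by
        by_contra hneg
        push Not at hneg
        nlinarith
      constructor
      · have h2 : Real.exp (-δ w) ≤ 1 := Real.exp_le_one_iff.2 (by linarith [h.delta_nonneg w])
        have h3 : 1 - (1 - β) * p ≤ 1 := by nlinarith
        nlinarith [Real.exp_nonneg (-δ w)]
      · have h2 := Real.add_one_le_exp (δ w)
        have h3 := h.delta_nonneg w
        have h4 : (1 - β) / X ≤ δ w := by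
          have : 0 ≤ (1 - β) / X := by positivity
          linarith
        nlinarith
    simpa using h1.const_mul hone.le
  · rw [if_neg hk, estStep, if_neg hk]
    have hinv' : DegreeInv G deg D (F.map Prod.fst) [] := fun v hv => by
      have := hinv v hv
      rw [List.count_cons] at this
      omega
    obtain ⟨hden, hp'⟩ := ratio_near h hw hκ hZ hinv' (hrec hk) a
    set num := colorStep G one b rec k D F [] w a with hnum
    set den := ∑ y, colorStep G one b rec k D F [] w y with hdendef
    have hle : num ≤ den := Finset.single_le_sum
      (f := fun y => colorStep G one b rec k D F [] w y) (fun _ _ => Nat.zero_le _)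
      (Finset.mem_univ a)
    set m := (one - b) * num / den with hm
    set p' : ℝ := (num : ℝ) / den with hp'def
    have ht : |((one - m : ℕ) : ℝ) / one - (1 - (1 - β) * p')| ≤ 1 / one :=
      abs_scaled_sub_le h.one_pos h.beta_lt.le h.le_b h.b_le hle (by exact_mod_cast hden)
    have hrE : 0 ≤ 2 * (r + E) := by
      have := h.inv_le
      have : 0 < 2 / (one : ℝ) := by positivity
      linarith
    have key := near_clamp hg hX hφ1 hφ2 hφ3 hp0 hp1 hrE hp' ht
    have e2 : ((max (cl w) (one - m) : ℕ) : ℝ) = one * max φ (((one - m : ℕ) : ℝ) / one) := by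
      rw [hφ, mul_max_of_nonneg _ _ hone.le, mul_div_cancel₀ _ hone0, mul_div_cancel₀ _ hone0,
        Nat.cast_max]
    have hf0 : 0 ≤ 1 - (1 - β) * p := by
      have : (1 - β) * p ≤ 1 := by nlinarith
      linarith
    rw [e2]
    refine (key.mono hf0 ?_).const_mul hone.le
    have : (1 - β) / X * (2 * (r + E)) = δ w * (r + E) := by rw [← hδ]; ring
    rw [this]
    have := h.inv_le
    have e3 : 2 * (1 / (one : ℝ)) = 2 / one := by ring
    linarith

theorem err_nonneg (hδ : ∀ w, 0 ≤ δ w) (hr : 0 ≤ r) (N k : ℕ) (D s : List (Fin n)) :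
    0 ≤ err G cl δ r N k D s := by
  induction N generalizing k D s with
  | zero => simp [err]
  | succ N ih =>
    induction s with
    | nil => simp [err, errStep]
    | cons w s ihs =>
      rw [err, errStep]
      rw [err] at ihs
      split_ifs
      · exact ihs
      · exact add_nonneg hr (ih _ _ _)
      · exact add_nonneg (hδ w) ihs
      · exact add_nonneg (add_nonneg (mul_nonneg (hδ w) (add_nonneg hr (ih _ _ _))) hr) ihs

/-- Up to a factor that does not depend on the colors of the pending fields, `val` approximates the
partition function. -/
theorem val_near (h : ScaleOK β q one b cl deg δ r ρ) (hq : 0 < q) (N k : ℕ) (D : List (Fin n))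
    (hN : alive D < N) (F : List (Fin n × Fin q)) (s : List (Fin n)) (hZ : 0 < fieldZ G β D F) :
    ∃ κ : ℝ, 0 < κ ∧ ∀ Q : List (Fin n × Fin q), Q.map Prod.fst = s →
      DegreeInv G deg D (F.map Prod.fst) (Q.map Prod.fst) →
      Near (err G cl δ r N k D s) (val G one b cl N k D F Q) (κ * fieldZ G β D (Q ++ F)) := by
  have hβ := h.beta_nonneg
  have hone : (0 : ℝ) < one := by exact_mod_cast h.one_pos
  have hq0 : (0 : ℝ) < q := by exact_mod_cast hq
  have hr : 0 ≤ r := le_trans (by positivity) h.inv_le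
  induction N generalizing k D F s with
  | zero => omega
  | succ N ih =>
    have hlt : ∀ w, w ∉ D → alive (w :: D) < N := fun w hw => by
      have := alive_cons_lt hw
      omega
    have hZc : ∀ w, w ∉ D → ∀ F : List (Fin n × Fin q), 0 < fieldZ G β D F →
        0 < fieldZ G β (w :: D) F :=
      fun w hw F hF => hF.trans_le (fieldZ_le_cons G hβ h.beta_lt.le hw F)
    induction s with
    | nil =>
      -- With no pending fields the recursion returns 1, so the unknown factor is the inverse of the
      -- partition function itself.
      refine ⟨(fieldZ G β D F)⁻¹, inv_pos.2 hZ, fun Q hQ _ => ?_⟩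
      rw [List.map_eq_nil_iff] at hQ
      subst hQ
      have : (fieldZ G β D F)⁻¹ * fieldZ G β D ([] ++ F) = 1 := by
        rw [List.nil_append, inv_mul_cancel₀ hZ.ne']
      rw [this]
      simpa [err, errStep, val, valStep] using Near.refl 1
    | cons w s ihs =>
      obtain ⟨κ₁, hκ₁, ih₁⟩ := ihs
      by_cases hw : w ∈ D
      · refine ⟨κ₁, hκ₁, fun Q hQ hinv => ?_⟩
        obtain ⟨⟨w', a⟩, Q, rfl, rfl, rfl⟩ := List.map_eq_cons_iff.1 hQ
        have h1 := ih₁ Q rfl hinv.tail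
        rw [List.cons_append, fieldZ_cons_of_mem G hw]
        simpa [err, errStep, val, valStep, hw] using h1
      by_cases hcl : cl w = 0
      · obtain ⟨κ, hκ, ih₂⟩ := ih (k - 1) (w :: D) (hlt w hw) F
          (aliveNbrs G (w :: D) w ++ (w :: s)) (hZc w hw F hZ)
        refine ⟨κ * one ^ (F.map Prod.fst).count w * one ^ (w :: s).count w * q, by positivity,
          fun Q hQ hinv => ?_⟩
        have h1 := fun y => colorStep_near h hw hκ (k := k) hinv
          (fun Q' hQ' hinv' => ih₂ Q' (by rw [hQ', hQ]) hinv') y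
        have h2 := Near.sum Finset.univ fun y _ => h1 y
        rw [← Finset.mul_sum, ← fieldZ_eq_sum, hQ] at h2
        obtain ⟨⟨w', a⟩, Q, rfl, rfl, rfl⟩ := List.map_eq_cons_iff.1 hQ
        simpa [err, errStep, val, valStep, hw, hcl] using h2
      · refine ⟨κ₁ * one, by positivity, fun Q hQ hinv => ?_⟩
        obtain ⟨⟨w', a⟩, Q, rfl, rfl, rfl⟩ := List.map_eq_cons_iff.1 hQ
        have h1 := ih₁ Q rfl hinv.tail
        simp only at hw hcl h1
        have hval : val G one b cl (N + 1) k D F ((w', a) :: Q) =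
            estStep G one b cl (val G one b cl N) k D (Q ++ F) w' a *
              val G one b cl (N + 1) k D F Q := by
          simp [val, valStep, hw, hcl]
        have herr : err G cl δ r (N + 1) k D (w' :: Q.map Prod.fst) =
            (if k = 0 then δ w' else δ w' *
              (r + err G cl δ r N (k - 1) (w' :: D) (aliveNbrs G (w' :: D) w')) + r) +
              err G cl δ r (N + 1) k D (Q.map Prod.fst) := by
          simp [err, errStep, hw, hcl]
        rw [hval, herr, List.cons_append]
        -- When `β = 0` the remaining pending fields may already exclude all configurations. Then
        -- both sides vanish, and the marginal at `w'` need not make sense.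
        rcases (fieldZ_nonneg G hβ D (Q ++ F)).eq_or_lt with h0 | hpos
        · have e1 : fieldZ G β D ((w', a) :: (Q ++ F)) = 0 := by
            refine le_antisymm ?_ (fieldZ_nonneg G hβ _ _)
            rw [fieldZ_cons G hw, ← h0]
            have := mul_nonneg (sub_nonneg.2 h.beta_lt.le) (fieldZAt_nonneg G hβ D (Q ++ F) w' a)
            linarith
          rw [← h0, mul_zero] at h1
          have e2 : (val G one b cl (N + 1) k D F Q : ℝ) = 0 :=
            le_antisymm (by simpa using h1.2) (h1.nonneg le_rfl)
          rw [e1]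
          simp [Near, e2]
        -- The factor `κ` obtained here may depend on the colors in `Q`. It does no harm, because it
        -- is used only inside a ratio; the factor passed on is `κ₁ * one`.
        · obtain ⟨κ, hκ, ih₂⟩ := ih (k - 1) (w' :: D) (hlt w' hw) (Q ++ F)
            (aliveNbrs G (w' :: D) w') (hZc w' hw _ hpos)
          have hinv' : DegreeInv G deg D (w' :: (Q ++ F).map Prod.fst) [] := by
            simpa using hinv.append
          have h2 := estStep_near h hw hcl (k := k) (err_nonneg h.delta_nonneg hr _ _ _ _) hκ a hpos
            hinv' (fun _ Q' hQ' hinv'' => ih₂ Q' hQ' hinv'')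
          have hp : (1 - (1 - β) * (fieldZAt G β D (Q ++ F) w' a / fieldZ G β D (Q ++ F))) *
              fieldZ G β D (Q ++ F) = fieldZ G β D ((w', a) :: (Q ++ F)) := by
            rw [fieldZ_cons G hw]
            field_simp
          have hp0 : 0 ≤ 1 - (1 - β) * (fieldZAt G β D (Q ++ F) w' a / fieldZ G β D (Q ++ F)) := by
            have := fieldZ_nonneg G hβ D ((w', a) :: (Q ++ F))
            rw [← hp] at this
            exact nonneg_of_mul_nonneg_left this hpos
          have h3 := h2.mul h1 (mul_nonneg hone.le hp0) (mul_nonneg hκ₁.le hpos.le)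
          have e3 : (one : ℝ) * (1 - (1 - β) * (fieldZAt G β D (Q ++ F) w' a /
              fieldZ G β D (Q ++ F))) * (κ₁ * fieldZ G β D (Q ++ F)) =
              κ₁ * one * fieldZ G β D ((w', a) :: (Q ++ F)) := by
            rw [← hp]; ring
          rw [e3] at h3
          exact_mod_cast h3

end Error

end Potts


namespace Potts

/-! ### Weighted self-avoiding walks -/

section Walks

variable {n : ℕ} (G : SimpleGraph (Fin n)) [DecidableRel G.Adj]

/-- The sum over the walks of length `ℓ` from `v` that avoid `D` and themselves, of the product of
the weights of their vertices after `v`. -/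
noncomputable def saw (ω : Fin n → ℝ) : ℕ → List (Fin n) → Fin n → ℝ
  | 0 => fun _ _ => 1
  | ℓ + 1 => fun D v => ((aliveNbrs G D v).map fun i => ω i * saw ω ℓ (i :: D) i).sum

/-- The total weight of the self-avoiding walks with fewer than `N` steps that avoid `D` and start
with a step to `w`, where walks of length `m` are counted with the factor `g (h + m)`. -/
noncomputable def pot (ω : Fin n → ℝ) (g : ℕ → ℝ) : ℕ → ℕ → List (Fin n) → Fin n → ℝ
  | 0 => fun _ _ _ => 0
  | N + 1 => fun h D w => ω w * (g (h + 1) +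
      ((aliveNbrs G (w :: D) w).map fun i => pot ω g N (h + 1) (w :: D) i).sum)

variable {ω : Fin n → ℝ} {g : ℕ → ℝ}

theorem saw_nonneg (hω : ∀ i, 0 ≤ ω i) (ℓ : ℕ) (D : List (Fin n)) (v : Fin n) :
    0 ≤ saw G ω ℓ D v := by
  induction ℓ generalizing D v with
  | zero => simp [saw]
  | succ ℓ ih =>
    refine List.sum_nonneg ?_
    simp only [List.mem_map]
    rintro _ ⟨i, _, rfl⟩
    exact mul_nonneg (hω i) (ih _ _)

theorem pot_nonneg (hω : ∀ i, 0 ≤ ω i) (hg : ∀ j, 0 ≤ g j) (N h : ℕ) (D : List (Fin n))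
    (w : Fin n) : 0 ≤ pot G ω g N h D w := by
  induction N generalizing h D w with
  | zero => simp [pot]
  | succ N ih =>
    refine mul_nonneg (hω w) (add_nonneg (hg _) (List.sum_nonneg ?_))
    simp only [List.mem_map]
    rintro _ ⟨i, _, rfl⟩
    exact ih _ _ _

theorem sum_map_le_sum_map_of_sublist {α : Type*} {l l' : List α} (h : l.Sublist l') {f f' : α → ℝ}
    (hf : ∀ i, f i ≤ f' i) (hf' : ∀ i, 0 ≤ f' i) : (l.map f).sum ≤ (l'.map f').sum := by
  induction h with
  | slnil => simp
  | cons a _ ih =>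
    simp only [List.map_cons, List.sum_cons]
    linarith [hf' a]
  | cons_cons a _ ih =>
    simp only [List.map_cons, List.sum_cons]
    linarith [hf a]

theorem aliveNbrs_sublist {D D' : List (Fin n)} (h : D ⊆ D') (w : Fin n) :
    (aliveNbrs G D' w).Sublist (aliveNbrs G D w) := by
  refine List.monotone_filter_right _ fun i hi => ?_
  simp only [decide_eq_true_eq] at hi ⊢
  exact ⟨hi.1, fun h' => hi.2 (h h')⟩

/-- Deleting more vertices, or allowing fewer steps, leaves fewer walks to count. -/
theorem pot_anti (hω : ∀ i, 0 ≤ ω i) (hg : ∀ j, 0 ≤ g j) {N N' : ℕ} (hN : N ≤ N') (h : ℕ)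
    {D D' : List (Fin n)} (hD : D ⊆ D') (w : Fin n) :
    pot G ω g N h D' w ≤ pot G ω g N' h D w := by
  induction N generalizing N' h D D' w with
  | zero => exact pot_nonneg G hω hg _ _ _ _
  | succ N ih =>
    obtain ⟨N', rfl⟩ : ∃ m, N' = m + 1 := ⟨N' - 1, by omega⟩
    have hD' : w :: D ⊆ w :: D' := List.cons_subset_cons _ hD
    refine mul_le_mul_of_nonneg_left (add_le_add le_rfl ?_) (hω w)
    exact sum_map_le_sum_map_of_sublist (aliveNbrs_sublist G hD' w)
      (fun i => ih (by omega) _ hD' i) (fun i => pot_nonneg G hω hg _ _ _ _)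

theorem sum_map_sum_range {α : Type*} (l : List α) (f : α → ℕ → ℝ) (N : ℕ) :
    (l.map fun i => ∑ m ∈ Finset.range N, f i m).sum =
      ∑ m ∈ Finset.range N, (l.map fun i => f i m).sum := by
  induction l with
  | nil => simp
  | cons a l ih => simp [ih, Finset.sum_add_distrib]

/-- Sorting the walks by length turns the recursively defined potential into the sums that the
contraction hypothesis controls. -/
theorem sum_pot_eq (N h : ℕ) (D : List (Fin n)) (v : Fin n) :
    ((aliveNbrs G D v).map fun i => pot G ω g N h D i).sum =
      ∑ m ∈ Finset.range N, g (h + m + 1) * saw G ω (m + 1) D v := by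
  induction N generalizing h D v with
  | zero => simp [pot]
  | succ N ih =>
    simp only [pot, ih]
    have h1 : ∀ i, ω i * (g (h + 1) + ∑ m ∈ Finset.range N, g (h + 1 + m + 1) *
        saw G ω (m + 1) (i :: D) i) =
        ∑ m ∈ Finset.range (N + 1), g (h + m + 1) * (ω i * saw G ω m (i :: D) i) := by
      intro i
      rw [Finset.sum_range_succ', mul_add, Finset.mul_sum, add_comm]
      congr 1
      · refine Finset.sum_congr rfl fun m _ => ?_
        rw [show h + 1 + m + 1 = h + (m + 1) + 1 by ring]
        ring
      · simp [saw]; ring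
    simp only [h1, sum_map_sum_range]
    refine Finset.sum_congr rfl fun m _ => ?_
    rw [List.sum_map_mul_left, saw]

/-- The self-avoiding walks of length `ℓ` from `v` to `w` that avoid `D` after `v`. -/
def avoidingPaths (ℓ : ℕ) (D : List (Fin n)) (v w : Fin n) : Finset (G.Walk v w) :=
  (G.finsetWalkLength ℓ v w).filter fun p => p.IsPath ∧ ∀ x ∈ p.support.tail, x ∉ D

theorem saw_eq_sum (ℓ : ℕ) (D : List (Fin n)) (v : Fin n) (hv : v ∈ D) :
    saw G ω ℓ D v = ∑ w, ∑ p ∈ avoidingPaths G ℓ D v w, ∏ i ∈ Finset.range ℓ,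
      ω (p.getVert (i + 1)) := by
  induction ℓ generalizing D v with
  | zero =>
    rw [Finset.sum_eq_single v]
    · have : avoidingPaths G 0 D v v = {SimpleGraph.Walk.nil} := by
        ext p
        simp only [avoidingPaths, Finset.mem_filter, SimpleGraph.mem_finsetWalkLength_iff,
          Finset.mem_singleton]
        constructor
        · exact fun h => SimpleGraph.Walk.eq_nil_iff_nil.2 (SimpleGraph.Walk.length_eq_zero_iff.1 h.1)
        · rintro rfl
          simp
      simp [saw, this]
    · intro w _ hw
      refine Finset.sum_eq_zero fun p hp => ?_
      simp only [avoidingPaths, Finset.mem_filter, SimpleGraph.mem_finsetWalkLength_iff] at hp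
      exact absurd (SimpleGraph.Walk.eq_of_length_eq_zero hp.1).symm hw
    · simp
  | succ ℓ ih =>
    have h1 : ∀ w, ∑ u ∈ (aliveNbrs G D v).toFinset, ω u * ∑ p ∈ avoidingPaths G ℓ (u :: D) u w,
        ∏ i ∈ Finset.range ℓ, ω (p.getVert (i + 1)) =
        ∑ p ∈ avoidingPaths G (ℓ + 1) D v w, ∏ i ∈ Finset.range (ℓ + 1),
          ω (p.getVert (i + 1)) := by
      intro w
      simp_rw [Finset.mul_sum]
      rw [Finset.sum_sigma']
      -- A nonempty path corresponds to its first step `u` and a path from `u` that also avoids `u`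
      -- afterwards. Since `v` already lies in `D`, the tail cannot return to `v`.
      refine Finset.sum_bij (fun x hx => SimpleGraph.Walk.cons
        (mem_aliveNbrs G |>.1 (List.mem_toFinset.1 (Finset.mem_sigma.1 hx).1)).1 x.2) ?_ ?_ ?_ ?_
      · rintro ⟨u, p⟩ hx
        simp only [Finset.mem_sigma, List.mem_toFinset, mem_aliveNbrs, avoidingPaths,
          Finset.mem_filter, SimpleGraph.mem_finsetWalkLength_iff] at hx
        obtain ⟨⟨_, hu⟩, hl, hp, h⟩ := hx
        have h4 : ∀ x ∈ p.support, x ∉ D := by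
          intro x hx
          rw [← p.cons_tail_support, List.mem_cons] at hx
          rcases hx with rfl | hx
          · exact hu
          · exact fun h5 => h x hx (List.mem_cons_of_mem _ h5)
        simp only [avoidingPaths, Finset.mem_filter, SimpleGraph.mem_finsetWalkLength_iff,
          SimpleGraph.Walk.length_cons, hl, SimpleGraph.Walk.cons_isPath_iff,
          SimpleGraph.Walk.support_cons, List.tail_cons, true_and]
        exact ⟨⟨hp, fun h5 => h4 v h5 hv⟩, h4⟩
      · rintro ⟨u, p⟩ hx ⟨u', p'⟩ hx' h
        simp only [SimpleGraph.Walk.cons.injEq] at h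
        exact Sigma.ext h.1 h.2
      · intro p hp
        simp only [avoidingPaths, Finset.mem_filter, SimpleGraph.mem_finsetWalkLength_iff] at hp
        obtain ⟨hl, hp, h⟩ := hp
        cases p with
        | nil => simp at hl
        | @cons _ u _ hadj p =>
          simp only [SimpleGraph.Walk.length_cons, add_left_inj] at hl
          simp only [SimpleGraph.Walk.support_cons, List.tail_cons] at h
          rw [SimpleGraph.Walk.cons_isPath_iff] at hp
          refine ⟨⟨u, p⟩, ?_, rfl⟩
          simp only [Finset.mem_sigma, List.mem_toFinset, mem_aliveNbrs, avoidingPaths,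
            Finset.mem_filter, SimpleGraph.mem_finsetWalkLength_iff]
          refine ⟨⟨hadj, h u p.start_mem_support⟩, hl, hp.1, fun x hx => ?_⟩
          have h4 := hp.1.support_nodup
          rw [← p.cons_tail_support, List.nodup_cons] at h4
          rw [List.mem_cons, not_or]
          exact ⟨fun h5 => h4.1 (h5 ▸ hx), h x (List.mem_of_mem_tail hx)⟩
      · rintro ⟨u, p⟩ hx
        rw [Finset.prod_range_succ', mul_comm]
        simp
    simp only [← h1]
    rw [Finset.sum_comm]
    change ((aliveNbrs G D v).map fun i => ω i * saw G ω ℓ (i :: D) i).sum = _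
    rw [← List.sum_toFinset _ (nodup_aliveNbrs G D v)]
    refine Finset.sum_congr rfl fun u _ => ?_
    rw [← Finset.mul_sum, ih (u :: D) u (by simp)]

theorem saw_le_sawSum (δ : ℕ → ℝ) (hδ : ∀ d, 0 ≤ δ d) (ℓ : ℕ) (v : Fin n) :
    saw G (fun i => δ (G.degree i)) ℓ [v] v ≤ sawSum δ G v ℓ := by
  rw [saw_eq_sum G ℓ [v] v (by simp), sawSum]
  refine Finset.sum_le_sum fun w _ => ?_
  have h : ∀ p : G.Walk v w, ∏ i ∈ Finset.Icc 1 ℓ, δ (G.degree (p.getVert i)) =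
      ∏ i ∈ Finset.range ℓ, δ (G.degree (p.getVert (i + 1))) := fun p => by
    refine (Finset.prod_Ico_eq_prod_range (fun i => δ (G.degree (p.getVert i))) 1 (ℓ + 1)).trans ?_
    refine Finset.prod_congr (by simp) fun i _ => ?_
    rw [add_comm 1 i]
  refine (Finset.sum_congr rfl fun p _ => (h p).symm).trans_le ?_
  refine (Finset.sum_le_sum_of_subset_of_nonneg
    (t := (G.finsetWalkLength ℓ v w).filter fun p => p.IsPath) ?_ ?_).trans (le_of_eq ?_)
  · intro p hp
    rw [avoidingPaths, Finset.mem_filter] at hp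
    exact Finset.mem_filter.2 ⟨hp.1, hp.2.1⟩
  · exact fun p _ _ => Finset.prod_nonneg fun i _ => hδ _
  · congr!

end Walks

end Potts


namespace Potts

/-! ### The path that leads to a pending vertex -/

section Entry

variable {n : ℕ} (q : ℕ) (β : ℝ) (G : SimpleGraph (Fin n))

theorem subset_minBlock (S : Set (Fin n)) : S ⊆ minBlock q β G ∅ S :=
  (minBlock_isLeast q β G ∅ S (by simp)).1.2

theorem minBlock_mono {S S' : Set (Fin n)} (h : S ⊆ S') :
    minBlock q β G ∅ S ⊆ minBlock q β G ∅ S' :=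
  Set.sInter_subset_sInter fun _ hB => ⟨hB.1, h.trans hB.2⟩

theorem mem_minBlock_of_adj {S : Set (Fin n)} {u w : Fin n} (hu : u ∈ minBlock q β G ∅ S)
    (hadj : G.Adj u w) (hw : ¬ IsLowDegree q β G w) : w ∈ minBlock q β G ∅ S := by
  by_contra h
  exact hw ((minBlock_isLeast q β G ∅ S (by simp)).1.1.2 w h (by simp) ⟨u, hu, hadj.symm⟩)

/-- A path of length `h` from `v₀` through `D \ Λ` to a neighbor of `w`, the block of which covers
`D \ Λ`. -/
def Entry (Λ D : List (Fin n)) (v₀ w : Fin n) (h : ℕ) : Prop :=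
  ∃ (u : Fin n) (p : G.Walk v₀ u), p.IsPath ∧ p.length = h ∧ (∀ x ∈ p.support, x ∈ D ∧ x ∉ Λ) ∧
    G.Adj u w ∧ ∀ x ∈ D, x ∉ Λ → x ∈ minBlock q β G ∅ {y | y ∈ p.support}

/-- The vertices of `D \ Λ` are covered by the block of a path of length at most `L`. -/
def Covered (Λ D : List (Fin n)) (v₀ : Fin n) (L : ℕ) : Prop :=
  ∃ (u : Fin n) (p : G.Walk v₀ u), p.IsPath ∧ p.length ≤ L ∧
    ∀ x ∈ D, x ∉ Λ → x ∈ minBlock q β G ∅ {y | y ∈ p.support}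

/-- The number of elements of `D \ Λ`. -/
def colored (Λ D : List (Fin n)) : ℕ := (D.filter (· ∉ Λ)).length

variable {q β G} {Λ D : List (Fin n)} {v₀ w x : Fin n} {h h' L : ℕ}

theorem colored_cons (hw : w ∉ Λ) : colored Λ (w :: D) = colored Λ D + 1 := by
  simp [colored, hw]

theorem colored_le_ncard (hD : D.Nodup) {S : Set (Fin n)} (hS : ∀ x ∈ D, x ∉ Λ → x ∈ S) :
    colored Λ D ≤ S.ncard := by
  rw [colored, ← List.toFinset_card_of_nodup (hD.filter _), ← Set.ncard_coe_finset]
  refine Set.ncard_le_ncard ?_ (Set.toFinite S)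
  intro x hx
  simp only [List.coe_toFinset, List.mem_filter, Set.mem_ofPred_eq, decide_eq_true_eq] at hx
  exact hS x hx.1 hx.2

/-- The `h + 1` vertices of the path are distinct and all belong to `D \ Λ`. -/
theorem Entry.lt_colored (hE : Entry q β G Λ D v₀ w h) (hD : D.Nodup) : h + 1 ≤ colored Λ D := by
  obtain ⟨u, p, hp, hl, hs, _⟩ := hE
  rw [colored, ← List.toFinset_card_of_nodup (hD.filter _), ← hl, ← p.length_support,
    ← List.toFinset_card_of_nodup hp.support_nodup]
  refine Finset.card_le_card fun x hx => ?_
  have := hs x (List.mem_toFinset.1 hx)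
  simp [this]

/-- Local sparsity is used here: many deletions force a long path, so an exhausted depth budget
occurs only far from `v₀`. -/
theorem Entry.colored_le {Bd : ℕ → ℕ}
    (hB : ∀ (u w : Fin n) (p : G.Walk u w), p.IsPath →
      (minBlock q β G ∅ {y | y ∈ p.support}).ncard ≤ Bd p.length)
    (hE : Entry q β G Λ D v₀ w h) (hD : D.Nodup) : colored Λ D ≤ Bd h := by
  obtain ⟨u, p, hp, rfl, _, _, hc⟩ := hE
  exact (colored_le_ncard hD hc).trans (hB _ _ p hp)

theorem Covered.colored_le {Bd : ℕ → ℕ} (hBm : Monotone Bd)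
    (hB : ∀ (u w : Fin n) (p : G.Walk u w), p.IsPath →
      (minBlock q β G ∅ {y | y ∈ p.support}).ncard ≤ Bd p.length)
    (hE : Covered q β G Λ D v₀ L) (hD : D.Nodup) : colored Λ D ≤ Bd L := by
  obtain ⟨u, p, hp, hl, hc⟩ := hE
  exact ((colored_le_ncard hD hc).trans (hB _ _ p hp)).trans (hBm hl)

/-- The last vertex `u` of the path to `w` is deleted, hence in the block of the path to `x`. Blocks
absorb high-degree neighbors of their members, so that block covers `w` as well and the path to `x`
need not change. -/
theorem Entry.cons_high (hE : Entry q β G Λ D v₀ w h) (hw : ¬ IsLowDegree q β G w)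
    (hx : Entry q β G Λ D v₀ x h') : Entry q β G Λ (w :: D) v₀ x h' := by
  obtain ⟨u, p, hp, hl, hs, hadj, hc⟩ := hE
  obtain ⟨u', p', hp', hl', hs', hadj', hc'⟩ := hx
  refine ⟨u', p', hp', hl', fun y hy => ⟨List.mem_cons_of_mem _ (hs' y hy).1, (hs' y hy).2⟩,
    hadj', fun y hy hyΛ => ?_⟩
  rcases List.mem_cons.1 hy with rfl | hy
  · have hu := hs u p.end_mem_support
    exact mem_minBlock_of_adj q β G (hc' u hu.1 hu.2) hadj hw
  · exact hc' y hy hyΛ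

theorem Covered.cons_high (hE : Entry q β G Λ D v₀ w h) (hw : ¬ IsLowDegree q β G w)
    (hx : Covered q β G Λ D v₀ L) : Covered q β G Λ (w :: D) v₀ L := by
  obtain ⟨u, p, hp, hl, hs, hadj, hc⟩ := hE
  obtain ⟨u', p', hp', hl', hc'⟩ := hx
  refine ⟨u', p', hp', hl', fun y hy hyΛ => ?_⟩
  rcases List.mem_cons.1 hy with rfl | hy
  · have hu := hs u p.end_mem_support
    exact mem_minBlock_of_adj q β G (hc' u hu.1 hu.2) hadj hw
  · exact hc' y hy hyΛ

/-- At a low-degree vertex the path itself is prolonged by `w`. Blocks are monotone in the path, so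
everything covered before remains covered. -/
theorem Entry.exists_concat (hE : Entry q β G Λ D v₀ w h) (hwD : w ∉ D) (hwΛ : w ∉ Λ) :
    ∃ p : G.Walk v₀ w, p.IsPath ∧ p.length = h + 1 ∧ (∀ x ∈ p.support, x ∈ w :: D ∧ x ∉ Λ) ∧
      ∀ x ∈ w :: D, x ∉ Λ → x ∈ minBlock q β G ∅ {y | y ∈ p.support} := by
  obtain ⟨u, p, hp, hl, hs, hadj, hc⟩ := hE
  refine ⟨p.concat hadj, hp.concat (fun h => hwD (hs w h).1) hadj, by simp [hl], ?_, ?_⟩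
  · intro x hx
    rw [SimpleGraph.Walk.support_concat, List.mem_append] at hx
    rcases hx with hx | hx
    · exact ⟨List.mem_cons_of_mem _ (hs x hx).1, (hs x hx).2⟩
    · rw [List.mem_singleton] at hx
      subst hx
      exact ⟨by simp, hwΛ⟩
  · intro x hx hxΛ
    rcases List.mem_cons.1 hx with rfl | hx
    · exact subset_minBlock q β G _ (by simp [SimpleGraph.Walk.support_concat])
    · refine minBlock_mono q β G ?_ (hc x hx hxΛ)
      intro y hy
      simp only [Set.mem_ofPred_eq] at hy ⊢
      simp [SimpleGraph.Walk.support_concat, hy]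

theorem Entry.cons_new (hE : Entry q β G Λ D v₀ w h) (hwD : w ∉ D) (hwΛ : w ∉ Λ)
    (hadj : G.Adj w x) : Entry q β G Λ (w :: D) v₀ x (h + 1) := by
  obtain ⟨p, hp, hl, hs, hc⟩ := hE.exists_concat hwD hwΛ
  exact ⟨w, p, hp, hl, hs, hadj, hc⟩

theorem Entry.covered (hE : Entry q β G Λ D v₀ w h) (hwD : w ∉ D) (hwΛ : w ∉ Λ) (hh : h + 1 ≤ L) :
    Covered q β G Λ (w :: D) v₀ L := by
  obtain ⟨p, hp, hl, _, hc⟩ := hE.exists_concat hwD hwΛ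
  exact ⟨w, p, hp, hl.trans_le hh, hc⟩

theorem Entry.init (hv : v₀ ∉ Λ) (hadj : G.Adj v₀ x) : Entry q β G Λ (v₀ :: Λ) v₀ x 0 := by
  refine ⟨v₀, .nil, by simp, rfl, by simpa using hv, hadj, ?_⟩
  intro y hy hyΛ
  rcases List.mem_cons.1 hy with rfl | hy
  · exact subset_minBlock q β G _ (by simp)
  · exact absurd hy hyΛ

theorem Covered.init : Covered q β G Λ (v₀ :: Λ) v₀ L := by
  refine ⟨v₀, .nil, by simp, by simp, ?_⟩
  intro y hy hyΛ
  rcases List.mem_cons.1 hy with rfl | hy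
  · exact subset_minBlock q β G _ (by simp)
  · exact absurd hy hyΛ

end Entry

/-! ### The total error -/

section Bounds

variable {n q : ℕ} {β : ℝ} {G : SimpleGraph (Fin n)} [DecidableRel G.Adj]

/-- The potential of a pending vertex. -/
noncomputable def pendingPot (G : SimpleGraph (Fin n)) [DecidableRel G.Adj] (ω : Fin n → ℝ)
    (g : ℕ → ℝ) (N : ℕ) (D : List (Fin n)) (p : Fin n × ℕ) : ℝ :=
  if p.1 ∈ D then 0 else pot G ω g N p.2 D p.1

variable {ω : Fin n → ℝ} {g : ℕ → ℝ} {cl : Fin n → ℕ} {δ : Fin n → ℝ} {r : ℝ}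
  {Λ : List (Fin n)} {v₀ : Fin n} {L : ℕ} {Bd : ℕ → ℕ}

theorem pendingPot_nonneg (hω : ∀ i, 0 ≤ ω i) (hg : ∀ j, 0 ≤ g j) (N : ℕ) (D : List (Fin n))
    (p : Fin n × ℕ) : 0 ≤ pendingPot G ω g N D p := by
  rw [pendingPot]
  split_ifs
  exacts [le_rfl, pot_nonneg G hω hg _ _ _ _]

theorem pendingPot_cons_le (hω : ∀ i, 0 ≤ ω i) (hg : ∀ j, 0 ≤ g j) (N : ℕ) (D : List (Fin n))
    (w : Fin n) (p : Fin n × ℕ) :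
    pendingPot G ω g N (w :: D) p ≤ pendingPot G ω g (N + 1) D p := by
  rw [pendingPot]
  split_ifs with h
  · exact pendingPot_nonneg hω hg _ _ _
  · rw [List.mem_cons, not_or] at h
    rw [pendingPot, if_neg h.2]
    exact pot_anti G hω hg (by omega) _ (by simp) _

theorem pendingPot_self (N : ℕ) (D : List (Fin n)) (w : Fin n) (h : ℕ) :
    pendingPot G ω g N (w :: D) (w, h) = 0 := by
  simp [pendingPot]

theorem sum_pendingPot_aliveNbrs (N : ℕ) (D : List (Fin n)) (w : Fin n) (h : ℕ) :
    ((aliveNbrs G D w).map fun i => pendingPot G ω g N D (i, h)).sum =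
      ((aliveNbrs G D w).map fun i => pot G ω g N h D i).sum := by
  refine congrArg _ (List.map_congr_left fun i hi => ?_)
  rw [mem_aliveNbrs] at hi
  rw [pendingPot, if_neg hi.2]

/-- The potential of a pending vertex pays for its own elimination. At a low-degree vertex, `δ w *
g` covers the rounding terms, or the whole error `δ w` at the cut-off, and the rest pays for the
neighbors. At a high-degree vertex `δ w = 1`, so its potential pays for `r` and for all neighbors
that become pending; its own potential drops to zero once it is deleted, and those of the others do
not grow. -/
theorem err_le (hB : ∀ (u w : Fin n) (p : G.Walk u w), p.IsPath →
      (minBlock q β G ∅ {y | y ∈ p.support}).ncard ≤ Bd p.length)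
    (hcl : ∀ w, cl w = 0 → ¬ IsLowDegree q β G w) (hδ : ∀ w, 0 ≤ δ w)
    (hδ1 : ∀ w, cl w = 0 → δ w = 1) (hr : 0 ≤ r) (hg0 : ∀ j, r ≤ g j)
    (hg1 : ∀ w j, δ w * r + r ≤ δ w * g j) (hg2 : ∀ h, L ≤ Bd h → 1 ≤ g (h + 1))
    (N k : ℕ) (D : List (Fin n)) (sp : List (Fin n × ℕ)) (hD : D.Nodup) (hΛ : Λ ⊆ D)
    (hk : k = L - colored Λ D) (hE : ∀ p ∈ sp, Entry q β G Λ D v₀ p.1 p.2) :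
    err G cl δ r N k D (sp.map Prod.fst) ≤ (sp.map (pendingPot G δ g N D)).sum := by
  have hg : ∀ j, 0 ≤ g j := fun j => hr.trans (hg0 j)
  induction N generalizing k D sp with
  | zero =>
    refine List.sum_nonneg ?_
    simp only [List.mem_map]
    rintro _ ⟨p, _, rfl⟩
    exact pendingPot_nonneg hδ hg _ _ _
  | succ N ih =>
    induction sp with
    | nil => simp [err, errStep]
    | cons p sp ihs =>
      obtain ⟨w, h⟩ := p
      have ihs' := ihs fun p hp => hE p (List.mem_cons_of_mem _ hp)
      have hw : Entry q β G Λ D v₀ w h := hE (w, h) (by simp)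
      simp only [List.map_cons, List.sum_cons]
      by_cases hwD : w ∈ D
      · rw [pendingPot, if_pos hwD, zero_add]
        simpa [err, errStep, hwD] using ihs'
      have hwΛ : w ∉ Λ := fun h' => hwD (hΛ h')
      have hD' : (w :: D).Nodup := List.nodup_cons.2 ⟨hwD, hD⟩
      have hΛ' : Λ ⊆ w :: D := fun x hx => List.mem_cons_of_mem _ (hΛ hx)
      have hk' : k - 1 = L - colored Λ (w :: D) := by rw [colored_cons hwΛ]; omega
      have hnew : ∀ p ∈ (aliveNbrs G (w :: D) w).map fun i => (i, h + 1),
          Entry q β G Λ (w :: D) v₀ p.1 p.2 := by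
        simp only [List.mem_map, mem_aliveNbrs]
        rintro _ ⟨i, ⟨hi, _⟩, rfl⟩
        exact hw.cons_new hwD hwΛ hi
      rw [pendingPot, if_neg hwD]
      simp only [pot]
      rw [← sum_pendingPot_aliveNbrs]
      set S := ((aliveNbrs G (w :: D) w).map fun i => pendingPot G δ g N (w :: D) (i, h + 1)).sum
        with hS
      by_cases hc : cl w = 0
      · have h1 := ih (k - 1) (w :: D)
          (((aliveNbrs G (w :: D) w).map fun i => (i, h + 1)) ++ ((w, h) :: sp)) hD' hΛ' hk' (by
            intro p hp
            rcases List.mem_append.1 hp with hp | hp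
            · exact hnew p hp
            · exact hw.cons_high (hcl w hc) (hE p hp))
        simp only [List.map_append, List.map_map, List.map_cons, List.sum_append, List.sum_cons,
          pendingPot_self, Function.comp_def, List.map_id', zero_add] at h1
        have h2 : (sp.map (pendingPot G δ g N (w :: D))).sum ≤
            (sp.map (pendingPot G δ g (N + 1) D)).sum :=
          sum_map_le_sum_map_of_sublist (List.Sublist.refl _) (pendingPot_cons_le hδ hg N D w)
            (pendingPot_nonneg hδ hg _ _)
        have h3 := hg0 (h + 1)
        rw [hδ1 w hc, err, errStep, if_neg hwD, if_pos hc]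
        linarith
      · rw [err, errStep, if_neg hwD, if_neg hc]
        refine add_le_add ?_ ihs'
        split_ifs with hk0
        -- When `k` is zero at least `L` vertices have been deleted, so the path has a block of size
        -- at least `L`.
        · have h1 : 1 ≤ g (h + 1) := hg2 h (by
            have := hw.colored_le hB hD
            omega)
          have h2 : 0 ≤ S := List.sum_nonneg (by
            simp only [List.mem_map]
            rintro _ ⟨i, _, rfl⟩
            exact pendingPot_nonneg hδ hg _ _ _)
          nlinarith [hδ w]
        · have h1 := ih (k - 1) (w :: D) ((aliveNbrs G (w :: D) w).map fun i => (i, h + 1))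
            hD' hΛ' hk' hnew
          simp only [List.map_map, Function.comp_def, List.map_id'] at h1
          have h2 := hg1 w (h + 1)
          have h3 := mul_le_mul_of_nonneg_left h1 (hδ w)
          linarith

/-! ### The number of steps -/

/-- A bound for the number of steps of `valStep` as a function of the pending vertices. -/
def costStep (G : SimpleGraph (Fin n)) [DecidableRel G.Adj] (cl : Fin n → ℕ) (q a : ℕ)
    (rec : ℕ → List (Fin n) → List (Fin n) → ℕ) (k : ℕ) (D : List (Fin n)) : List (Fin n) → ℕ
  | [] => a
  | w :: s => a +
    if w ∈ D then costStep G cl q a rec k D s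
    else if cl w = 0 then q * (a + rec (k - 1) (w :: D) (aliveNbrs G (w :: D) w ++ (w :: s)))
    else (if k = 0 then 0 else (q + 1) * (a + rec (k - 1) (w :: D) (aliveNbrs G (w :: D) w))) +
      costStep G cl q a rec k D s

/-- A bound for the number of steps of `val`. -/
def cost (G : SimpleGraph (Fin n)) [DecidableRel G.Adj] (cl : Fin n → ℕ) (q a : ℕ) :
    ℕ → ℕ → List (Fin n) → List (Fin n) → ℕ
  | 0 => fun _ _ _ => 0
  | N + 1 => costStep G cl q a (cost G cl q a N)

/-- Each deletion multiplies the work by at most a constant, paid by lowering the exponent of `2 q +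
3`. The widths of the lists of pending vertices are paid by walks of unit weight. `Covered` keeps
the number of deletions below `Bd L + 1`, so the exponent does not run out. -/
theorem cost_le (hBm : Monotone Bd) (hB : ∀ (u w : Fin n) (p : G.Walk u w), p.IsPath →
      (minBlock q β G ∅ {y | y ∈ p.support}).ncard ≤ Bd p.length)
    (hcl : ∀ w, cl w = 0 → ¬ IsLowDegree q β G w) (a : ℕ)
    (hg : ∀ j, 0 ≤ g j) (hg1 : ∀ j ≤ Bd L, (n : ℝ) + 1 ≤ g j)
    (N k : ℕ) (D : List (Fin n)) (sp : List (Fin n × ℕ)) (hD : D.Nodup) (hΛ : Λ ⊆ D)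
    (hk : k = L - colored Λ D) (hE : ∀ p ∈ sp, Entry q β G Λ D v₀ p.1 p.2)
    (hC : Covered q β G Λ D v₀ L) :
    (cost G cl q a N k D (sp.map Prod.fst) : ℝ) ≤
      a * (2 * q + 3) ^ (Bd L + 1 - colored Λ D) *
        (1 + (sp.map fun p => 1 + pendingPot G 1 g N D p).sum) := by
  have hω : ∀ i : Fin n, (0 : ℝ) ≤ (1 : Fin n → ℝ) i := fun _ => zero_le_one
  have hX : (1 : ℝ) ≤ 2 * q + 3 := by
    have : (0 : ℝ) ≤ q := by positivity
    linarith
  have hnn : ∀ N D (sp : List (Fin n × ℕ)),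
      0 ≤ (sp.map fun p => 1 + pendingPot G 1 g N D p).sum := by
    intro N D sp
    refine List.sum_nonneg ?_
    simp only [List.mem_map]
    rintro _ ⟨p, _, rfl⟩
    exact add_nonneg zero_le_one (pendingPot_nonneg hω hg _ _ _)
  induction N generalizing k D sp with
  | zero =>
    have := hnn 0 D sp
    simp only [cost, Nat.cast_zero]
    positivity
  | succ N ih =>
    have hcol := hC.colored_le hBm hB hD
    obtain ⟨e, he⟩ : ∃ e, Bd L + 1 - colored Λ D = e + 1 := ⟨Bd L - colored Λ D, by omega⟩
    rw [he]
    have ha : (0 : ℝ) ≤ a := by positivity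
    set A : ℝ := a * (2 * q + 3) ^ e with hA
    have haA : (a : ℝ) ≤ A := le_mul_of_one_le_right ha (one_le_pow₀ hX)
    have hA0 : 0 ≤ A := ha.trans haA
    have hAe : (a : ℝ) * (2 * q + 3) ^ (e + 1) = A * (2 * q + 3) := by rw [hA, pow_succ]; ring
    rw [hAe]
    induction sp with
    | nil =>
      simp only [cost, costStep, List.map_nil, List.sum_nil, add_zero, mul_one]
      nlinarith
    | cons p sp ihs =>
      obtain ⟨w, h⟩ := p
      have ihs' := ihs fun p hp => hE p (List.mem_cons_of_mem _ hp)
      have hw : Entry q β G Λ D v₀ w h := hE (w, h) (by simp)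
      have hS0 := hnn (N + 1) D sp
      simp only [List.map_cons, List.sum_cons]
      set S := (sp.map fun p => 1 + pendingPot G 1 g (N + 1) D p).sum with hS
      by_cases hwD : w ∈ D
      · rw [pendingPot, if_pos hwD, cost, costStep, if_pos hwD]
        rw [cost] at ihs'
        push_cast
        nlinarith
      have hwΛ : w ∉ Λ := fun h' => hwD (hΛ h')
      have hD' : (w :: D).Nodup := List.nodup_cons.2 ⟨hwD, hD⟩
      have hΛ' : Λ ⊆ w :: D := fun x hx => List.mem_cons_of_mem _ (hΛ hx)
      have hk' : k - 1 = L - colored Λ (w :: D) := by rw [colored_cons hwΛ]; omega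
      have he' : Bd L + 1 - colored Λ (w :: D) = e := by rw [colored_cons hwΛ]; omega
      have hnew : ∀ p ∈ (aliveNbrs G (w :: D) w).map fun i => (i, h + 1),
          Entry q β G Λ (w :: D) v₀ p.1 p.2 := by
        simp only [List.mem_map, mem_aliveNbrs]
        rintro _ ⟨i, ⟨hi, _⟩, rfl⟩
        exact hw.cons_new hwD hwΛ hi
      -- The term `g ≥ n + 1` pays one unit for the call and one for each of the at most `n` new
      -- pending vertices.
      have hψ : 1 + ((aliveNbrs G (w :: D) w).map fun i =>
          1 + pendingPot G 1 g N (w :: D) (i, h + 1)).sum ≤ pendingPot G 1 g (N + 1) D (w, h) := by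
        rw [pendingPot, if_neg hwD]
        simp only [pot]
        rw [← sum_pendingPot_aliveNbrs, List.sum_map_add, List.map_const', List.sum_replicate]
        have h1 : (aliveNbrs G (w :: D) w).length ≤ n := by
          simpa using (nodup_aliveNbrs G (w :: D) w).length_le_card
        have h2 : ((aliveNbrs G (w :: D) w).length : ℝ) ≤ n := by exact_mod_cast h1
        have h3 := hg1 (h + 1) ((hw.lt_colored hD).trans hcol)
        simp only [nsmul_eq_mul, mul_one, Pi.one_apply, one_mul]
        linarith
      have hψ0 : 0 ≤ ((aliveNbrs G (w :: D) w).map fun i =>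
          1 + pendingPot G 1 g N (w :: D) (i, h + 1)).sum := by
        have := hnn N (w :: D) ((aliveNbrs G (w :: D) w).map fun i => (i, h + 1))
        simpa only [List.map_map, Function.comp_def] using this
      set ψ := pendingPot G 1 g (N + 1) D (w, h) with hψdef
      set S' := ((aliveNbrs G (w :: D) w).map fun i =>
          1 + pendingPot G 1 g N (w :: D) (i, h + 1)).sum with hS'
      have hq0 : (0 : ℝ) ≤ q := by positivity
      by_cases hc : cl w = 0
      · have h1 := ih (k - 1) (w :: D)
          (((aliveNbrs G (w :: D) w).map fun i => (i, h + 1)) ++ ((w, h) :: sp)) hD' hΛ' hk' (by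
            intro p hp
            rcases List.mem_append.1 hp with hp | hp
            · exact hnew p hp
            · exact hw.cons_high (hcl w hc) (hE p hp)) (hC.cons_high hw (hcl w hc))
        simp only [List.map_append, List.map_map, List.map_cons, List.sum_append, List.sum_cons,
          pendingPot_self, Function.comp_def, List.map_id', add_zero] at h1
        rw [he', ← hA, ← hS'] at h1
        have h2 : (sp.map fun p => 1 + pendingPot G 1 g N (w :: D) p).sum ≤ S :=
          sum_map_le_sum_map_of_sublist (List.Sublist.refl _)
            (fun p => add_le_add le_rfl (pendingPot_cons_le hω hg N D w p))
            (fun p => add_nonneg zero_le_one (pendingPot_nonneg hω hg _ _ _))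
        rw [cost, costStep, if_neg hwD, if_pos hc]
        push_cast
        set c : ℝ := ((cost G cl q a N (k - 1) (w :: D)
          (aliveNbrs G (w :: D) w ++ w :: sp.map Prod.fst) : ℕ) : ℝ)
        have h3 : c ≤ A * (1 + ψ + S) :=
          h1.trans (mul_le_mul_of_nonneg_left (by linarith) hA0)
        have h4 : q * (a + c) ≤ q * (A + A * (1 + ψ + S)) :=
          mul_le_mul_of_nonneg_left (by linarith) hq0
        have h5 : (0 : ℝ) ≤ A * ((q + 3) * (1 + ψ + S)) := by
          have : 0 ≤ 1 + ψ + S := by linarith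
          positivity
        have h6 : 0 ≤ A * q * (ψ + S) := by
          have : 0 ≤ ψ + S := by linarith
          positivity
        nlinarith
      · have hkey : ∀ c : ℝ, c ≤ A * ψ → (a : ℝ) + ((q + 1) * (a + c) +
            A * (2 * q + 3) * (1 + S)) ≤ A * (2 * q + 3) * (1 + (1 + ψ + S)) := by
          intro c hc
          have h4 : ((q : ℝ) + 1) * (a + c) ≤ (q + 1) * (A + A * ψ) :=
            mul_le_mul_of_nonneg_left (by linarith) (by positivity)
          have h6 : 0 ≤ A * (q + 2) * ψ := by
            have : 0 ≤ ψ := by linarith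
            positivity
          have h7 : 0 ≤ A * (q + 1) := by positivity
          nlinarith
        rw [cost, costStep, if_neg hwD, if_neg hc]
        rw [cost] at ihs'
        push_cast
        split_ifs with hk0
        · have h8 := hkey (-a) (by
            have : 0 ≤ ψ := by linarith
            have : 0 ≤ A * ψ := by positivity
            linarith)
          simp only [add_neg_cancel, mul_zero] at h8
          linarith
        · have h1 := ih (k - 1) (w :: D) ((aliveNbrs G (w :: D) w).map fun i => (i, h + 1))
            hD' hΛ' hk' hnew (hw.covered hwD hwΛ (by
              have := hw.lt_colored hD
              omega))
          simp only [List.map_map, Function.comp_def, List.map_id'] at h1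
          rw [he', ← hA] at h1
          have h8 := hkey _ (h1.trans (mul_le_mul_of_nonneg_left hψ hA0))
          linarith

end Bounds

end Potts


namespace Cost

/-! ### Reasoning about programs -/

/-- In the environment `env`, the term `e` evaluates to some `v` in `t` steps with `Q v t`. -/
def WP (P : Program) (β : ℝ) (env : List Val) (e : Term) (Q : Val → ℕ → Prop) : Prop :=
  ∃ v t, Eval P β env e v t ∧ Q v t

/-- The `f`-th function evaluates on the argument `u` to some `v` in `t` steps with `Q v t`. -/
def WC (P : Program) (β : ℝ) (f : ℕ) (u : Val) (Q : Val → ℕ → Prop) : Prop :=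
  ∃ body, P[f]? = some body ∧ WP P β [u] body Q

/-- The `f`-th function evaluates on `u` to `v` in at most `T` steps. -/
def RunsLE (P : Program) (β : ℝ) (f : ℕ) (u v : Val) (T : ℕ) : Prop :=
  WC P β f u fun v' t => v' = v ∧ t ≤ T

section

variable {P : Program} {β : ℝ} {env : List Val} {Q : Val → ℕ → Prop}

@[simp] theorem wp_var {i : ℕ} : WP P β env (.var i) Q ↔ ∃ v, env[i]? = some v ∧ Q v 1 := by
  constructor
  · rintro ⟨v, t, h, hQ⟩
    cases h with
    | var h => exact ⟨v, h, hQ⟩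
  · rintro ⟨v, h, hQ⟩
    exact ⟨v, 1, .var h, hQ⟩

@[simp] theorem wp_lit {a : ℕ} : WP P β env (.lit a) Q ↔ Q (.nat a) 1 := by
  constructor
  · rintro ⟨v, t, h, hQ⟩
    cases h
    exact hQ
  · exact fun hQ => ⟨_, _, .lit, hQ⟩

@[simp] theorem wp_arith {o : Op} {e₁ e₂ : Term} : WP P β env (.arith o e₁ e₂) Q ↔
    WP P β env e₁ fun v₁ t₁ => WP P β env e₂ fun v₂ t₂ =>
      Q (.nat (o.apply v₁.toNat v₂.toNat)) (t₁ + t₂ + v₁.toNat.size + v₂.toNat.size + 1) := by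
  constructor
  · rintro ⟨v, t, h, hQ⟩
    cases h with
    | arith h₁ h₂ => exact ⟨_, _, h₁, _, _, h₂, hQ⟩
  · rintro ⟨_, _, h₁, _, _, h₂, hQ⟩
    exact ⟨_, _, .arith h₁ h₂, hQ⟩

@[simp] theorem wp_digits {e : Term} : WP P β env (.digits e) Q ↔
    WP P β env e fun v t => Q (.nat ⌊β * 2 ^ v.toNat⌋₊) (t + v.toNat + 1) := by
  constructor
  · rintro ⟨v, t, h, hQ⟩
    cases h with
    | digits h => exact ⟨_, _, h, hQ⟩
  · rintro ⟨_, _, h, hQ⟩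
    exact ⟨_, _, .digits h, hQ⟩

@[simp] theorem wp_pair {e₁ e₂ : Term} : WP P β env (.pair e₁ e₂) Q ↔
    WP P β env e₁ fun v₁ t₁ => WP P β env e₂ fun v₂ t₂ => Q (.pair v₁ v₂) (t₁ + t₂ + 1) := by
  constructor
  · rintro ⟨v, t, h, hQ⟩
    cases h with
    | pair h₁ h₂ => exact ⟨_, _, h₁, _, _, h₂, hQ⟩
  · rintro ⟨_, _, h₁, _, _, h₂, hQ⟩
    exact ⟨_, _, .pair h₁ h₂, hQ⟩

@[simp] theorem wp_fst {e : Term} : WP P β env (.fst e) Q ↔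
    WP P β env e fun v t => Q v.fst (t + 1) := by
  constructor
  · rintro ⟨v, t, h, hQ⟩
    cases h with
    | fst h => exact ⟨_, _, h, hQ⟩
  · rintro ⟨_, _, h, hQ⟩
    exact ⟨_, _, .fst h, hQ⟩

@[simp] theorem wp_snd {e : Term} : WP P β env (.snd e) Q ↔
    WP P β env e fun v t => Q v.snd (t + 1) := by
  constructor
  · rintro ⟨v, t, h, hQ⟩
    cases h with
    | snd h => exact ⟨_, _, h, hQ⟩
  · rintro ⟨_, _, h, hQ⟩
    exact ⟨_, _, .snd h, hQ⟩

@[simp] theorem wp_ite {c e₁ e₂ : Term} : WP P β env (.ite c e₁ e₂) Q ↔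
    WP P β env c fun b s => (b ≠ .nat 0 → WP P β env e₁ fun v t => Q v (s + t + 1)) ∧
      (b = .nat 0 → WP P β env e₂ fun v t => Q v (s + t + 1)) := by
  constructor
  · rintro ⟨v, t, h, hQ⟩
    cases h with
    | iteTrue h₁ hb h₂ => exact ⟨_, _, h₁, fun _ => ⟨_, _, h₂, hQ⟩, fun h => absurd h hb⟩
    | iteFalse h₁ hb h₂ => exact ⟨_, _, h₁, fun h => absurd hb h, fun _ => ⟨_, _, h₂, hQ⟩⟩
  · rintro ⟨b, s, h₁, h₂, h₃⟩
    by_cases hb : b = .nat 0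
    · obtain ⟨v, t, h, hQ⟩ := h₃ hb
      exact ⟨_, _, .iteFalse h₁ hb h, hQ⟩
    · obtain ⟨v, t, h, hQ⟩ := h₂ hb
      exact ⟨_, _, .iteTrue h₁ hb h, hQ⟩

@[simp] theorem wp_bind {e₁ e₂ : Term} : WP P β env (.bind e₁ e₂) Q ↔
    WP P β env e₁ fun u s => WP P β (u :: env) e₂ fun v t => Q v (s + t + 1) := by
  constructor
  · rintro ⟨v, t, h, hQ⟩
    cases h with
    | bind h₁ h₂ => exact ⟨_, _, h₁, _, _, h₂, hQ⟩
  · rintro ⟨_, _, h₁, _, _, h₂, hQ⟩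
    exact ⟨_, _, .bind h₁ h₂, hQ⟩

@[simp] theorem wp_call {f : ℕ} {e : Term} : WP P β env (.call f e) Q ↔
    WP P β env e fun u s => WC P β f u fun v t => Q v (s + t + 1) := by
  constructor
  · rintro ⟨v, t, h, hQ⟩
    cases h with
    | call h₁ hf h₂ => exact ⟨_, _, h₁, _, hf, _, _, h₂, hQ⟩
  · rintro ⟨_, _, h₁, _, hf, _, _, h₂, hQ⟩
    exact ⟨_, _, .call h₁ hf h₂, hQ⟩

theorem WC.mono {f : ℕ} {u : Val} {Q' : Val → ℕ → Prop} (h : WC P β f u Q)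
    (hQ : ∀ v t, Q v t → Q' v t) : WC P β f u Q' := by
  obtain ⟨body, hf, v, t, h, hq⟩ := h
  exact ⟨body, hf, v, t, h, hQ v t hq⟩

/-- By determinism value and time are unique, so a specification becomes an equivalence by which
later calls can be rewritten. -/
theorem RunsLE.exists_time {f : ℕ} {u v : Val} {T : ℕ} (h : RunsLE P β f u v T) :
    ∃ t ≤ T, ∀ Q, WC P β f u Q ↔ Q v t := by
  obtain ⟨body, hf, _, t, he, rfl, ht⟩ := h
  refine ⟨t, ht, fun Q => ⟨?_, fun hQ => ⟨body, hf, _, t, he, hQ⟩⟩⟩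
  rintro ⟨body', hf', v', t', he', hQ⟩
  obtain rfl := Option.some.inj (hf.symm.trans hf')
  obtain ⟨rfl, rfl⟩ := he.det he'
  exact hQ

theorem RunsLE.mono {f : ℕ} {u v : Val} {T T' : ℕ} (h : RunsLE P β f u v T) (hT : T ≤ T') :
    RunsLE P β f u v T' :=
  WC.mono h fun _ _ h => ⟨h.1, h.2.trans hT⟩

end

@[simp] theorem Val.fst_pair (a b : Val) : (Val.pair a b).fst = a := rfl

@[simp] theorem Val.snd_pair (a b : Val) : (Val.pair a b).snd = b := rfl

@[simp] theorem Val.fst_nat (a : ℕ) : (Val.nat a).fst = .nat 0 := rfl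

@[simp] theorem Val.snd_nat (a : ℕ) : (Val.nat a).snd = .nat 0 := rfl

@[simp] theorem Val.toNat_nat (a : ℕ) : (Val.nat a).toNat = a := rfl

@[simp] theorem Val.ofList_nil : Val.ofList [] = .nat 0 := rfl

@[simp] theorem Val.ofList_cons (a : Val) (l : List Val) :
    Val.ofList (a :: l) = .pair a (Val.ofList l) := rfl

@[simp] theorem Op.apply_add (a b : ℕ) : Op.apply .add a b = a + b := rfl

@[simp] theorem Op.apply_sub (a b : ℕ) : Op.apply .sub a b = a - b := rfl

@[simp] theorem Op.apply_mul (a b : ℕ) : Op.apply .mul a b = a * b := rfl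

@[simp] theorem Op.apply_div (a b : ℕ) : Op.apply .div a b = a / b := rfl

theorem size_le_self (a : ℕ) : a.size ≤ a :=
  Nat.size_le.2 Nat.lt_two_pow_self

end Cost

namespace Potts

open Cost

/-! ### The program -/

section Program

/-- Argument: a list and an index. A conditional tests for `nat 0`, which is both the number zero
and the empty list; the same test therefore ends loops over lists and over counters. Positions
beyond the end yield `nat 0`. -/
def nthBody : Term :=
  .ite (.snd (.var 0))
    (.call 1 (.pair (.snd (.fst (.var 0))) (.arith .sub (.snd (.var 0)) (.lit 1))))
    (.fst (.fst (.var 0)))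

def sumBody : Term :=
  .ite (.var 0) (.arith .add (.fst (.var 0)) (.call 2 (.snd (.var 0)))) (.lit 0)

/-- Zero if and only if the values of `e₁` and `e₂` are equal. -/
def neTerm (e₁ e₂ : Term) : Term := .arith .add (.arith .sub e₁ e₂) (.arith .sub e₂ e₁)

def memBody : Term :=
  .ite (.snd (.var 0))
    (.ite (neTerm (.fst (.var 0)) (.fst (.snd (.var 0))))
      (.call 3 (.pair (.fst (.var 0)) (.snd (.snd (.var 0)))))
      (.lit 1))
    (.lit 0)

/-- Arguments: a final segment of a row, its position, `D`, the color, and the accumulator. -/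
def nbrsBody : Term :=
  .ite (.fst (.var 0))
    (.bind (.call 4 (.pair (.snd (.fst (.var 0)))
        (.pair (.arith .add (.fst (.snd (.var 0))) (.lit 1)) (.snd (.snd (.var 0))))))
      (.ite (.fst (.fst (.var 1)))
        (.ite (.call 3 (.pair (.fst (.snd (.var 1))) (.fst (.snd (.snd (.var 1))))))
          (.var 0)
          (.pair (.pair (.fst (.snd (.var 1))) (.fst (.snd (.snd (.snd (.var 1)))))) (.var 0)))
        (.var 0)))
    (.snd (.snd (.snd (.snd (.var 0)))))

/-- Arguments: the fields, the vertex, the color, `one`, `b`. -/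
def factorBody : Term :=
  .ite (.fst (.var 0))
    (.bind (.call 5 (.pair (.snd (.fst (.var 0))) (.snd (.var 0))))
      (.ite (neTerm (.fst (.fst (.fst (.var 1)))) (.fst (.snd (.var 1))))
        (.var 0)
        (.arith .mul
          (.ite (neTerm (.snd (.fst (.fst (.var 1)))) (.fst (.snd (.snd (.var 1)))))
            (.fst (.snd (.snd (.snd (.var 1)))))
            (.snd (.snd (.snd (.snd (.var 1))))))
          (.var 0))))
    (.lit 1)

def appendBody : Term :=
  .ite (.fst (.var 0))
    (.pair (.fst (.fst (.var 0))) (.call 6 (.pair (.snd (.fst (.var 0))) (.snd (.var 0)))))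
    (.snd (.var 0))

/-- Arguments: the context (adjacency matrix, `one`, `b`, the table), `k`, `D`, the fields, the
pending fields, the vertex, and the color. -/
def colorBody : Term :=
  .bind (.snd (.var 0)) <| .bind (.snd (.var 0)) <| .bind (.snd (.var 0)) <| .bind (.snd (.var 0)) <|
  .bind (.snd (.var 0)) <|
  .bind (.pair (.fst (.var 0)) (.fst (.var 3))) <|
  .arith .mul
    (.arith .mul
      (.call 5 (.pair (.fst (.var 3)) (.pair (.fst (.var 1)) (.pair (.snd (.var 1))
        (.pair (.fst (.snd (.fst (.var 6)))) (.fst (.snd (.snd (.fst (.var 6))))))))))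
      (.call 5 (.pair (.fst (.var 2)) (.pair (.fst (.var 1)) (.pair (.snd (.var 1))
        (.pair (.fst (.snd (.fst (.var 6)))) (.fst (.snd (.snd (.fst (.var 6)))))))))))
    (.call 10 (.pair (.fst (.var 6)) (.pair (.arith .sub (.fst (.var 5)) (.lit 1))
      (.pair (.var 0) (.pair (.fst (.var 3))
        (.call 4 (.pair (.call 1 (.pair (.fst (.fst (.var 6))) (.fst (.var 1))))
          (.pair (.lit 0) (.pair (.var 0) (.pair (.snd (.var 1)) (.fst (.var 2))))))))))))

/-- Arguments as for the previous function, with the number of colors in place of the color. -/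
def sumColorsBody : Term :=
  .bind (.snd (.var 0)) <| .bind (.snd (.var 0)) <| .bind (.snd (.var 0)) <| .bind (.snd (.var 0)) <|
  .bind (.snd (.var 0)) <|
  .ite (.snd (.var 0))
    (.bind (.pair (.fst (.var 5)) (.pair (.fst (.var 4)) (.pair (.fst (.var 3))
        (.pair (.fst (.var 2)) (.pair (.fst (.var 1)) (.pair (.fst (.var 0))
          (.arith .sub (.snd (.var 0)) (.lit 1))))))))
      (.arith .add (.call 7 (.var 0)) (.call 8 (.var 0))))
    (.lit 0)

/-- Arguments: the context, `k`, `D`, the fields, the vertex, the color, and the clamp. -/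
def estBody (q : ℕ) : Term :=
  .bind (.snd (.var 0)) <| .bind (.snd (.var 0)) <| .bind (.snd (.var 0)) <| .bind (.snd (.var 0)) <|
  .bind (.snd (.var 0)) <|
  .bind (.fst (.snd (.fst (.var 5)))) <|
  .ite (.fst (.var 5))
    (.bind (.arith .sub (.var 0) (.arith .div
        (.arith .mul (.arith .sub (.var 0) (.fst (.snd (.snd (.fst (.var 6))))))
          (.call 7 (.pair (.fst (.var 6)) (.pair (.fst (.var 5)) (.pair (.fst (.var 4))
            (.pair (.fst (.var 3)) (.pair (.lit 0) (.pair (.fst (.var 2)) (.fst (.var 1))))))))))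
        (.call 8 (.pair (.fst (.var 6)) (.pair (.fst (.var 5)) (.pair (.fst (.var 4))
            (.pair (.fst (.var 3)) (.pair (.lit 0) (.pair (.fst (.var 2)) (.lit q)))))))))) <|
      -- With truncated subtraction `c + (e - c)` is the maximum of `c` and `e`; this is the
      -- clamping.
      .arith .add (.snd (.var 2)) (.arith .sub (.var 0) (.snd (.var 2))))
    (.var 0)

/-- Arguments: the context, `k`, `D`, the fields, and the pending fields. -/
def valBody (q : ℕ) : Term :=
  .bind (.snd (.var 0)) <| .bind (.snd (.var 0)) <| .bind (.snd (.var 0)) <| .bind (.snd (.var 0)) <|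
  .ite (.var 0)
    (.ite (.call 3 (.pair (.fst (.fst (.var 0))) (.fst (.var 2))))
      (.call 10 (.pair (.fst (.var 4)) (.pair (.fst (.var 3)) (.pair (.fst (.var 2))
        (.pair (.fst (.var 1)) (.snd (.var 0)))))))
      (.bind (.call 11 (.pair (.fst (.var 4)) (.fst (.fst (.var 0)))))
        (.ite (.var 0)
          (.arith .mul
            (.call 9 (.pair (.fst (.var 5)) (.pair (.fst (.var 4)) (.pair (.fst (.var 3))
              (.pair (.call 6 (.pair (.snd (.var 1)) (.fst (.var 2))))
                (.pair (.fst (.fst (.var 1))) (.pair (.snd (.fst (.var 1))) (.var 0))))))))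
            (.call 10 (.pair (.fst (.var 5)) (.pair (.fst (.var 4)) (.pair (.fst (.var 3))
              (.pair (.fst (.var 2)) (.snd (.var 1))))))))
          (.call 8 (.pair (.fst (.var 5)) (.pair (.fst (.var 4)) (.pair (.fst (.var 3))
            (.pair (.fst (.var 2)) (.pair (.var 1) (.pair (.fst (.fst (.var 1)))
              (.lit q)))))))))))
    (.lit 1)

/-- Arguments: the context and the vertex. -/
def clampBody (sc : ℕ) : Term :=
  .arith .div (.arith .mul
    (.call 1 (.pair (.snd (.snd (.snd (.fst (.var 0)))))
      (.call 2 (.call 1 (.pair (.fst (.fst (.var 0))) (.snd (.var 0)))))))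
    (.fst (.snd (.fst (.var 0))))) (.lit sc)

def powBody : Term :=
  .ite (.var 0) (.arith .mul (.lit 2) (.call 12 (.arith .sub (.var 0) (.lit 1)))) (.lit 1)

def sizeBody : Term :=
  .ite (.var 0) (.arith .add (.lit 1) (.call 13 (.arith .div (.var 0) (.lit 2)))) (.lit 0)

/-- Arguments: a final segment of the boundary list and its position. -/
def deadBody : Term :=
  .ite (.fst (.var 0))
    (.bind (.call 14 (.pair (.snd (.fst (.var 0))) (.arith .add (.snd (.var 0)) (.lit 1))))
      (.ite (.fst (.fst (.var 1))) (.pair (.snd (.var 1)) (.var 0)) (.var 0)))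
    (.lit 0)

/-- Arguments: final segments of the boundary list and of the list of rows, and `D`. -/
def fieldsBody : Term :=
  .ite (.fst (.var 0))
    (.bind (.call 15 (.pair (.snd (.fst (.var 0)))
        (.pair (.snd (.fst (.snd (.var 0)))) (.snd (.snd (.var 0))))))
      (.ite (.fst (.fst (.var 1)))
        (.call 4 (.pair (.fst (.fst (.snd (.var 1)))) (.pair (.lit 0) (.pair (.snd (.snd (.var 1)))
          (.pair (.arith .sub (.fst (.fst (.var 1))) (.lit 1)) (.var 0))))))
        (.var 0)))
    (.lit 0)

/-- A list of numbers as a term. -/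
def litList : List ℕ → Term
  | [] => .lit 0
  | a :: l => .pair (.lit a) (litList l)

/-- The program: `c₁ * size n + 1` is the recursion depth, `n + c₀` the precision, and `tbl` the
table of the clamps in units of `2 ^ (-c₀)`. -/
def mainBody (q c₀ c₁ : ℕ) (tbl : List ℕ) : Term :=
  .bind (.snd (.var 0)) <| .bind (.snd (.var 0)) <| .bind (.snd (.var 0)) <|
  .bind (.call 1 (.pair (.fst (.var 1)) (.fst (.var 0)))) <|
  .ite (.var 0)
    (.ite (neTerm (.var 0) (.arith .add (.snd (.var 1)) (.lit 1)))
      (.pair (.lit 0) (.lit 1)) (.pair (.lit 1) (.lit 1)))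
    (.bind (.arith .add (.fst (.var 4)) (.lit c₀)) <|
     .bind (.pair (.fst (.var 4)) (.pair (.call 12 (.var 0)) (.pair (.digits (.var 0))
        (litList tbl)))) <|
     .bind (.arith .add (.arith .mul (.lit c₁) (.call 13 (.fst (.var 6)))) (.lit 1)) <|
     .bind (.call 14 (.pair (.fst (.var 5)) (.lit 0))) <|
     .bind (.call 15 (.pair (.fst (.var 6)) (.pair (.fst (.var 7)) (.var 0)))) <|
     .pair
       (.call 7 (.pair (.var 3) (.pair (.var 2) (.pair (.var 1) (.pair (.var 0) (.pair (.lit 0)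
         (.pair (.fst (.var 6)) (.snd (.var 6)))))))))
       (.call 8 (.pair (.var 3) (.pair (.var 2) (.pair (.var 1) (.pair (.var 0) (.pair (.lit 0)
         (.pair (.fst (.var 6)) (.lit q)))))))))

/-- The position in the list is the number by which `Term.call` refers to a function. -/
def pottsProgram (q c₀ c₁ : ℕ) (tbl : List ℕ) : Program :=
  [mainBody q c₀ c₁ tbl, nthBody, sumBody, memBody, nbrsBody, factorBody, appendBody, colorBody,
    sumColorsBody, estBody q, valBody q, clampBody (2 ^ c₀), powBody, sizeBody, deadBody,
    fieldsBody]

end Program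

/-! ### Running times: indexing and summing lists -/

section Specs

variable {q c₀ c₁ : ℕ} {tbl : List ℕ} {β : ℝ} {m : ℕ}

local notation "PP" => pottsProgram q c₀ c₁ tbl

theorem wc_iff {f : ℕ} {body : Term} {P : Program} (h : P[f]? = some body) {u : Val}
    {Q : Val → ℕ → Prop} : WC P β f u Q ↔ WP P β [u] body Q := by
  simp [WC, h]

theorem nth_runs (hm : 1 ≤ m) (l : List Val) (i : ℕ) (hi : i ≤ m) :
    RunsLE PP β 1 (.pair (Val.ofList l) (.nat i)) (l.getD i (.nat 0)) ((i + 1) * (40 * m)) := by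
  induction i generalizing l with
  | zero =>
    rw [RunsLE, wc_iff (body := nthBody) rfl]
    cases l with
    | nil => simp [nthBody]; omega
    | cons a l => simp [nthBody]; omega
  | succ i ih =>
    obtain ⟨t, ht, hc⟩ := (ih l.tail (by omega)).exists_time
    rw [RunsLE, wc_iff (body := nthBody) rfl]
    have h1 : (Val.ofList l).snd = Val.ofList l.tail := by cases l <;> rfl
    have h2 : l.tail.getD i (.nat 0) = l.getD (i + 1) (.nat 0) := by cases l <;> simp
    simp [nthBody, h1, hc, h2, -List.getD_eq_getElem?_getD]
    have := size_le_self (i + 1)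
    have e : (i + 1 + 1) * (40 * m) = (i + 1) * (40 * m) + 40 * m := by ring
    omega

theorem sum_runs (hm : 1 ≤ m) (l : List ℕ) (hl : l.sum ≤ m) :
    RunsLE PP β 2 (Val.ofList (l.map Val.nat)) (.nat l.sum) ((l.length + 1) * (40 * m)) := by
  induction l with
  | nil =>
    rw [RunsLE, wc_iff (body := sumBody) rfl]
    simp [sumBody]
    omega
  | cons a l ih =>
    rw [List.sum_cons] at hl
    obtain ⟨t, ht, hc⟩ := (ih (by omega)).exists_time
    rw [RunsLE, wc_iff (body := sumBody) rfl]
    simp [sumBody, hc]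
    have := size_le_self a
    have := size_le_self l.sum
    have e : (l.length + 1 + 1) * (40 * m) = (l.length + 1) * (40 * m) + 40 * m := by ring
    omega

end Specs

end Potts


namespace Potts

open Cost

/-! ### Running times: vertex lists, fields and clamps -/

section FieldSpecs

variable {n q q' c₀ c₁ : ℕ} {tbl : List ℕ} {β : ℝ} {m : ℕ}

local notation "PP" => pottsProgram q' c₀ c₁ tbl

def encVerts (D : List (Fin n)) : Val := Val.ofList (D.map fun i => .nat i)

def encFields (F : List (Fin n × Fin q)) : Val :=
  Val.ofList (F.map fun p => .pair (.nat p.1) (.nat p.2))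

@[simp] theorem encVerts_nil : encVerts ([] : List (Fin n)) = .nat 0 := rfl

@[simp] theorem encVerts_cons (w : Fin n) (D : List (Fin n)) :
    encVerts (w :: D) = .pair (.nat w) (encVerts D) := rfl

@[simp] theorem encFields_nil : encFields ([] : List (Fin n × Fin q)) = .nat 0 := rfl

@[simp] theorem encFields_cons (p : Fin n × Fin q) (F : List (Fin n × Fin q)) :
    encFields (p :: F) = .pair (.pair (.nat p.1) (.nat p.2)) (encFields F) := rfl

theorem size_mono {a b : ℕ} (h : a ≤ b) : a.size ≤ b.size := Nat.size_le_size h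

theorem size_le_of_lt {a : ℕ} (h : a ≤ m) : a.size ≤ m := (size_le_self a).trans h

theorem mem_runs (hm : 1 ≤ m) (hn : n ≤ m) (w : Fin n) (D : List (Fin n)) :
    RunsLE PP β 3 (.pair (.nat w) (encVerts D)) (.nat (if w ∈ D then 1 else 0))
      ((D.length + 1) * (40 * m)) := by
  induction D with
  | nil =>
    rw [RunsLE, wc_iff (body := memBody) rfl]
    simp [memBody]
    omega
  | cons d D ih =>
    obtain ⟨t, ht, hc⟩ := ih.exists_time
    rw [RunsLE, wc_iff (body := memBody) rfl]
    have h1 : (w : ℕ).size ≤ m := size_le_of_lt (by omega)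
    have h2 : (d : ℕ).size ≤ m := size_le_of_lt (by omega)
    have h3 : ((w : ℕ) - d).size ≤ m := size_le_of_lt (by omega)
    have h4 : ((d : ℕ) - w).size ≤ m := size_le_of_lt (by omega)
    have e : (D.length + 1 + 1) * (40 * m) = (D.length + 1) * (40 * m) + 40 * m := by ring
    by_cases h : w = d
    · subst h
      simp [memBody, neTerm]
      simp at h3
      omega
    · simp only [memBody, neTerm, wp_ite, wp_snd, wp_var, wp_arith, wp_fst, wp_call, wp_pair,
        encVerts_cons]
      simp [hc, h]
      omega

theorem nbrs_runs (G : SimpleGraph (Fin n)) [DecidableRel G.Adj] (hm : 1 ≤ m) (hn : n ≤ m)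
    (w : Fin n) (y : Fin q) (D : List (Fin n)) (hD : D.length + 1 ≤ m) (acc : List (Fin n × Fin q))
    (l : List (Fin n)) (i : ℕ) (hl : ∀ (j : ℕ) (h : j < l.length), (l[j] : ℕ) = i + j)
    (hi : i + l.length ≤ m) :
    RunsLE PP β 4 (.pair (Val.ofList (l.map fun j => .nat (if G.Adj w j then 1 else 0)))
      (.pair (.nat i) (.pair (encVerts D) (.pair (.nat y) (encFields acc)))))
      (encFields (((l.filter fun j => G.Adj w j ∧ j ∉ D).map (·, y)) ++ acc))
      ((l.length + 1) * (100 * m ^ 2)) := by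
  have hmm : m ≤ m ^ 2 := Nat.le_self_pow two_ne_zero m
  induction l generalizing i with
  | nil =>
    rw [RunsLE, wc_iff (body := nbrsBody) rfl]
    simp [nbrsBody]
    omega
  | cons a l ih =>
    have hl' : ∀ (j : ℕ) (h : j < l.length), (l[j] : ℕ) = i + 1 + j := fun j h => by
      have := hl (j + 1) (by simpa using h)
      simp only [List.getElem_cons_succ] at this
      omega
    have ha : (a : ℕ) = i := (hl 0 (Nat.succ_pos _)).trans (add_zero i)
    rw [List.length_cons] at hi
    obtain ⟨t, ht, hc⟩ := (ih (i + 1) hl' (by omega)).exists_time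
    obtain ⟨t', ht', hc'⟩ := (mem_runs (q' := q') (c₀ := c₀) (c₁ := c₁) (tbl := tbl) (β := β)
      hm hn a D).exists_time
    have ht2 : (D.length + 1) * (40 * m) ≤ 40 * m ^ 2 := by
      calc (D.length + 1) * (40 * m) ≤ m * (40 * m) := Nat.mul_le_mul_right _ hD
        _ = 40 * m ^ 2 := by ring
    rw [ha] at hc'
    have e : (l.length + 1 + 1) * (100 * m ^ 2) = (l.length + 1) * (100 * m ^ 2) + 100 * m ^ 2 := by
      ring
    have h1 : i.size ≤ m := size_le_of_lt (by omega)
    rw [RunsLE, wc_iff (body := nbrsBody) rfl]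
    by_cases hadj : G.Adj w a
    · by_cases haD : a ∈ D
      · simp [nbrsBody, hc, hc', hadj, haD]
        omega
      · simp [nbrsBody, hc, hc', hadj, haD, ha]
        omega
    · simp [nbrsBody, hc, hadj]
      omega

theorem intFactor_cons {one b : ℕ} (p : Fin n × Fin q) (F : List (Fin n × Fin q)) (w : Fin n)
    (y : Fin q) : intFactor one b (p :: F) w y =
      (if p.1 = w then (if p.2 = y then b else one) else 1) * intFactor one b F w y := rfl

theorem intFactor_le {one b : ℕ} (hb : b ≤ one) (hone : 1 ≤ one) (F : List (Fin n × Fin q))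
    (w : Fin n) (y : Fin q) : intFactor one b F w y ≤ one ^ F.length := by
  induction F with
  | nil => simp [intFactor]
  | cons p F ih =>
    rw [intFactor_cons, List.length_cons, pow_succ']
    refine Nat.mul_le_mul ?_ ih
    split_ifs <;> omega

theorem factor_runs {one b : ℕ} (hm : 1 ≤ m) (hn : n ≤ m) (hq : q ≤ m) (hb : b ≤ one)
    (hone : 1 ≤ one) (h1m : one.size ≤ m) (F : List (Fin n × Fin q))
    (hF : (one ^ F.length).size ≤ m) (w : Fin n) (y : Fin q) :
    RunsLE PP β 5 (.pair (encFields F) (.pair (.nat w) (.pair (.nat y)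
      (.pair (.nat one) (.nat b))))) (.nat (intFactor one b F w y))
      ((F.length + 1) * (100 * m)) := by
  induction F with
  | nil =>
    rw [RunsLE, wc_iff (body := factorBody) rfl]
    simp [factorBody, intFactor]
    omega
  | cons p F ih =>
    have hF' : (one ^ F.length).size ≤ m :=
      (size_mono (Nat.pow_le_pow_right hone (by simp))).trans hF
    obtain ⟨t, ht, hc⟩ := (ih hF').exists_time
    have hf := (size_mono (intFactor_le hb hone F w y)).trans hF'
    have hbm := (size_mono hb).trans h1m
    have e : (F.length + 1 + 1) * (100 * m) = (F.length + 1) * (100 * m) + 100 * m := by ring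
    obtain ⟨p, z⟩ := p
    have h1 : (w : ℕ).size ≤ m := size_le_of_lt (by omega)
    have h2 : (p : ℕ).size ≤ m := size_le_of_lt (by omega)
    have h3 : ((w : ℕ) - p).size ≤ m := size_le_of_lt (by omega)
    have h4 : ((p : ℕ) - w).size ≤ m := size_le_of_lt (by omega)
    have h5 : (y : ℕ).size ≤ m := size_le_of_lt (by omega)
    have h6 : (z : ℕ).size ≤ m := size_le_of_lt (by omega)
    have h7 : ((y : ℕ) - z).size ≤ m := size_le_of_lt (by omega)
    have h8 : ((z : ℕ) - y).size ≤ m := size_le_of_lt (by omega)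
    rw [RunsLE, wc_iff (body := factorBody) rfl, intFactor_cons]
    by_cases hp : p = w
    · subst hp
      by_cases hz : z = y
      · subst hz
        simp [factorBody, neTerm, hc]
        simp at h3 h7
        omega
      · simp [factorBody, neTerm, hc, hz]
        simp at h3
        omega
    · simp [factorBody, neTerm, hc, hp]
      omega

theorem append_runs (Q F : List (Fin n × Fin q)) :
    RunsLE PP β 6 (.pair (encFields Q) (encFields F)) (encFields (Q ++ F))
      ((Q.length + 1) * 40) := by
  induction Q with
  | nil =>
    rw [RunsLE, wc_iff (body := appendBody) rfl]
    simp [appendBody]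
  | cons p Q ih =>
    obtain ⟨t, ht, hc⟩ := ih.exists_time
    rw [RunsLE, wc_iff (body := appendBody) rfl]
    simp [appendBody, hc]
    omega

/-- The row of the adjacency matrix of `w`. -/
def encRow (G : SimpleGraph (Fin n)) [DecidableRel G.Adj] (w : Fin n) : Val :=
  Val.ofList ((List.finRange n).map fun j => .nat (if G.Adj w j then 1 else 0))

def encGraph (G : SimpleGraph (Fin n)) [DecidableRel G.Adj] : Val :=
  Val.ofList ((List.finRange n).map fun i => encRow G i)

def encCtx (G : SimpleGraph (Fin n)) [DecidableRel G.Adj] (one b : ℕ) (tbl : List ℕ) : Val :=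
  .pair (encGraph G) (.pair (.nat one) (.pair (.nat b) (Val.ofList (tbl.map Val.nat))))

theorem row_runs (G : SimpleGraph (Fin n)) [DecidableRel G.Adj] (hm : 1 ≤ m) (hn : n ≤ m)
    (w : Fin n) : RunsLE PP β 1 (.pair (encGraph G) (.nat w)) (encRow G w) (m * (40 * m)) := by
  have h := nth_runs (q := q') (c₀ := c₀) (c₁ := c₁) (tbl := tbl) (β := β) hm
    ((List.finRange n).map fun i => encRow G i) w (by omega)
  have e : ((List.finRange n).map fun i => encRow G i).getD w (.nat 0) = encRow G w := by
    simp
  rw [e] at h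
  exact h.mono (Nat.mul_le_mul_right _ (by omega))

theorem alive_nbrs_runs (G : SimpleGraph (Fin n)) [DecidableRel G.Adj] (hm : 1 ≤ m) (hn : n ≤ m)
    (w : Fin n) (y : Fin q) (D : List (Fin n)) (hD : D.length + 1 ≤ m)
    (acc : List (Fin n × Fin q)) :
    RunsLE PP β 4 (.pair (encRow G w) (.pair (.nat 0) (.pair (encVerts D) (.pair (.nat y)
      (encFields acc))))) (encFields ((aliveNbrs G D w).map (·, y) ++ acc))
      ((n + 1) * (100 * m ^ 2)) := by
  have h := nbrs_runs (q' := q') (c₀ := c₀) (c₁ := c₁) (tbl := tbl) (β := β) G hm hn w y D hD acc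
    (List.finRange n) 0 (by simp) (by simpa using hn)
  simpa [encRow, aliveNbrs] using h

/-- The clamp of a vertex. -/
def clampAt (G : SimpleGraph (Fin n)) [DecidableRel G.Adj] (tbl : List ℕ) (one sc : ℕ)
    (w : Fin n) : ℕ :=
  tbl.getD (G.degree w) 0 * one / sc

/-- The program obtains a degree by summing a row of the adjacency matrix. -/
theorem sum_row (G : SimpleGraph (Fin n)) [DecidableRel G.Adj] (w : Fin n) :
    ((List.finRange n).map fun j => if G.Adj w j then 1 else 0).sum = G.degree w := by
  rw [← SimpleGraph.card_neighborFinset_eq_degree, SimpleGraph.neighborFinset_eq_filter,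
    Finset.card_filter, ← List.ofFn_eq_map, List.sum_ofFn]

theorem clamp_runs (G : SimpleGraph (Fin n)) [DecidableRel G.Adj] (hm : 1 ≤ m) (hn : n + 1 ≤ m)
    {one b : ℕ} (h1m : one.size ≤ m) (htbl : ∀ x ∈ tbl, x ≤ m)
    (htm : ∀ x ∈ tbl, (x * one).size ≤ m) (hsc : (2 ^ c₀).size ≤ m) (w : Fin n) :
    RunsLE PP β 11 (.pair (encCtx G one b tbl) (.nat w)) (.nat (clampAt G tbl one (2 ^ c₀) w))
      (200 * m ^ 2) := by
  have hmm : m ≤ m ^ 2 := Nat.le_self_pow two_ne_zero m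
  have hdeg : G.degree w ≤ m := by
    have := G.degree_lt_card_verts w
    simp only [Fintype.card_fin] at this
    omega
  obtain ⟨t, ht, hc⟩ := (row_runs (q' := q') (c₀ := c₀) (c₁ := c₁) (tbl := tbl) (β := β) G hm
    (by omega) w).exists_time
  obtain ⟨t', ht', hc'⟩ := (sum_runs (q := q') (c₀ := c₀) (c₁ := c₁) (tbl := tbl) (β := β) hm
    ((List.finRange n).map fun j => if G.Adj w j then 1 else 0)
    (by rw [sum_row]; exact hdeg)).exists_time
  rw [sum_row, List.map_map, List.length_map, List.length_finRange] at *
  obtain ⟨t₂, ht₂, hc₂⟩ := (nth_runs (q := q') (c₀ := c₀) (c₁ := c₁) (tbl := tbl) (β := β) hm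
    (tbl.map Val.nat) (G.degree w) hdeg).exists_time
  have hget : (tbl.map Val.nat).getD (G.degree w) (.nat 0) = .nat (tbl.getD (G.degree w) 0) := by
    simp only [List.getD_eq_getElem?_getD, List.getElem?_map]
    cases tbl[G.degree w]? <;> rfl
  rw [hget] at hc₂
  have hx : tbl.getD (G.degree w) 0 ≤ m ∧ (tbl.getD (G.degree w) 0 * one).size ≤ m := by
    by_cases h : G.degree w < tbl.length
    · rw [List.getD_eq_getElem _ _ h]
      exact ⟨htbl _ (List.getElem_mem h), htm _ (List.getElem_mem h)⟩
    · rw [List.getD_eq_default _ _ (by omega)]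
      simp
  have hrow : encRow G w = Val.ofList ((List.finRange n).map
    (Val.nat ∘ fun j => if G.Adj w j then 1 else 0)) := rfl
  rw [hrow] at hc
  rw [RunsLE, wc_iff (body := clampBody (2 ^ c₀)) rfl]
  have hx1 := (size_le_self (tbl.getD (G.degree w) 0)).trans hx.1
  have hx2 := hx.2
  have e1 : m * (40 * m) = 40 * m ^ 2 := by ring
  have e2 : (n + 1) * (40 * m) ≤ 40 * m ^ 2 := by
    rw [← e1]; exact Nat.mul_le_mul_right _ hn
  have e3 : (G.degree w + 1) * (40 * m) ≤ 40 * m ^ 2 := by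
    rw [← e1]
    refine Nat.mul_le_mul_right _ ?_
    have := G.degree_lt_card_verts w
    simp only [Fintype.card_fin] at this
    omega
  simp only [clampBody, wp_arith, wp_call, wp_pair, wp_snd, wp_fst, wp_var, wp_lit, encCtx,
    List.getElem?_cons_zero, Option.some.injEq, exists_eq_left', Val.fst_pair, Val.snd_pair, hc,
    hc', hc₂, Val.toNat_nat, Op.apply_mul, Op.apply_div]
  refine ⟨rfl, ?_⟩
  omega

end FieldSpecs

end Potts


namespace Potts

open Cost

/-! ### The size of the numbers -/

section Size

variable {n q one b Y : ℕ} {G : SimpleGraph (Fin n)} [DecidableRel G.Adj] {cl : Fin n → ℕ}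

theorem alive_le (D : List (Fin n)) : alive D ≤ n :=
  (Finset.card_le_univ _).trans_eq (Fintype.card_fin n)

theorem length_aliveNbrs_le (D : List (Fin n)) (w : Fin n) : (aliveNbrs G D w).length ≤ n := by
  simpa using (nodup_aliveNbrs G D w).length_le_card

/-- A deletion adds at most `n` pending fields and uses up at least one surviving vertex, which is
worth `n` in this budget. The total number of fields therefore stays below `Y` throughout the
recursion. -/
theorem length_add_le_of_cons {D : List (Fin n)} {w : Fin n} (hw : w ∉ D) {f s : ℕ}
    (hY : f + s + n * alive D ≤ Y) :
    f + ((aliveNbrs G (w :: D) w).length + s) + n * alive (w :: D) ≤ Y := by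
  have h1 := alive_cons_lt hw
  have h2 := length_aliveNbrs_le (G := G) (w :: D) w
  have h3 : n * (alive (w :: D) + 1) ≤ n * alive D := Nat.mul_le_mul_left _ h1
  rw [mul_add] at h3
  omega

theorem colorStep_le (hb : b ≤ one) (hone : 1 ≤ one)
    {rec : ℕ → List (Fin n) → List (Fin n × Fin q) → List (Fin n × Fin q) → ℕ} {k : ℕ}
    {D : List (Fin n)} {F Q : List (Fin n × Fin q)} {w : Fin n} (hw : w ∉ D)
    (hY : F.length + Q.length + n * alive D ≤ Y)
    (hrec : ∀ Q' : List (Fin n × Fin q), F.length + Q'.length + n * alive (w :: D) ≤ Y →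
      rec (k - 1) (w :: D) F Q' ≤ (q * one ^ (2 * Y)) ^ alive (w :: D) * one ^ Q'.length)
    (y : Fin q) :
    colorStep G one b rec k D F Q w y ≤ one ^ (2 * Y) * (q * one ^ (2 * Y)) ^ (alive D - 1) := by
  have hq : 1 ≤ q := y.pos
  have hlen := length_add_le_of_cons (G := G) hw hY
  have h1 := hrec ((aliveNbrs G (w :: D) w).map (·, y) ++ Q) (by simpa using hlen)
  have h2 := intFactor_le hb hone F w y
  have h3 := intFactor_le hb hone Q w y
  have hM : 1 ≤ q * one ^ (2 * Y) := Nat.mul_pos hq (Nat.pow_pos hone)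
  have halive := alive_cons_lt hw
  calc colorStep G one b rec k D F Q w y
      ≤ one ^ F.length * one ^ Q.length * ((q * one ^ (2 * Y)) ^ alive (w :: D) *
          one ^ ((aliveNbrs G (w :: D) w).length + Q.length)) := by
        refine Nat.mul_le_mul (Nat.mul_le_mul h2 h3) ?_
        simpa using h1
    _ = one ^ (F.length + Q.length + ((aliveNbrs G (w :: D) w).length + Q.length)) *
          (q * one ^ (2 * Y)) ^ alive (w :: D) := by
        rw [pow_add, pow_add]; ring
    _ ≤ _ := Nat.mul_le_mul (Nat.pow_le_pow_right hone (by omega))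
        (Nat.pow_le_pow_right hM (by omega))

theorem sum_colorStep_le (hb : b ≤ one) (hone : 1 ≤ one)
    {rec : ℕ → List (Fin n) → List (Fin n × Fin q) → List (Fin n × Fin q) → ℕ} {k : ℕ}
    {D : List (Fin n)} {F Q : List (Fin n × Fin q)} {w : Fin n} (hw : w ∉ D)
    (hY : F.length + Q.length + n * alive D ≤ Y)
    (hrec : ∀ Q' : List (Fin n × Fin q), F.length + Q'.length + n * alive (w :: D) ≤ Y →
      rec (k - 1) (w :: D) F Q' ≤ (q * one ^ (2 * Y)) ^ alive (w :: D) * one ^ Q'.length) :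
    ∑ y, colorStep G one b rec k D F Q w y ≤ (q * one ^ (2 * Y)) ^ alive D := by
  have halive := alive_cons_lt hw
  obtain ⟨u, hu⟩ : ∃ u, alive D = u + 1 := ⟨alive D - 1, by omega⟩
  refine (Finset.sum_le_sum fun y _ => colorStep_le hb hone hw hY hrec y).trans ?_
  rw [hu, Finset.sum_const, Finset.card_univ, Fintype.card_fin, smul_eq_mul, add_tsub_cancel_right,
    pow_succ]
  exact le_of_eq (by ring)

theorem estStep_le (hcl : ∀ w, cl w ≤ one)
    {rec : ℕ → List (Fin n) → List (Fin n × Fin q) → List (Fin n × Fin q) → ℕ} (k : ℕ)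
    (D : List (Fin n)) (F : List (Fin n × Fin q)) (w : Fin n) (a : Fin q) :
    estStep G one b cl rec k D F w a ≤ one := by
  rw [estStep]
  split_ifs
  exacts [le_rfl, max_le (hcl w) (Nat.sub_le _ _)]

/-- A deletion contributes at most a factor `q` for the sum over colors and `one ^ (2 * Y)` for the
fields. A pending field contributes at most `one`. The logarithm of the result is polynomial in the
input size. -/
theorem val_le (hq : 1 ≤ q) (hb : b ≤ one) (hone : 1 ≤ one) (hcl : ∀ w, cl w ≤ one) (N k : ℕ)
    (D : List (Fin n)) (F Q : List (Fin n × Fin q)) (hY : F.length + Q.length + n * alive D ≤ Y) :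
    val G one b cl N k D F Q ≤ (q * one ^ (2 * Y)) ^ alive D * one ^ Q.length := by
  have hM : 1 ≤ q * one ^ (2 * Y) := Nat.mul_pos hq (Nat.pow_pos hone)
  induction N generalizing k D F Q with
  | zero => exact Nat.mul_pos (Nat.pow_pos hM) (Nat.pow_pos hone)
  | succ N ih =>
    induction Q with
    | nil => exact Nat.mul_pos (Nat.pow_pos hM) (Nat.pow_pos hone)
    | cons p Q ihq =>
      obtain ⟨w, a⟩ := p
      rw [List.length_cons] at hY
      have ihq' := ihq (by omega)
      rw [val] at ihq' ⊢
      rw [valStep]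
      have hone' : one ^ Q.length ≤ one ^ (Q.length + 1) := Nat.pow_le_pow_right hone (by omega)
      split_ifs with hw hc
      · exact ihq'.trans (Nat.mul_le_mul_left _ hone')
      · have h := sum_colorStep_le (G := G) (k := k) (Q := (w, a) :: Q) hb hone hw
          (by simpa using hY) fun Q' hQ' => ih (k - 1) (w :: D) F Q' hQ'
        exact h.trans (Nat.le_mul_of_pos_right _ (Nat.pow_pos hone))
      · rw [List.length_cons, pow_succ]
        calc _ ≤ one * ((q * one ^ (2 * Y)) ^ alive D * one ^ Q.length) :=
              Nat.mul_le_mul (estStep_le hcl _ _ _ _ _) ihq'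
          _ = _ := by ring

/-- A bound for all numbers that occur. -/
def numBound (n q one Y : ℕ) : ℕ := one * ((q * one ^ (2 * Y)) ^ n * one ^ Y)

theorem pow_mul_le_numBound (hq : 1 ≤ q) (hone : 1 ≤ one) {u v : ℕ} (hu : u ≤ n) (hv : v ≤ Y) :
    one * ((q * one ^ (2 * Y)) ^ u * one ^ v) ≤ numBound n q one Y :=
  Nat.mul_le_mul_left _ (Nat.mul_le_mul
    (Nat.pow_le_pow_right (Nat.mul_pos hq (Nat.pow_pos hone)) hu) (Nat.pow_le_pow_right hone hv))

theorem size_mul_le (a b : ℕ) : (a * b).size ≤ a.size + b.size := by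
  rw [Nat.size_le, pow_add]
  exact Nat.mul_lt_mul'' (Nat.lt_size_self a) (Nat.lt_size_self b)

theorem size_pow_le (a k : ℕ) : (a ^ k).size ≤ k * a.size + 1 := by
  rw [Nat.size_le, pow_succ, mul_comm k, pow_mul]
  have h : a ^ k ≤ (2 ^ a.size) ^ k := Nat.pow_le_pow_left (Nat.lt_size_self a).le k
  have : 0 < (2 ^ a.size) ^ k := by positivity
  omega

theorem size_numBound_le : (numBound n q one Y).size ≤
    one.size + ((n * (q.size + (2 * Y * one.size + 1)) + 1) + (Y * one.size + 1)) := by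
  refine (size_mul_le _ _).trans (Nat.add_le_add_left ((size_mul_le _ _).trans
    (Nat.add_le_add ?_ (size_pow_le _ _))) _)
  refine (size_pow_le _ _).trans (Nat.add_le_add_right (Nat.mul_le_mul_left _ ?_) _)
  exact (size_mul_le _ _).trans (Nat.add_le_add_left (size_pow_le _ _) _)

end Size

/-! ### Running times: the recursion -/

section ValSpecs

variable {n q c₀ c₁ : ℕ} {tbl : List ℕ} {β : ℝ} {m one b Y : ℕ} {G : SimpleGraph (Fin n)}
  [DecidableRel G.Adj]

local notation "PP" => pottsProgram q c₀ c₁ tbl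

/-- Bounds for the sizes of the data by `m`. -/
structure SizeOK (n q c₀ one b Y m : ℕ) (tbl : List ℕ) : Prop where
  q_pos : 1 ≤ q
  q_le : q ≤ m
  n_le : n + 2 ≤ m
  Y_le : Y + 1 ≤ m
  b_le : b ≤ one
  one_pos : 1 ≤ one
  size_le : (numBound n q one Y).size ≤ m
  tbl_le : ∀ x ∈ tbl, x ≤ m
  size_tbl_le : ∀ x ∈ tbl, (x * one).size ≤ m
  size_pow_le : (2 ^ c₀).size ≤ m

namespace SizeOK

variable (h : SizeOK n q c₀ one b Y m tbl)

include h

theorem m_pos : 1 ≤ m := by have := h.n_le; omega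

theorem numBound_pos : one ≤ numBound n q one Y :=
  Nat.le_mul_of_pos_right _ (Nat.mul_pos (Nat.pow_pos (Nat.mul_pos h.q_pos (Nat.pow_pos h.one_pos)))
    (Nat.pow_pos h.one_pos))

theorem size_one_le : one.size ≤ m := (size_mono h.numBound_pos).trans h.size_le

theorem size_pow_one_le {v : ℕ} (hv : v ≤ Y) : (one ^ v).size ≤ m := by
  refine (size_mono ?_).trans h.size_le
  refine le_trans ?_ (pow_mul_le_numBound h.q_pos h.one_pos (Nat.zero_le n) hv)
  rw [pow_zero, one_mul]
  exact Nat.le_mul_of_pos_left _ h.one_pos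

end SizeOK

/-- The argument of the functions that handle a color. -/
def encState (G : SimpleGraph (Fin n)) [DecidableRel G.Adj] (one b : ℕ) (tbl : List ℕ) (k : ℕ)
    (D : List (Fin n)) (F : List (Fin n × Fin q)) (v : Val) : Val :=
  .pair (encCtx G one b tbl) (.pair (.nat k) (.pair (encVerts D) (.pair (encFields F) v)))

/-- The time `T` must serve all colors, so the hypothesis on the recursive call concerns every
pending list with the given positions. It can be met because `cost` ignores colors. -/
theorem color_runs (h : SizeOK n q c₀ one b Y m tbl) {N k T : ℕ} (hk : k ≤ m) {D : List (Fin n)}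
    (hD : D.Nodup) {F Q : List (Fin n × Fin q)} {w : Fin n} (hw : w ∉ D)
    (hcl : ∀ w, clampAt G tbl one (2 ^ c₀) w ≤ one)
    (hY : F.length + Q.length + n * alive D ≤ Y)
    (hrec : ∀ Q', Q'.map Prod.fst = aliveNbrs G (w :: D) w ++ Q.map Prod.fst →
      RunsLE PP β 10 (encState G one b tbl (k - 1) (w :: D) F (encFields Q'))
        (.nat (val G one b (clampAt G tbl one (2 ^ c₀)) N (k - 1) (w :: D) F Q')) T) (y : Fin q) :
    RunsLE PP β 7 (encState G one b tbl k D F (.pair (encFields Q) (.pair (.nat w) (.nat y))))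
      (.nat (colorStep G one b (val G one b (clampAt G tbl one (2 ^ c₀)) N) k D F Q w y))
      (700 * m ^ 3 + T) := by
  have hn := h.n_le
  have hm := h.m_pos
  have hYm := h.Y_le
  have hlen : D.length ≤ n := by simpa using hD.length_le_card
  obtain ⟨t₁, ht₁, hc₁⟩ := (factor_runs (q' := q) (c₀ := c₀) (c₁ := c₁) (tbl := tbl) (β := β) hm
    (by omega) h.q_le h.b_le h.one_pos h.size_one_le F (h.size_pow_one_le (by omega)) w
    y).exists_time
  obtain ⟨t₂, ht₂, hc₂⟩ := (factor_runs (q' := q) (c₀ := c₀) (c₁ := c₁) (tbl := tbl) (β := β) hm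
    (by omega) h.q_le h.b_le h.one_pos h.size_one_le Q (h.size_pow_one_le (by omega)) w
    y).exists_time
  obtain ⟨t₃, ht₃, hc₃⟩ := (row_runs (q' := q) (c₀ := c₀) (c₁ := c₁) (tbl := tbl) (β := β) G hm
    (by omega) w).exists_time
  obtain ⟨t₄, ht₄, hc₄⟩ := (alive_nbrs_runs (q' := q) (c₀ := c₀) (c₁ := c₁) (tbl := tbl) (β := β)
    G hm (by omega) w y (w :: D) (by simp; omega) Q).exists_time
  obtain ⟨t₅, ht₅, hc₅⟩ := (hrec ((aliveNbrs G (w :: D) w).map (·, y) ++ Q)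
    (by simp [Function.comp_def])).exists_time
  have hlen' := length_add_le_of_cons (G := G) hw hY
  have hval := val_le (G := G) h.q_pos h.b_le h.one_pos hcl N (k - 1) (w :: D) F
    ((aliveNbrs G (w :: D) w).map (·, y) ++ Q) (by simpa using hlen')
  have hnb := pow_mul_le_numBound (n := n) (Y := Y) h.q_pos h.one_pos (alive_le (w :: D))
    (v := ((aliveNbrs G (w :: D) w).map (·, y) ++ Q).length) (by simp; omega)
  have s₁ : (val G one b (clampAt G tbl one (2 ^ c₀)) N (k - 1) (w :: D) F
      ((aliveNbrs G (w :: D) w).map (·, y) ++ Q)).size ≤ m :=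
    (size_mono (hval.trans ((Nat.le_mul_of_pos_left _ h.one_pos).trans hnb))).trans h.size_le
  have s₂ : (intFactor one b F w y * intFactor one b Q w y).size ≤ m := by
    refine (size_mono ?_).trans (h.size_pow_one_le (v := F.length + Q.length) (by omega))
    rw [pow_add]
    exact Nat.mul_le_mul (intFactor_le h.b_le h.one_pos _ _ _) (intFactor_le h.b_le h.one_pos _ _ _)
  have s₃ : (intFactor one b F w y).size ≤ m :=
    (size_mono (intFactor_le h.b_le h.one_pos F w y)).trans (h.size_pow_one_le (by omega))
  have s₄ : (intFactor one b Q w y).size ≤ m :=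
    (size_mono (intFactor_le h.b_le h.one_pos Q w y)).trans (h.size_pow_one_le (by omega))
  have s₅ : k.size ≤ m := size_le_of_lt hk
  have b₁ : (F.length + 1) * (100 * m) ≤ 100 * m ^ 2 := by
    calc (F.length + 1) * (100 * m) ≤ m * (100 * m) := Nat.mul_le_mul_right _ (by omega)
      _ = _ := by ring
  have b₂ : (Q.length + 1) * (100 * m) ≤ 100 * m ^ 2 := by
    calc (Q.length + 1) * (100 * m) ≤ m * (100 * m) := Nat.mul_le_mul_right _ (by omega)
      _ = _ := by ring
  have b₃ : m * (40 * m) = 40 * m ^ 2 := by ring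
  have b₄ : (n + 1) * (100 * m ^ 2) ≤ 100 * m ^ 3 := by
    calc (n + 1) * (100 * m ^ 2) ≤ m * (100 * m ^ 2) := Nat.mul_le_mul_right _ (by omega)
      _ = _ := by ring
  have b₅ : m ^ 2 ≤ m ^ 3 := Nat.pow_le_pow_right hm (by norm_num)
  have b₆ : m ≤ m ^ 2 := Nat.le_self_pow two_ne_zero m
  rw [encVerts_cons] at hc₄
  rw [encState, encVerts_cons] at hc₅
  rw [RunsLE, wc_iff (body := colorBody) rfl]
  simp only [encCtx] at hc₅
  simp [colorBody, encState, encCtx, hc₁, hc₂, hc₃, hc₄, hc₅, colorStep]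
  omega

theorem sum_colors_runs (h : SizeOK n q c₀ one b Y m tbl) {N k T : ℕ} (hk : k ≤ m)
    {D : List (Fin n)} (hD : D.Nodup) {F Q : List (Fin n × Fin q)} {w : Fin n} (hw : w ∉ D)
    (hcl : ∀ w, clampAt G tbl one (2 ^ c₀) w ≤ one)
    (hY : F.length + Q.length + n * alive D ≤ Y)
    (hrec : ∀ Q', Q'.map Prod.fst = aliveNbrs G (w :: D) w ++ Q.map Prod.fst →
      RunsLE PP β 10 (encState G one b tbl (k - 1) (w :: D) F (encFields Q'))
        (.nat (val G one b (clampAt G tbl one (2 ^ c₀)) N (k - 1) (w :: D) F Q')) T) (j : ℕ)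
    (hj : j ≤ q) :
    RunsLE PP β 8 (encState G one b tbl k D F (.pair (encFields Q) (.pair (.nat w) (.nat j))))
      (.nat (∑ y ∈ Finset.univ.filter (fun y : Fin q => (y : ℕ) < j),
        colorStep G one b (val G one b (clampAt G tbl one (2 ^ c₀)) N) k D F Q w y))
      (j * (1000 * m ^ 3 + T) + 100) := by
  have hsum := sum_colorStep_le (G := G) (k := k) (Q := Q) (q := q) h.b_le h.one_pos hw hY
    fun Q' hQ' => val_le (G := G) h.q_pos h.b_le h.one_pos hcl N (k - 1) (w :: D) F Q' hQ'
  set f := colorStep G one b (val G one b (clampAt G tbl one (2 ^ c₀)) N) k D F Q w with hf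
  have hsub : ∀ s : Finset (Fin q), (∑ y ∈ s, f y).size ≤ m := fun s => by
    refine (size_mono ?_).trans h.size_le
    refine le_trans (Finset.sum_le_sum_of_subset (Finset.subset_univ s)) (hsum.trans ?_)
    refine le_trans ?_ (pow_mul_le_numBound (n := n) h.q_pos h.one_pos (alive_le D)
      (Nat.zero_le Y))
    rw [pow_zero, mul_one]
    exact Nat.le_mul_of_pos_left _ h.one_pos
  have hm := h.m_pos
  have b₅ : m ^ 2 ≤ m ^ 3 := Nat.pow_le_pow_right hm (by norm_num)
  have b₆ : m ≤ m ^ 2 := Nat.le_self_pow two_ne_zero m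
  induction j with
  | zero =>
    rw [RunsLE, wc_iff (body := sumColorsBody) rfl]
    simp [sumColorsBody, encState]
  | succ j ih =>
    obtain ⟨t₁, ht₁, hc₁⟩ := (color_runs (c₁ := c₁) h hk hD hw hcl hY hrec ⟨j, hj⟩).exists_time
    obtain ⟨t₂, ht₂, hc₂⟩ := (ih (by omega)).exists_time
    have e : ∑ y ∈ Finset.univ.filter (fun y : Fin q => (y : ℕ) < j + 1), f y =
        f ⟨j, hj⟩ + ∑ y ∈ Finset.univ.filter (fun y : Fin q => (y : ℕ) < j), f y := by
      rw [← Finset.sum_insert (by simp)]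
      refine Finset.sum_congr ?_ fun _ _ => rfl
      ext y
      simp [Fin.ext_iff]
      omega
    have s₁ : (f ⟨j, hj⟩).size ≤ m := by simpa using hsub {⟨j, hj⟩}
    have s₂ := hsub (Finset.univ.filter fun y : Fin q => (y : ℕ) < j)
    have s₃ : (j + 1).size ≤ m := size_le_of_lt (hj.trans h.q_le)
    have e₂ : (j + 1) * (1000 * m ^ 3 + T) = j * (1000 * m ^ 3 + T) + (1000 * m ^ 3 + T) := by ring
    rw [← hf] at hc₁
    rw [encState] at hc₁ hc₂
    rw [RunsLE, wc_iff (body := sumColorsBody) rfl]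
    rw [e]
    simp [sumColorsBody, encState, hc₁, hc₂]
    omega

theorem sum_filter_lt (f : Fin q → ℕ) : ∑ y ∈ Finset.univ.filter (fun y : Fin q => (y : ℕ) < q), f y = ∑ y, f y := by
  refine Finset.sum_congr ?_ fun _ _ => rfl
  ext y
  simp

set_option maxHeartbeats 1000000 in
theorem est_runs (h : SizeOK n q c₀ one b Y m tbl) {N k T : ℕ} (hk : k ≤ m) {D : List (Fin n)}
    (hD : D.Nodup) {F : List (Fin n × Fin q)} {w : Fin n} (hw : w ∉ D)
    (hcl : ∀ w, clampAt G tbl one (2 ^ c₀) w ≤ one)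
    (hY : F.length + n * alive D ≤ Y)
    (hrec : ∀ Q', Q'.map Prod.fst = aliveNbrs G (w :: D) w → k ≠ 0 →
      RunsLE PP β 10 (encState G one b tbl (k - 1) (w :: D) F (encFields Q'))
        (.nat (val G one b (clampAt G tbl one (2 ^ c₀)) N (k - 1) (w :: D) F Q')) T) (a : Fin q) :
    RunsLE PP β 9 (encState G one b tbl k D F (.pair (.nat w) (.pair (.nat a)
      (.nat (clampAt G tbl one (2 ^ c₀) w)))))
      (.nat (estStep G one b (clampAt G tbl one (2 ^ c₀))
        (val G one b (clampAt G tbl one (2 ^ c₀)) N) k D F w a))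
      (300 * m ^ 3 + if k = 0 then 0 else (q + 1) * (1000 * m ^ 3 + T)) := by
  have hm := h.m_pos
  have b₅ : m ^ 2 ≤ m ^ 3 := Nat.pow_le_pow_right hm (by norm_num)
  have b₆ : m ≤ m ^ 2 := Nat.le_self_pow two_ne_zero m
  by_cases hk0 : k = 0
  · subst hk0
    rw [RunsLE, wc_iff (body := estBody q) rfl]
    simp [estBody, encState, estStep, encCtx]
    omega
  have hrec' : ∀ Q' : List (Fin n × Fin q), Q'.map Prod.fst =
      aliveNbrs G (w :: D) w ++ ([] : List (Fin n × Fin q)).map Prod.fst → _ :=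
    fun Q' hQ' => hrec Q' (by simpa using hQ') hk0
  have hY' : F.length + ([] : List (Fin n × Fin q)).length + n * alive D ≤ Y := by simpa using hY
  obtain ⟨t₁, ht₁, hc₁⟩ := (color_runs (c₁ := c₁) h hk hD hw hcl hY' hrec' a).exists_time
  obtain ⟨t₂, ht₂, hc₂⟩ :=
    (sum_colors_runs (c₁ := c₁) h hk hD hw hcl hY' hrec' q le_rfl).exists_time
  rw [sum_filter_lt] at hc₂
  have hsum := sum_colorStep_le (G := G) (k := k) (Q := []) (q := q) h.b_le h.one_pos hw hY'
    fun Q' hQ' => val_le (G := G) h.q_pos h.b_le h.one_pos hcl N (k - 1) (w :: D) F Q' hQ'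
  set f := colorStep G one b (val G one b (clampAt G tbl one (2 ^ c₀)) N) k D F [] w with hf
  have hle : f a ≤ ∑ y, f y :=
    Finset.single_le_sum (f := f) (fun _ _ => Nat.zero_le _) (Finset.mem_univ a)
  have hbd : one * ∑ y, f y ≤ numBound n q one Y := by
    refine le_trans (Nat.mul_le_mul_left _ hsum) ?_
    have := pow_mul_le_numBound (n := n) h.q_pos h.one_pos (alive_le D) (Nat.zero_le Y)
    rwa [pow_zero, mul_one] at this
  have hone := h.one_pos
  have hbd' : ∑ y, f y ≤ numBound n q one Y := (Nat.le_mul_of_pos_left _ hone).trans hbd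
  have hone' := h.numBound_pos
  have hb := h.b_le
  have hclw := hcl w
  have sz : ∀ x, x ≤ numBound n q one Y → x.size ≤ m := fun x hx => (size_mono hx).trans h.size_le
  have s₁ := sz _ (hle.trans hbd')
  have s₂ := sz _ hbd'
  have s₃ := sz _ hone'
  have s₄ := sz _ (hb.trans hone')
  have s₅ := sz (one - b) ((Nat.sub_le _ _).trans hone')
  have s₆ := sz ((one - b) * f a) ((Nat.mul_le_mul (Nat.sub_le _ _) hle).trans hbd)
  have s₇ := sz ((one - b) * f a / ∑ y, f y) ((Nat.div_le_self _ _).trans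
    ((Nat.mul_le_mul (Nat.sub_le _ _) hle).trans hbd))
  have s₈ := sz (one - (one - b) * f a / ∑ y, f y) ((Nat.sub_le _ _).trans hone')
  have s₉ := sz _ (hclw.trans hone')
  have s₁₀ := sz (one - (one - b) * f a / ∑ y, f y - clampAt G tbl one (2 ^ c₀) w)
    (((Nat.sub_le _ _).trans (Nat.sub_le _ _)).trans hone')
  have e₂ : (q + 1) * (1000 * m ^ 3 + T) = q * (1000 * m ^ 3 + T) + (1000 * m ^ 3 + T) := by ring
  have e₃ : estStep G one b (clampAt G tbl one (2 ^ c₀))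
      (val G one b (clampAt G tbl one (2 ^ c₀)) N) k D F w a =
      clampAt G tbl one (2 ^ c₀) w + (one - (one - b) * f a / ∑ y, f y -
        clampAt G tbl one (2 ^ c₀) w) := by
    rw [estStep, if_neg hk0, ← hf]
    omega
  rw [encState, encFields_nil] at hc₁ hc₂
  simp only [encCtx] at hc₁ hc₂
  rw [RunsLE, wc_iff (body := estBody q) rfl, e₃, if_neg hk0]
  simp [estBody, encState, encCtx, hk0, hc₁, hc₂]
  omega

set_option maxHeartbeats 1000000 in
-- The recursion `cost` mirrors the calls of the program. The `2000 * m ^ 3` per node covers list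
-- handling and arithmetic on numbers of at most `m` bits. The fuel `N` exceeds the number of
-- surviving vertices, so the recursion never reaches its default value.
theorem val_runs (h : SizeOK n q c₀ one b Y m tbl)
    (hcl : ∀ w, clampAt G tbl one (2 ^ c₀) w ≤ one) (N k : ℕ) (hk : k ≤ m) (D : List (Fin n))
    (hD : D.Nodup) (hN : alive D < N) (F Q : List (Fin n × Fin q))
    (hY : F.length + Q.length + n * alive D ≤ Y) :
    RunsLE PP β 10 (encState G one b tbl k D F (encFields Q))
      (.nat (val G one b (clampAt G tbl one (2 ^ c₀)) N k D F Q))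
      (cost G (clampAt G tbl one (2 ^ c₀)) q (2000 * m ^ 3) N k D (Q.map Prod.fst)) := by
  have hm := h.m_pos
  have hn := h.n_le
  have hYm := h.Y_le
  have b₅ : m ^ 2 ≤ m ^ 3 := Nat.pow_le_pow_right hm (by norm_num)
  have b₆ : m ≤ m ^ 2 := Nat.le_self_pow two_ne_zero m
  set cl := clampAt G tbl one (2 ^ c₀) with hcldef
  induction N generalizing k D F Q with
  | zero => omega
  | succ N ih =>
    have hlen : D.length ≤ n := by simpa using hD.length_le_card
    induction Q with
    | nil =>
      rw [RunsLE, wc_iff (body := valBody q) rfl]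
      simp [valBody, encState, val, valStep, cost, costStep]
      omega
    | cons p Q ihq =>
      obtain ⟨w, a⟩ := p
      rw [List.length_cons] at hY
      obtain ⟨t₁, ht₁, hc₁⟩ := (ihq (by omega)).exists_time
      obtain ⟨t₂, ht₂, hc₂⟩ := (mem_runs (q' := q) (c₀ := c₀) (c₁ := c₁) (tbl := tbl) (β := β)
        hm (by omega) w D).exists_time
      have b₁ : (D.length + 1) * (40 * m) ≤ 40 * m ^ 2 := by
        calc (D.length + 1) * (40 * m) ≤ m * (40 * m) := Nat.mul_le_mul_right _ (by omega)
          _ = _ := by ring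
      rw [encState] at hc₁
      by_cases hw : w ∈ D
      · rw [if_pos hw] at hc₂
        have e₁ : val G one b cl (N + 1) k D F ((w, a) :: Q) = val G one b cl (N + 1) k D F Q := by
          simp [val, valStep, hw]
        have e₂ : cost G cl q (2000 * m ^ 3) (N + 1) k D (((w, a) :: Q).map Prod.fst) =
            2000 * m ^ 3 + cost G cl q (2000 * m ^ 3) (N + 1) k D (Q.map Prod.fst) := by
          simp [cost, costStep, hw]
        rw [RunsLE, wc_iff (body := valBody q) rfl, e₁, e₂]
        simp [valBody, encState, hc₁, hc₂]
        omega
      rw [if_neg hw] at hc₂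
      have hD' : (w :: D).Nodup := List.nodup_cons.2 ⟨hw, hD⟩
      have hN' : alive (w :: D) < N := by
        have := alive_cons_lt hw
        omega
      obtain ⟨t₃, ht₃, hc₃⟩ := (clamp_runs (q' := q) (c₀ := c₀) (c₁ := c₁) (tbl := tbl) (β := β) G
        hm (by omega) (b := b) h.size_one_le h.tbl_le h.size_tbl_le h.size_pow_le w).exists_time
      rw [← hcldef] at hc₃
      by_cases hc : cl w = 0
      · have hlen' := length_add_le_of_cons (G := G) (f := F.length) (s := Q.length + 1) hw
          (by simpa using hY)
        obtain ⟨t₄, ht₄, hc₄⟩ := (sum_colors_runs (G := G) (c₁ := c₁) (β := β) (N := N)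
          (Q := (w, a) :: Q)
          (T := cost G cl q (2000 * m ^ 3) N (k - 1) (w :: D)
            (aliveNbrs G (w :: D) w ++ w :: Q.map Prod.fst)) h hk hD hw hcl (by simpa using hY)
          (fun Q' hQ' => by
            have hl := congrArg List.length hQ'
            simp only [List.length_map, List.length_append, List.length_cons] at hl
            have := ih (k - 1) (by omega) (w :: D) hD' hN' F Q' (by rw [hl]; exact hlen')
            rw [hQ'] at this
            exact this) q le_rfl).exists_time
        rw [sum_filter_lt, ← hcldef, encState, encFields_cons] at hc₄
        have e₁ : val G one b cl (N + 1) k D F ((w, a) :: Q) =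
            ∑ y, colorStep G one b (val G one b cl N) k D F ((w, a) :: Q) w y := by
          simp [val, valStep, hw, hc]
        have e₂ : cost G cl q (2000 * m ^ 3) (N + 1) k D (((w, a) :: Q).map Prod.fst) =
            2000 * m ^ 3 + q * (2000 * m ^ 3 + cost G cl q (2000 * m ^ 3) N (k - 1) (w :: D)
            (aliveNbrs G (w :: D) w ++ w :: Q.map Prod.fst)) := by
          simp [cost, costStep, hw, hc]
        rw [hc] at hc₃
        rw [RunsLE, wc_iff (body := valBody q) rfl, e₁, e₂]
        simp [valBody, encState, hc₂, hc₃, hc₄]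
        set T := cost G cl q (2000 * m ^ 3) N (k - 1) (w :: D)
            (aliveNbrs G (w :: D) w ++ w :: Q.map Prod.fst)
        have b₇ : q * (1000 * m ^ 3 + T) ≤ q * (2000 * m ^ 3 + T) :=
          Nat.mul_le_mul_left _ (by omega)
        omega
      · have hlen' := length_add_le_of_cons (G := G) (f := Q.length + F.length) (s := 0) (Y := Y) hw
          (by omega)
        obtain ⟨t₄, ht₄, hc₄⟩ := (est_runs (G := G) (c₁ := c₁) (β := β) (N := N) (F := Q ++ F)
          (T := cost G cl q (2000 * m ^ 3) N (k - 1) (w :: D)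
            (aliveNbrs G (w :: D) w)) h hk hD hw hcl (by simp; omega)
          (fun Q' hQ' _ => by
            have hl := congrArg List.length hQ'
            simp only [List.length_map] at hl
            have := ih (k - 1) (by omega) (w :: D) hD' hN' (Q ++ F) Q'
              (by rw [hl, List.length_append]; exact hlen')
            rw [hQ'] at this
            exact this) a).exists_time
        obtain ⟨t₅, ht₅, hc₅⟩ := (append_runs (q' := q) (c₀ := c₀) (c₁ := c₁) (tbl := tbl) (β := β)
          Q F).exists_time
        rw [← hcldef, encState] at hc₄
        have e₁ : val G one b cl (N + 1) k D F ((w, a) :: Q) =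
            estStep G one b cl (val G one b cl N) k D (Q ++ F) w a *
              val G one b cl (N + 1) k D F Q := by
          simp [val, valStep, hw, hc]
        have e₂ : cost G cl q (2000 * m ^ 3) (N + 1) k D (((w, a) :: Q).map Prod.fst) =
            2000 * m ^ 3 + ((if k = 0 then 0 else (q + 1) * (2000 * m ^ 3 +
              cost G cl q (2000 * m ^ 3) N (k - 1) (w :: D) (aliveNbrs G (w :: D) w))) +
              cost G cl q (2000 * m ^ 3) (N + 1) k D (Q.map Prod.fst)) := by
          simp [cost, costStep, hw, hc]
        have s₁ : (estStep G one b cl (val G one b cl N) k D (Q ++ F) w a).size ≤ m :=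
          (size_mono (estStep_le hcl _ _ _ _ _)).trans h.size_one_le
        have s₂ : (val G one b cl (N + 1) k D F Q).size ≤ m := by
          refine (size_mono ((val_le (G := G) h.q_pos h.b_le h.one_pos hcl (N + 1) k D F Q
            (by omega)).trans ((Nat.le_mul_of_pos_left _ h.one_pos).trans
              (pow_mul_le_numBound (n := n) (Y := Y) h.q_pos h.one_pos (alive_le D)
                (by omega))))).trans h.size_le
        rw [RunsLE, wc_iff (body := valBody q) rfl, e₁, e₂]
        simp [valBody, encState, hc₁, hc₂, hc₃, hc₄, hc₅, hc]
        set T := cost G cl q (2000 * m ^ 3) N (k - 1) (w :: D) (aliveNbrs G (w :: D) w)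
        have b₇ : (if k = 0 then 0 else (q + 1) * (1000 * m ^ 3 + T)) ≤
            (if k = 0 then 0 else (q + 1) * (2000 * m ^ 3 + T)) := by
          split_ifs
          · exact le_rfl
          · exact Nat.mul_le_mul_left _ (by omega)
        omega

end ValSpecs

end Potts


namespace Potts

open Cost

/-! ### Running times: reading the input and the main function -/

section MainSpecs

variable {n q c₀ c₁ : ℕ} {tbl : List ℕ} {β : ℝ} {m : ℕ}

local notation "PP" => pottsProgram q c₀ c₁ tbl

theorem pow_runs (hm : 1 ≤ m) (i : ℕ) (hi : i ≤ m) :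
    RunsLE PP β 12 (.nat i) (.nat (2 ^ i)) ((i + 1) * (40 * m)) := by
  induction i with
  | zero =>
    rw [RunsLE, wc_iff (body := powBody) rfl]
    simp [powBody]
    omega
  | succ i ih =>
    obtain ⟨t, ht, hc⟩ := (ih (by omega)).exists_time
    rw [RunsLE, wc_iff (body := powBody) rfl]
    have h1 := size_le_self (i + 1)
    have h2 : (2 ^ i).size = i + 1 := Nat.size_pow
    have e : (i + 1 + 1) * (40 * m) = (i + 1) * (40 * m) + 40 * m := by ring
    have h3 : (2 : ℕ).size = 2 := by simpa using Nat.size_pow (n := 1)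
    simp [powBody, hc, h2, h3, pow_succ']
    omega

theorem size_div_two {a : ℕ} (ha : a ≠ 0) : a.size = (a / 2).size + 1 := by
  conv_lhs => rw [← Nat.bit_bodd_div2 a]
  rw [Nat.size_bit (by rwa [Nat.bit_bodd_div2]), Nat.div2_val]

theorem size_runs (hm : 2 ≤ m) (a : ℕ) (ha : a ≤ m) :
    RunsLE PP β 13 (.nat a) (.nat a.size) ((a.size + 1) * (40 * m)) := by
  induction a using Nat.strong_induction_on with
  | _ a ih =>
    by_cases h0 : a = 0
    · subst h0
      rw [RunsLE, wc_iff (body := sizeBody) rfl]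
      simp [sizeBody]
      omega
    · obtain ⟨t, ht, hc⟩ := (ih (a / 2) (by omega) (by omega)).exists_time
      have e : ((a / 2).size + 1 + 1) * (40 * m) = ((a / 2).size + 1) * (40 * m) + 40 * m := by ring
      have h1 := size_le_self a
      have h2 := size_le_self (a / 2).size
      have h3 : (2 : ℕ).size = 2 := by simpa using Nat.size_pow (n := 1)
      have h4 := size_div_two h0
      rw [RunsLE, wc_iff (body := sizeBody) rfl]
      have h5 := size_le_self (a / 2)
      simp [sizeBody, hc, h0, h3, h4]
      rw [h4] at h1
      omega

/-- The entry of the boundary list. -/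
def boundaryCode (σ : Fin n → Option (Fin q)) (i : Fin n) : ℕ :=
  (σ i).elim 0 fun y => y + 1

theorem boundaryCode_eq_zero {σ : Fin n → Option (Fin q)} {i : Fin n} :
    boundaryCode σ i = 0 ↔ σ i = none := by
  cases h : σ i <;> simp [boundaryCode, h]

/-- The vertices with a fixed color. -/
def fixedVerts (σ : Fin n → Option (Fin q)) (l : List (Fin n)) : List (Fin n) :=
  l.filter fun i => (σ i).isSome

/-- The fields that the vertices of `l` with a fixed color exert. -/
def fixedFields (G : SimpleGraph (Fin n)) [DecidableRel G.Adj] (σ : Fin n → Option (Fin q))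
    (D l : List (Fin n)) : List (Fin n × Fin q) :=
  l.flatMap fun i => (σ i).elim [] fun y => (aliveNbrs G D i).map (·, y)

theorem dead_runs (σ : Fin n → Option (Fin q)) (l : List (Fin n)) (i : ℕ)
    (hl : ∀ (j : ℕ) (h : j < l.length), (l[j] : ℕ) = i + j) (hi : i + l.length ≤ m) (hm : 1 ≤ m) :
    RunsLE PP β 14 (.pair (Val.ofList (l.map fun j => .nat (boundaryCode σ j))) (.nat i))
      (encVerts (fixedVerts σ l)) ((l.length + 1) * (40 * m)) := by
  induction l generalizing i with
  | nil =>
    rw [RunsLE, wc_iff (body := deadBody) rfl]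
    simp [deadBody, fixedVerts]
    omega
  | cons a l ih =>
    have hl' : ∀ (j : ℕ) (h : j < l.length), (l[j] : ℕ) = i + 1 + j := fun j h => by
      have := hl (j + 1) (by simpa using h)
      simp only [List.getElem_cons_succ] at this
      omega
    have ha : (a : ℕ) = i := (hl 0 (Nat.succ_pos _)).trans (add_zero i)
    rw [List.length_cons] at hi
    obtain ⟨t, ht, hc⟩ := (ih (i + 1) hl' (by omega)).exists_time
    have e : (l.length + 1 + 1) * (40 * m) = (l.length + 1) * (40 * m) + 40 * m := by ring
    have h1 : i.size ≤ m := size_le_of_lt (by omega)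
    rw [fixedVerts] at hc
    rw [RunsLE, wc_iff (body := deadBody) rfl]
    cases h : σ a with
    | none =>
      have hb : boundaryCode σ a = 0 := boundaryCode_eq_zero.2 h
      simp [deadBody, hc, hb, h, fixedVerts]
      omega
    | some y =>
      have hb : boundaryCode σ a = y + 1 := by simp [boundaryCode, h]
      simp [deadBody, hc, hb, h, fixedVerts, ha]
      omega

theorem fields_runs (G : SimpleGraph (Fin n)) [DecidableRel G.Adj] (σ : Fin n → Option (Fin q))
    (D l : List (Fin n)) (hm : 1 ≤ m) (hn : n + 1 ≤ m) (hq : q ≤ m) (hD : D.length + 1 ≤ m) :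
    RunsLE PP β 15 (.pair (Val.ofList (l.map fun j => .nat (boundaryCode σ j)))
      (.pair (Val.ofList (l.map fun j => encRow G j)) (encVerts D)))
      (encFields (fixedFields G σ D l)) ((l.length + 1) * (200 * m ^ 3)) := by
  have b₅ : m ^ 2 ≤ m ^ 3 := Nat.pow_le_pow_right hm (by norm_num)
  have b₆ : m ≤ m ^ 2 := Nat.le_self_pow two_ne_zero m
  have b₄ : (n + 1) * (100 * m ^ 2) ≤ 100 * m ^ 3 := by
    calc (n + 1) * (100 * m ^ 2) ≤ m * (100 * m ^ 2) := Nat.mul_le_mul_right _ (by omega)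
      _ = _ := by ring
  induction l with
  | nil =>
    rw [RunsLE, wc_iff (body := fieldsBody) rfl]
    simp [fieldsBody, fixedFields]
    omega
  | cons a l ih =>
    obtain ⟨t, ht, hc⟩ := ih.exists_time
    have e : (l.length + 1 + 1) * (200 * m ^ 3) = (l.length + 1) * (200 * m ^ 3) + 200 * m ^ 3 := by
      ring
    rw [fixedFields] at hc
    rw [RunsLE, wc_iff (body := fieldsBody) rfl]
    cases h : σ a with
    | none =>
      have hb : boundaryCode σ a = 0 := boundaryCode_eq_zero.2 h
      simp [fieldsBody, hc, hb, h, fixedFields]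
      omega
    | some y =>
      have hb : boundaryCode σ a = y + 1 := by simp [boundaryCode, h]
      obtain ⟨t', ht', hc'⟩ := (alive_nbrs_runs (q' := q) (c₀ := c₀) (c₁ := c₁) (tbl := tbl)
        (β := β) G hm (by omega) a y D hD (fixedFields G σ D l)).exists_time
      have h1 : ((y : ℕ) + 1).size ≤ m := size_le_of_lt (by omega)
      rw [fixedFields] at hc'
      simp [fieldsBody, hc, hc', hb, h, fixedFields]
      omega

theorem wp_litList {P : Program} {env : List Val} (l : List ℕ) {Q : Val → ℕ → Prop} :
    WP P β env (litList l) Q ↔ Q (Val.ofList (l.map Val.nat)) (2 * l.length + 1) := by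
  induction l generalizing Q with
  | nil => simp [litList]
  | cons a l ih =>
    rw [litList, wp_pair, wp_lit, ih]
    simp only [List.map_cons, Val.ofList_cons, List.length_cons]
    rw [show 1 + (2 * l.length + 1) + 1 = 2 * (l.length + 1) + 1 by ring]

/-- The input of the program. -/
def encInput (G : SimpleGraph (Fin n)) [DecidableRel G.Adj] (σ : Fin n → Option (Fin q))
    (v : Fin n) (x : Fin q) : Val :=
  .pair (.nat n) (.pair (encGraph G) (.pair
    (Val.ofList ((List.finRange n).map fun j => .nat (boundaryCode σ j)))
    (.pair (.nat v) (.nat x))))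

variable (G : SimpleGraph (Fin n)) [DecidableRel G.Adj] (σ : Fin n → Option (Fin q))

theorem boundary_runs (hm : 1 ≤ m) (hn : n + 1 ≤ m) (v : Fin n) :
    RunsLE PP β 1 (.pair (Val.ofList ((List.finRange n).map fun j => .nat (boundaryCode σ j)))
      (.nat v)) (.nat (boundaryCode σ v)) (m * (40 * m)) := by
  have h := nth_runs (q := q) (c₀ := c₀) (c₁ := c₁) (tbl := tbl) (β := β) hm
    ((List.finRange n).map fun j => Val.nat (boundaryCode σ j)) v (by omega)
  have e : ((List.finRange n).map fun j => Val.nat (boundaryCode σ j)).getD v (.nat 0) =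
      .nat (boundaryCode σ v) := by
    simp
  rw [e] at h
  exact h.mono (Nat.mul_le_mul_right _ (by omega))

theorem main_runs_of_fixed (hm : 1 ≤ m) (hn : n + 1 ≤ m) (hq : q ≤ m) {v : Fin n} {y : Fin q}
    (hv : σ v = some y) (x : Fin q) :
    RunsLE PP β 0 (encInput G σ v x) (.pair (.nat (if y = x then 1 else 0)) (.nat 1))
      (200 * m ^ 2) := by
  have hb : boundaryCode σ v = y + 1 := by simp [boundaryCode, hv]
  obtain ⟨t, ht, hc⟩ := (boundary_runs (q := q) (c₀ := c₀) (c₁ := c₁) (tbl := tbl) (β := β) σ hm hn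
    v).exists_time
  rw [hb] at hc
  have b₆ : m ≤ m ^ 2 := Nat.le_self_pow two_ne_zero m
  have e : m * (40 * m) = 40 * m ^ 2 := by ring
  have h1 : ((y : ℕ) + 1).size ≤ m := size_le_of_lt (by omega)
  have h2 : ((x : ℕ) + 1).size ≤ m := size_le_of_lt (by omega)
  have h3 : ((y : ℕ) - x).size ≤ m := size_le_of_lt (by omega)
  have h4 : ((x : ℕ) - y).size ≤ m := size_le_of_lt (by omega)
  have h5 : (x : ℕ).size ≤ m := size_le_of_lt (by omega)
  rw [RunsLE, wc_iff (body := mainBody q c₀ c₁ tbl) rfl]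
  by_cases hxy : y = x
  · subst hxy
    simp [mainBody, neTerm, encInput, hc]
    simp at h3
    omega
  · have h6 : (y : ℕ) ≠ x := fun h => hxy (Fin.ext h)
    have h7 : ¬ ((y : ℕ) - x = 0 ∧ (x : ℕ) - y = 0) := by omega
    simp only [mainBody, neTerm, encInput, wp_bind, wp_snd, wp_fst, wp_var, wp_call, wp_pair,
      wp_ite, wp_arith, wp_lit]
    simp [hc, hxy]
    omega

/-- The factor `q + 1` counts the color contributions at `v`: one for the numerator and `q` for the
denominator. -/
theorem main_runs_of_free {Y : ℕ}
    (h : SizeOK n q c₀ (2 ^ (n + c₀)) ⌊β * 2 ^ (n + c₀)⌋₊ Y m tbl)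
    (hcm : n + c₀ ≤ m) (hkm : c₁ * n.size + 1 ≤ m) (hc₁ : c₁ ≤ m) (htm : tbl.length ≤ m)
    (hcl : ∀ w, clampAt G tbl (2 ^ (n + c₀)) (2 ^ c₀) w ≤ 2 ^ (n + c₀))
    {D : List (Fin n)} (hD : D = fixedVerts σ (List.finRange n)) {F : List (Fin n × Fin q)}
    (hF : F = fixedFields G σ D (List.finRange n)) (hY : F.length + n * alive D ≤ Y)
    {v : Fin n} (hv : σ v = none) (x : Fin q) {k N : ℕ} (hk : k = c₁ * n.size + 1) (hN : n < N)
    {T : ℕ} (hT : T = cost G (clampAt G tbl (2 ^ (n + c₀)) (2 ^ c₀)) q (2000 * m ^ 3) N (k - 1)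
      (v :: D) (aliveNbrs G (v :: D) v))
    {b : ℕ} (hb : b = ⌊β * 2 ^ (n + c₀)⌋₊) {rec}
    (hrec : rec = val G (2 ^ (n + c₀)) b (clampAt G tbl (2 ^ (n + c₀)) (2 ^ c₀)) N) :
    RunsLE PP β 0 (encInput G σ v x)
      (.pair (.nat (colorStep G (2 ^ (n + c₀)) b rec k D F [] v x))
        (.nat (∑ y, colorStep G (2 ^ (n + c₀)) b rec k D F [] v y)))
      ((q + 1) * (2000 * m ^ 4 + T)) := by
  subst hrec hb hk
  have hm := h.m_pos
  have hn := h.n_le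
  have hvD : v ∉ D := by simp [hD, fixedVerts, hv]
  have hDn : D.Nodup := hD ▸ (List.nodup_finRange n).filter _
  have hlen : D.length ≤ n := by simpa using hDn.length_le_card
  have hrec' : ∀ Q' : List (Fin n × Fin q),
      Q'.map Prod.fst = aliveNbrs G (v :: D) v ++ ([] : List (Fin n × Fin q)).map Prod.fst →
      RunsLE PP β 10 (encState G (2 ^ (n + c₀)) ⌊β * 2 ^ (n + c₀)⌋₊ tbl (c₁ * n.size + 1 - 1)
        (v :: D) F (encFields Q')) (.nat (val G (2 ^ (n + c₀)) ⌊β * 2 ^ (n + c₀)⌋₊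
          (clampAt G tbl (2 ^ (n + c₀)) (2 ^ c₀)) N (c₁ * n.size + 1 - 1) (v :: D) F Q')) T := by
    intro Q' hQ'
    rw [List.map_nil, List.append_nil] at hQ'
    have hl := length_add_le_of_cons (G := G) (f := F.length) (s := 0) hvD (by simpa using hY)
    rw [← hQ', List.length_map] at hl
    have := val_runs (G := G) (β := β) (c₁ := c₁) h hcl N (c₁ * n.size + 1 - 1) (by omega)
      (v :: D) (List.nodup_cons.2 ⟨hvD, hDn⟩) ((alive_le _).trans_lt hN) F Q' (by omega)
    rwa [hQ', ← hT] at this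
  obtain ⟨t₁, ht₁, r₁⟩ := (color_runs (G := G) (Q := []) (c₁ := c₁) (β := β) h hkm hDn hvD hcl
    (by simpa using hY) hrec' x).exists_time
  have hsum := sum_colors_runs (G := G) (Q := []) (c₁ := c₁) (β := β) h hkm hDn hvD hcl
    (by simpa using hY) hrec' q le_rfl
  rw [sum_filter_lt] at hsum
  obtain ⟨t₂, ht₂, r₂⟩ := hsum.exists_time
  obtain ⟨t₃, ht₃, r₃⟩ := (boundary_runs (q := q) (c₀ := c₀) (c₁ := c₁) (tbl := tbl) (β := β) σ hm
    (by omega) v).exists_time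
  obtain ⟨t₄, ht₄, r₄⟩ := (pow_runs (q := q) (c₀ := c₀) (c₁ := c₁) (tbl := tbl) (β := β) hm
    (n + c₀) hcm).exists_time
  obtain ⟨t₅, ht₅, r₅⟩ := (size_runs (q := q) (c₀ := c₀) (c₁ := c₁) (tbl := tbl) (β := β)
    (m := m) (by omega) n (by omega)).exists_time
  obtain ⟨t₆, ht₆, r₆⟩ := (dead_runs (q := q) (c₀ := c₀) (c₁ := c₁) (tbl := tbl) (β := β) (m := m)
    σ (List.finRange n) 0 (by simp) (by simp; omega) hm).exists_time
  obtain ⟨t₇, ht₇, r₇⟩ := (fields_runs (q := q) (c₀ := c₀) (c₁ := c₁) (tbl := tbl) (β := β) (m := m)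
    G σ D (List.finRange n) hm (by omega) h.q_le (by omega)).exists_time
  rw [boundaryCode_eq_zero.2 hv] at r₃
  rw [← hD] at r₆
  rw [← hF] at r₇
  rw [List.length_finRange] at ht₆ ht₇
  have hg : Val.ofList ((List.finRange n).map fun j => encRow G j) = encGraph G := rfl
  rw [hg] at r₇
  have q₁ : m ^ 2 ≤ m ^ 3 := Nat.pow_le_pow_right hm (by norm_num)
  have q₂ : m ≤ m ^ 2 := Nat.le_self_pow two_ne_zero m
  have q₃ : m ^ 3 ≤ m ^ 4 := Nat.pow_le_pow_right hm (by norm_num)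
  have u₁ : m * (40 * m) = 40 * m ^ 2 := by ring
  have u₂ : (n + c₀ + 1) * (40 * m) ≤ 80 * m ^ 2 := by
    calc (n + c₀ + 1) * (40 * m) ≤ (2 * m) * (40 * m) := Nat.mul_le_mul_right _ (by omega)
      _ = _ := by ring
  have hns := size_le_self n
  have u₃ : (n.size + 1) * (40 * m) ≤ 40 * m ^ 2 := by
    calc (n.size + 1) * (40 * m) ≤ m * (40 * m) := Nat.mul_le_mul_right _ (by omega)
      _ = _ := by ring
  have u₄ : (n + 1) * (40 * m) ≤ 40 * m ^ 2 := by
    calc (n + 1) * (40 * m) ≤ m * (40 * m) := Nat.mul_le_mul_right _ (by omega)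
      _ = _ := by ring
  have u₅ : (n + 1) * (200 * m ^ 3) ≤ 200 * m ^ 4 := by
    calc (n + 1) * (200 * m ^ 3) ≤ m * (200 * m ^ 3) := Nat.mul_le_mul_right _ (by omega)
      _ = _ := by ring
  have v₁ : n.size ≤ m := by omega
  have v₂ : c₀.size ≤ m := size_le_of_lt (by omega)
  have v₃ : c₁.size ≤ m := size_le_of_lt hc₁
  have v₄ : n.size.size ≤ m := size_le_of_lt v₁
  have v₅ : (c₁ * n.size).size ≤ m := size_le_of_lt (by omega)
  have u₆ : q * (1000 * m ^ 3 + T) + (700 * m ^ 3 + T) + 1000 * m ^ 4 ≤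
      (q + 1) * (2000 * m ^ 4 + T) := by
    have : q * (1000 * m ^ 3) ≤ q * (2000 * m ^ 4) := Nat.mul_le_mul_left _ (by omega)
    have e : (q + 1) * (2000 * m ^ 4 + T) = q * (2000 * m ^ 4) + 2000 * m ^ 4 + q * T + T := by ring
    have e' : q * (1000 * m ^ 3 + T) = q * (1000 * m ^ 3) + q * T := by ring
    omega
  rw [encState, encCtx] at r₁ r₂
  rw [RunsLE, wc_iff (body := mainBody q c₀ c₁ tbl) rfl]
  simp only [encFields_nil] at r₁ r₂
  simp [mainBody, encInput, wp_litList, r₁, r₂, r₃, r₄, r₅, r₆, r₇]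
  omega

theorem _root_.Cost.RunsLE.runsIn {P : Program} {u w : Val} {T : ℕ} (h : RunsLE P β 0 u w T) :
    ∃ t ≤ T + 2, P.RunsIn β u w t := by
  obtain ⟨body, hf, _, t, he, rfl, ht⟩ := h
  exact ⟨1 + t + 1, by omega, .call (.var rfl) hf he⟩

end MainSpecs

end Potts


namespace Potts

/-! ### From Gibbs marginals to partition functions with fields -/

section Marginals

variable {n q : ℕ} (G : SimpleGraph (Fin n)) [DecidableRel G.Adj] {β : ℝ}

theorem numMono_eq_card (c : Fin n → Fin q) : numMono G c =
    (Finset.univ.filter fun p : Fin n × Fin n => p.1 < p.2 ∧ G.Adj p.1 p.2 ∧ c p.1 = c p.2).card := by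
  rw [numMono, ← Set.ncard_coe_finset, ← Set.InjOn.ncard_image (f := fun p : Fin n × Fin n => s(p.1, p.2))]
  · congr 1
    ext e
    induction e using Sym2.ind with
    | _ a b =>
      simp only [Set.mem_ofPred_eq, SimpleGraph.mem_edgeSet, Sym2.map_mk, Sym2.mk_isDiag_iff,
        Set.mem_image, Finset.coe_filter, Finset.mem_univ, true_and, Prod.exists]
      constructor
      · rintro ⟨h1, h2⟩
        rcases lt_or_gt_of_ne h1.ne with h | h
        · exact ⟨a, b, ⟨h, h1, h2⟩, rfl⟩
        · exact ⟨b, a, ⟨h, h1.symm, h2.symm⟩, Sym2.eq_swap⟩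
      · rintro ⟨a', b', ⟨h1, h2, h3⟩, h4⟩
        rcases Sym2.eq_iff.1 h4 with ⟨rfl, rfl⟩ | ⟨rfl, rfl⟩
        · exact ⟨h2, h3⟩
        · exact ⟨h2.symm, h3.symm⟩
  · rintro ⟨a, b⟩ h ⟨a', b'⟩ h' he
    simp only [Finset.coe_filter, Finset.mem_univ, true_and, Set.mem_ofPred_eq] at h h'
    rcases Sym2.eq_iff.1 he with ⟨rfl, rfl⟩ | ⟨rfl, rfl⟩
    · rfl
    · exact absurd h.1 h'.1.not_gt

theorem pow_numMono (c : Fin n → Fin q) : β ^ numMono G c =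
    ∏ i, ∏ j, if i < j ∧ G.Adj i j ∧ c i = c j then β else 1 := by
  rw [numMono_eq_card, ← Finset.prod_const, Finset.prod_filter, ← Finset.univ_product_univ,
    Finset.prod_product]

variable (β) in
/-- The weight of the edges between vertices with a fixed color. -/
noncomputable def fixedWeight (σ : Fin n → Option (Fin q)) : ℝ :=
  ∏ i, ∏ j, if i < j ∧ G.Adj i j ∧ (σ i).isSome ∧ (σ j).isSome ∧ σ i = σ j then β else 1

theorem fieldWeight_fixedFields (σ : Fin n → Option (Fin q)) (D : List (Fin n))
    {c : Fin n → Fin q} (hc : ∀ i y, σ i = some y → c i = y) :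
    fieldWeight β D (fixedFields G σ D (List.finRange n)) c =
      ∏ i, ∏ j, if (σ i).isSome ∧ G.Adj i j ∧ j ∉ D ∧ c j = c i then β else 1 := by
  have h : ∀ l : List (Fin n), fieldWeight β D (fixedFields G σ D l) c =
      (l.map fun i => ∏ j, if (σ i).isSome ∧ G.Adj i j ∧ j ∉ D ∧ c j = c i then β else 1).prod := by
    intro l
    induction l with
    | nil => simp [fieldWeight, fixedFields]
    | cons a l ih =>
      rw [List.map_cons, List.prod_cons, ← ih, fixedFields, List.flatMap_cons, fieldWeight_append]
      congr 1
      cases h : σ a with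
      | none => simp [fieldWeight]
      | some y => simp [fieldWeight_aliveNbrs, pow_count_aliveNbrs, hc a y h]
  rw [h, ← List.ofFn_eq_map, List.prod_ofFn]

theorem mem_fixedVerts {σ : Fin n → Option (Fin q)} {i : Fin n} :
    i ∈ fixedVerts σ (List.finRange n) ↔ (σ i).isSome := by
  simp [fixedVerts]

/-- Edges are sorted by their fixed endpoints: two give a constant, one gives a field at the free
endpoint, none gives an edge of the reduced graph. -/
theorem pow_numMono_eq_mul_fullWeight (σ : Fin n → Option (Fin q)) {c : Fin n → Fin q}
    (hc : ∀ i y, σ i = some y → c i = y) {D : List (Fin n)}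
    (hD : D = fixedVerts σ (List.finRange n)) :
    β ^ numMono G c = fixedWeight G β σ *
      fullWeight G β D (fixedFields G σ D (List.finRange n)) c := by
  have hmem : ∀ i, i ∈ D ↔ (σ i).isSome := fun i => by rw [hD]; exact mem_fixedVerts
  rw [fullWeight, fieldWeight_fixedFields G σ D hc, pow_numMono, fixedWeight, edgeWeight]
  have h1 : ∀ i j, (if i < j ∧ G.Adj i j ∧ c i = c j then β else 1) =
      (if i < j ∧ G.Adj i j ∧ (σ i).isSome ∧ (σ j).isSome ∧ σ i = σ j then β else 1) *
      (if i < j ∧ G.Adj i j ∧ i ∉ D ∧ j ∉ D ∧ c i = c j then β else 1) *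
      (if i < j ∧ (σ i).isSome ∧ G.Adj i j ∧ j ∉ D ∧ c j = c i then β else 1) *
      (if i < j ∧ (σ j).isSome ∧ G.Adj j i ∧ i ∉ D ∧ c i = c j then β else 1) := by
    intro i j
    simp only [hmem]
    cases hi : σ i with
    | none =>
      cases hj : σ j with
      | none => simp
      | some z => simp [G.adj_comm]
    | some y =>
      cases hj : σ j with
      | none => simp [eq_comm]
      | some z => simp [hc i y hi, hc j z hj]
  simp_rw [h1, Finset.prod_mul_distrib]
  rw [Finset.prod_comm (f := fun i j =>
    if i < j ∧ (σ j).isSome ∧ G.Adj j i ∧ i ∉ D ∧ c i = c j then β else 1), mul_assoc, mul_assoc]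
  congr 2
  rw [← Finset.prod_mul_distrib]
  refine Finset.prod_congr rfl fun i _ => ?_
  rw [← Finset.prod_mul_distrib]
  refine Finset.prod_congr rfl fun j _ => ?_
  -- Edges with one fixed endpoint appear twice in the splitting, according to whether the fixed
  -- endpoint comes first. For a given ordered pair only one of the two factors is active.
  by_cases h : G.Adj i j
  · rcases lt_or_gt_of_ne h.ne with h' | h' <;> simp [h', h'.not_gt]
  · simp [h]

/-- Fixing the coordinates in `l` one at a time, each selects one of `q` equal classes. This
converts sums over extensions of the boundary condition into sums over all configurations. -/
theorem pow_mul_sum_agree (σ : Fin n → Option (Fin q)) (l : List (Fin n)) (hl : l.Nodup)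
    (hσ : ∀ w ∈ l, (σ w).isSome) (h : (Fin n → Fin q) → ℝ)
    (hh : ∀ w ∈ l, ∀ c z, h (Function.update c w z) = h c) :
    q ^ l.length * ∑ c with ∀ w ∈ l, σ w = some (c w), h c = ∑ c, h c := by
  induction l with
  | nil => simp
  | cons w l ih =>
    rw [List.nodup_cons] at hl
    rw [← ih hl.2 (fun w hw => hσ w (by simp [hw])) (fun w hw => hh w (by simp [hw]))]
    obtain ⟨y, hy⟩ := Option.isSome_iff_exists.1 (hσ w (by simp))
    have key := mul_sum_color_eq (w := w)
      (fun c => if ∀ w ∈ l, σ w = some (c w) then h c else 0) ?_ y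
    · rw [List.length_cons, pow_succ, mul_assoc]
      congr 1
      rw [Finset.sum_filter (p := fun c : Fin n → Fin q => ∀ w ∈ l, _), ← key,
        ← Finset.sum_filter, Finset.filter_filter]
      congr 2
      ext c
      simp only [List.forall_mem_cons, hy, Option.some.injEq, eq_comm]
    · intro c z
      rw [hh w (by simp)]
      congr 1
      refine propext (forall₂_congr fun i hi => ?_)
      rw [Function.update_of_ne (fun e => hl.1 (by rwa [← e]))]

/-- The boundary condition of an instance. -/
noncomputable def Instance.fixedColor (Ω : Instance q n) (i : Fin n) : Option (Fin q) :=
  if h : i ∈ Ω.fixedSet then some (Ω.boundary ⟨i, h⟩) else none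

theorem Instance.fixedColor_of_mem (Ω : Instance q n) {i : Fin n} (h : i ∈ Ω.fixedSet) :
    Ω.fixedColor i = some (Ω.boundary ⟨i, h⟩) := by
  simp [fixedColor, h]

theorem Instance.fixedColor_of_notMem (Ω : Instance q n) {i : Fin n} (h : i ∉ Ω.fixedSet) :
    Ω.fixedColor i = none := by
  simp [fixedColor, h]

theorem Instance.agree_iff (Ω : Instance q n) (c : Fin n → Fin q) :
    (∀ u : Ω.fixedSet, c u = Ω.boundary u) ↔
      ∀ w ∈ fixedVerts Ω.fixedColor (List.finRange n), Ω.fixedColor w = some (c w) := by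
  constructor
  · intro h w hw
    rw [mem_fixedVerts] at hw
    by_cases hm : w ∈ Ω.fixedSet
    · rw [Ω.fixedColor_of_mem hm, h ⟨w, hm⟩]
    · simp [Ω.fixedColor_of_notMem hm] at hw
  · rintro h ⟨w, hw⟩
    have := h w (by simp [mem_fixedVerts, Ω.fixedColor_of_mem hw])
    rw [Ω.fixedColor_of_mem hw] at this
    exact (Option.some.inj this).symm

theorem Instance.weight_nonneg (Ω : Instance q n) (hβ : 0 ≤ β) (c : Fin n → Fin q) :
    0 ≤ Ω.weight β c := by
  rw [weight]
  split_ifs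
  exacts [pow_nonneg hβ _, le_rfl]

theorem Instance.Feasible.partitionFunction_pos {Ω : Instance q n} (h : Ω.Feasible β)
    (hβ : 0 ≤ β) : 0 < Ω.partitionFunction β := by
  obtain ⟨c, hc⟩ := h
  exact hc.trans_le (Finset.single_le_sum (f := fun c => Ω.weight β c)
    (fun c _ => Ω.weight_nonneg hβ c) (Finset.mem_univ c))

theorem Instance.Feasible.marginal_of_fixed {Ω : Instance q n} (h : Ω.Feasible β) (hβ : 0 ≤ β)
    {v : Fin n} {y : Fin q} (hv : Ω.fixedColor v = some y) (x : Fin q) :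
    Ω.marginal β v x = if y = x then 1 else 0 := by
  have hm : v ∈ Ω.fixedSet := by
    by_contra hm
    simp [Ω.fixedColor_of_notMem hm] at hv
  rw [Ω.fixedColor_of_mem hm] at hv
  have hw : ∀ c, c v ≠ y → Ω.weight β c = 0 := by
    intro c hc
    rw [weight, if_neg]
    intro h'
    exact hc ((h' ⟨v, hm⟩).trans (Option.some.inj hv))
  rw [marginal]
  split_ifs with hxy
  · subst hxy
    rw [← Finset.sum_div, Finset.sum_filter_of_ne, ← Instance.partitionFunction,
      div_self (h.partitionFunction_pos hβ).ne']
    intro c _ hc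
    by_contra h'
    exact hc (hw c h')
  · refine Finset.sum_eq_zero fun c hc => ?_
    rw [Finset.mem_filter] at hc
    rw [hw c (fun e => hxy (e.symm.trans hc.2)), zero_div]

/-- The test function is taken to be 1 for the partition function and the indicator of a color at a
free vertex for the marginal; the constants then cancel in the quotient. -/
theorem Instance.sum_weight_mul (Ω : Instance q n) [DecidableRel Ω.graph.Adj] {D : List (Fin n)}
    (hD : D = fixedVerts Ω.fixedColor (List.finRange n)) (g : (Fin n → Fin q) → ℝ)
    (hg : ∀ w ∈ D, ∀ c z, g (Function.update c w z) = g c) :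
    q ^ D.length * ∑ c, Ω.weight β c * g c = fixedWeight Ω.graph β Ω.fixedColor *
      ∑ c, fullWeight Ω.graph β D (fixedFields Ω.graph Ω.fixedColor D (List.finRange n)) c * g c := by
  have key := pow_mul_sum_agree Ω.fixedColor D (hD ▸ (List.nodup_finRange n).filter _)
    (fun w hw => by rwa [hD, mem_fixedVerts] at hw)
    (fun c => fullWeight Ω.graph β D
      (fixedFields Ω.graph Ω.fixedColor D (List.finRange n)) c * g c)
    (fun w hw c z => by rw [fullWeight_update _ hw, hg w hw])
  rw [← key, mul_left_comm]
  congr 1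
  rw [Finset.mul_sum, Finset.sum_filter]
  refine Finset.sum_congr rfl fun c _ => ?_
  rw [weight]
  simp only [Ω.agree_iff c, ← hD]
  split_ifs with h
  · rw [pow_numMono_eq_mul_fullWeight Ω.graph Ω.fixedColor _ hD, mul_assoc]
    intro i y hy
    have := h i (by rw [hD, mem_fixedVerts]; simp [hy])
    rw [hy] at this
    exact (Option.some.inj this).symm
  · rw [zero_mul]

theorem Instance.Feasible.marginal_of_free {Ω : Instance q n} [DecidableRel Ω.graph.Adj]
    (h : Ω.Feasible β) (hβ : 0 ≤ β) {D : List (Fin n)}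
    (hD : D = fixedVerts Ω.fixedColor (List.finRange n)) {F : List (Fin n × Fin q)}
    (hF : F = fixedFields Ω.graph Ω.fixedColor D (List.finRange n)) {v : Fin n} (hv : v ∉ D)
    (x : Fin q) :
    0 < fieldZ Ω.graph β D F ∧
      Ω.marginal β v x = fieldZAt Ω.graph β D F v x / fieldZ Ω.graph β D F := by
  have h1 := Ω.sum_weight_mul (β := β) hD (fun _ => 1) (fun _ _ _ _ => rfl)
  have h2 := Ω.sum_weight_mul (β := β) hD (fun c => if c v = x then 1 else 0) (fun w hw c z => by
    rw [Function.update_of_ne (fun e => hv (by rwa [e]))])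
  simp only [mul_one, ← hF, mul_ite, mul_zero, ← Finset.sum_filter] at h1 h2
  have hq : (0 : ℝ) < q ^ D.length := by
    have : (0 : ℝ) < q := by exact_mod_cast x.pos
    positivity
  have hZ := h.partitionFunction_pos hβ
  have hpos : 0 < fixedWeight Ω.graph β Ω.fixedColor * fieldZ Ω.graph β D F := by
    rw [fieldZ, ← h1]
    exact mul_pos hq hZ
  have hF0 : 0 < fieldZ Ω.graph β D F :=
    lt_of_le_of_ne (fieldZ_nonneg _ hβ _ _) (fun e => by simp [← e] at hpos)
  refine ⟨hF0, ?_⟩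
  have hK := (pos_iff_pos_of_mul_pos hpos).2 hF0
  rw [marginal, ← Finset.sum_div, partitionFunction, ← mul_div_mul_left _ _ hq.ne', h1, h2,
    mul_div_mul_left _ _ hK.ne', fieldZ, fieldZAt]

/-- A neighbor of a free vertex `w` is either fixed, and then exerts one field on `w`, or free, and
then counts as a surviving neighbor. It is never both. -/
theorem degreeInv_fixedFields (σ : Fin n → Option (Fin q)) {D : List (Fin n)}
    (hD : D = fixedVerts σ (List.finRange n)) :
    DegreeInv G (fun w => G.degree w) D
      ((fixedFields G σ D (List.finRange n)).map Prod.fst) [] := by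
  have hmem : ∀ i, i ∈ D ↔ (σ i).isSome := fun i => by rw [hD]; exact mem_fixedVerts
  intro w hw
  have h1 : ∀ l : List (Fin n), ((fixedFields G σ D l).map Prod.fst).count w +
      (l.filter fun i => G.Adj w i ∧ i ∉ D).length ≤
      (l.map fun j => if G.Adj w j then 1 else 0).sum := by
    intro l
    induction l with
    | nil => simp [fixedFields]
    | cons a l ih =>
      rw [fixedFields, List.flatMap_cons, List.map_append, List.count_append, ← fixedFields]
      rw [List.map_cons, List.sum_cons]
      cases h : σ a with
      | none =>
        have ha : a ∉ D := by simp [hmem, h]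
        by_cases hadj : G.Adj w a
        · rw [List.filter_cons_of_pos (by simp [ha, hadj])]
          simp only [Option.elim_none, List.map_nil, List.count_nil, List.length_cons, hadj, if_true]
          omega
        · rw [List.filter_cons_of_neg (by simp [hadj])]
          simp only [Option.elim_none, List.map_nil, List.count_nil, hadj, if_false]
          omega
      | some y =>
        have ha : a ∈ D := by simp [hmem, h]
        rw [List.filter_cons_of_neg (by simp [ha])]
        have h2 : (((aliveNbrs G D a).map (·, y)).map Prod.fst).count w ≤
            if G.Adj w a then 1 else 0 := by
          rw [List.map_map]
          have : (Prod.fst ∘ fun x : Fin n => (x, y)) = id := rfl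
          rw [this, List.map_id]
          split_ifs with hadj
          · exact List.nodup_iff_count_le_one.1 (nodup_aliveNbrs G D a) w
          · rw [List.count_eq_zero_of_not_mem]
            simp [hadj, G.adj_comm]
        simp only [Option.elim_some]
        omega
  have h3 := h1 (List.finRange n)
  rw [sum_row] at h3
  simpa [aliveNbrs] using h3

theorem length_fixedFields_le (σ : Fin n → Option (Fin q)) (D : List (Fin n)) :
    (fixedFields G σ D (List.finRange n)).length ≤ n * n := by
  have h : ∀ l : List (Fin n), (fixedFields G σ D l).length ≤ l.length * n := by
    intro l
    induction l with
    | nil => simp [fixedFields]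
    | cons a l ih =>
      rw [fixedFields, List.flatMap_cons, List.length_append, ← fixedFields, List.length_cons,
        add_mul, one_mul, add_comm]
      refine Nat.add_le_add ih ?_
      cases σ a with
      | none => simp
      | some y => simpa using length_aliveNbrs_le (G := G) D a
  simpa using h (List.finRange n)

theorem Instance.encode_eq (Ω : Instance q n) [DecidableRel Ω.graph.Adj] (v : Fin n) (x : Fin q) :
    Ω.encode v x = encInput Ω.graph Ω.fixedColor v x := by
  rw [encode, encInput, encGraph, List.ofFn_eq_map, List.ofFn_eq_map]
  congr 2
  · refine congrArg _ (List.map_congr_left fun i _ => ?_)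
    rw [encRow, List.ofFn_eq_map]
    congr! 4
    split_ifs <;> rfl
  · congr 1
    refine congrArg _ (List.map_congr_left fun i _ => ?_)
    by_cases h : i ∈ Ω.fixedSet
    · simp [h, boundaryCode, Ω.fixedColor_of_mem h]
    · simp [h, boundaryCode, Ω.fixedColor_of_notMem h]

end Marginals

end Potts


namespace Potts

/-! ### The clamps -/

section Clamps

variable {n q c₀ : ℕ} {β : ℝ}

/-- The clamp of the vertices of degree `d` in units of `2 ^ (-c₀)`. -/
noncomputable def clampNum (q c₀ : ℕ) (β : ℝ) (d : ℕ) : ℕ :=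
  open Classical in
  if (d : ℝ) < ((q : ℝ) - 1) / (1 - β) - 2 then
    ⌈2 ^ c₀ * ((q - 1 - (1 - β) * d) / (q - 1 - (1 - β) * d + (1 - β)) : ℝ)⌉₊ else 0

noncomputable def clampTable (q c₀ : ℕ) (β : ℝ) : List ℕ :=
  (List.range ⌈((q : ℝ) - 1) / (1 - β)⌉₊).map (clampNum q c₀ β)

/-- A finite table suffices: beyond its end no degree is low, and the default entry 0 marks
high-degree vertices. -/
theorem getD_clampTable (d : ℕ) : (clampTable q c₀ β).getD d 0 = clampNum q c₀ β d := by
  rw [clampTable]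
  by_cases h : d < ⌈((q : ℝ) - 1) / (1 - β)⌉₊
  · rw [List.getD_eq_getElem _ _ (by simpa using h)]
    simp
  · rw [List.getD_eq_default _ _ (by simpa using h), clampNum, if_neg]
    have := (Nat.ceil_le).1 (not_lt.1 h)
    linarith

theorem lt_threshold_iff (hβ1 : β < 1) {d : ℝ} :
    d < ((q : ℝ) - 1) / (1 - β) - 2 ↔ 2 * (1 - β) < q - 1 - (1 - β) * d := by
  rw [lt_sub_iff_add_lt, lt_div_iff₀ (by linarith)]
  constructor <;> intro h <;> linarith

/-- A clamp must lie between `x / (x + g)` and `(x + 1) / (x + 1 + g)`. The gap is bounded below in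
terms of `q` and `β` alone, so a multiple of `2 ^ (-c₀)` with constant `c₀` fits. The last bound
holds because `x > 2 g`. -/
theorem clampNum_spec (hq : 1 ≤ q) (hβ0 : 0 ≤ β) (hβ1 : β < 1)
    (hc₀ : (q : ℝ) * (q + 1) / (1 - β) ≤ 2 ^ c₀) {d : ℕ} {x : ℝ}
    (hx : x = q - 1 - (1 - β) * d) (hd : 2 * (1 - β) < x) :
    2 ^ c₀ * x ≤ clampNum q c₀ β d * (x + (1 - β)) ∧
      clampNum q c₀ β d * (x + 1 + (1 - β)) ≤ 2 ^ c₀ * (x + 1) ∧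
      (2 : ℝ) ^ c₀ ≤ 2 * clampNum q c₀ β d := by
  set g := 1 - β with hg
  have hg0 : 0 < g := by simp only [hg]; linarith
  have hx0 : 0 < x := by linarith
  have hq' : (1 : ℝ) ≤ q := by exact_mod_cast hq
  have hxq : x ≤ q - 1 := by
    rw [hx]
    have : 0 ≤ g * d := by positivity
    linarith
  have hg1 : g ≤ 1 := by simp only [hg]; linarith
  have hlow : (d : ℝ) < ((q : ℝ) - 1) / (1 - β) - 2 := (lt_threshold_iff hβ1).2 (by rwa [← hx])
  rw [clampNum, if_pos hlow, ← hg, ← hx]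
  have h1 := Nat.le_ceil ((2 : ℝ) ^ c₀ * (x / (x + g)))
  have h2 := Nat.ceil_lt_add_one (a := (2 : ℝ) ^ c₀ * (x / (x + g))) (by positivity)
  set A : ℝ := (⌈(2 : ℝ) ^ c₀ * (x / (x + g))⌉₊ : ℝ)
  set P : ℝ := (2 : ℝ) ^ c₀
  have hP : 0 < P := by positivity
  have e : P * (x / (x + g)) * (x + g) = P * x := by field_simp
  have h3 : P * x ≤ A * (x + g) := by
    rw [← e]
    exact mul_le_mul_of_nonneg_right h1 (by positivity)
  have h4 : A * (x + g) ≤ P * x + (x + g) := by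
    have := mul_le_mul_of_nonneg_right h2.le (show 0 ≤ x + g by positivity)
    rw [add_mul, e, one_mul] at this
    exact this
  refine ⟨h3, ?_, ?_⟩
  · rw [div_le_iff₀ hg0] at hc₀
    have h5 : (x + g) * (x + 1 + g) ≤ q * (q + 1) :=
      mul_le_mul (by linarith) (by linarith) (by positivity) (by positivity)
    have h6 := mul_le_mul_of_nonneg_right h4 (show 0 ≤ x + 1 + g by positivity)
    have h7 : A * (x + 1 + g) * (x + g) ≤ P * (x + 1) * (x + g) := by nlinarith
    exact le_of_mul_le_mul_right h7 (by positivity)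
  · by_contra! h
    nlinarith

theorem clampNum_le (hβ1 : β < 1) (d : ℕ) : clampNum q c₀ β d ≤ 2 ^ c₀ := by
  rw [clampNum]
  split_ifs with h
  · rw [lt_threshold_iff hβ1] at h
    rw [Nat.ceil_le]
    push_cast
    refine mul_le_of_le_one_right (by positivity) ?_
    rw [div_le_one (by linarith)]
    linarith
  · exact Nat.zero_le _

variable (G : SimpleGraph (Fin n)) [DecidableRel G.Adj]

theorem isLowDegree_iff {w : Fin n} :
    IsLowDegree q β G w ↔ (G.degree w : ℝ) < ((q : ℝ) - 1) / (1 - β) - 2 := by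
  rw [IsLowDegree]
  congr!

theorem clampAt_clampTable (w : Fin n) :
    clampAt G (clampTable q c₀ β) (2 ^ (n + c₀)) (2 ^ c₀) w =
      clampNum q c₀ β (G.degree w) * 2 ^ n := by
  rw [clampAt, getD_clampTable, pow_add, ← mul_assoc, Nat.mul_div_cancel _ (by positivity)]

theorem clampAt_le (hβ1 : β < 1) (w : Fin n) :
    clampAt G (clampTable q c₀ β) (2 ^ (n + c₀)) (2 ^ c₀) w ≤ 2 ^ (n + c₀) := by
  rw [clampAt_clampTable, pow_add, mul_comm]
  exact Nat.mul_le_mul_left _ (clampNum_le hβ1 _)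

theorem isLowDegree_of_clampAt (hβ1 : β < 1) {w : Fin n}
    (h : clampAt G (clampTable q c₀ β) (2 ^ (n + c₀)) (2 ^ c₀) w ≠ 0) :
    2 * (1 - β) < q - 1 - (1 - β) * G.degree w := by
  rw [clampAt_clampTable, clampNum] at h
  split_ifs at h with h'
  · exact (lt_threshold_iff hβ1).1 h'
  · simp at h

theorem clampAt_eq_zero (hq : 1 ≤ q) (hβ0 : 0 ≤ β) (hβ1 : β < 1)
    (hc₀ : (q : ℝ) * (q + 1) / (1 - β) ≤ 2 ^ c₀) {w : Fin n}
    (h : clampAt G (clampTable q c₀ β) (2 ^ (n + c₀)) (2 ^ c₀) w = 0) :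
    ¬ IsLowDegree q β G w := by
  rw [isLowDegree_iff, lt_threshold_iff hβ1]
  intro h'
  have h1 := (clampNum_spec hq hβ0 hβ1 hc₀ rfl h').2.2
  rw [clampAt_clampTable] at h
  have h2 : clampNum q c₀ β (G.degree w) = 0 := by simpa using h
  rw [h2, Nat.cast_zero, mul_zero] at h1
  exact absurd h1 (not_le.2 (by positivity))

theorem delta_of_low (hβ1 : β < 1) {d : ℕ} (h : 2 * (1 - β) < q - 1 - (1 - β) * d) :
    delta q β d = 2 * (1 - β) / (q - 1 - (1 - β) * d) := by
  rw [delta, if_pos ((lt_threshold_iff hβ1).2 h).le]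

/-- If the degree equals the threshold, the fraction in `delta` already has the value 1, so both
branches agree. -/
theorem delta_of_not_low (hβ1 : β < 1) {d : ℕ} (h : ¬ (d : ℝ) < ((q : ℝ) - 1) / (1 - β) - 2) :
    delta q β d = 1 := by
  rw [delta]
  split_ifs with h'
  · have e : (d : ℝ) = ((q : ℝ) - 1) / (1 - β) - 2 := le_antisymm h' (not_lt.1 h)
    have hg : 0 < 1 - β := by linarith
    have e' : (q : ℝ) - 1 - (1 - β) * d = 2 * (1 - β) := by
      rw [e]
      field_simp
      ring
    rw [e', div_self (by positivity)]
  · rfl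

/-- This uniform lower bound lets `δ` absorb additive rounding errors and compares unweighted with
weighted walk counts. -/
theorem le_delta (hq : 3 ≤ q) (hβ0 : 0 ≤ β) (hβ1 : β < 1) (d : ℕ) :
    2 * (1 - β) / (q - 1) ≤ delta q β d := by
  have hq' : (3 : ℝ) ≤ q := by exact_mod_cast hq
  by_cases h : (d : ℝ) < ((q : ℝ) - 1) / (1 - β) - 2
  · rw [lt_threshold_iff hβ1] at h
    rw [delta_of_low hβ1 h]
    have : 0 ≤ (1 - β) * d := mul_nonneg (by linarith) (by positivity)
    exact div_le_div_of_nonneg_left (by linarith) (by linarith) (by linarith)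
  · rw [delta_of_not_low hβ1 h, div_le_one (by linarith)]
    linarith

theorem delta_pos (hq : 3 ≤ q) (hβ0 : 0 ≤ β) (hβ1 : β < 1) (d : ℕ) : 0 < delta q β d := by
  have hq' : (3 : ℝ) ≤ q := by exact_mod_cast hq
  exact (div_pos (by linarith) (by linarith)).trans_le (le_delta hq hβ0 hβ1 d)

/-- The relative rounding error of one step. -/
noncomputable def rounding (β : ℝ) (n : ℕ) : ℝ := (2 / β * n + 2) / 2 ^ n

theorem rounding_nonneg (hβ0 : 0 ≤ β) : 0 ≤ rounding β n := by
  rw [rounding]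
  positivity

/-- For `z ≥ 2` the loss of at most 1 is a factor at least `1 - 1 / z ≥ exp (- 2 / z)`. When `β = 0`
the floor is exact and the conventional value of division by zero gives error 0. -/
theorem near_floor (hβ0 : 0 ≤ β) {one : ℝ} (hone : 0 < one) (h : 2 / β ≤ one) :
    Near (2 / (β * one)) (⌊β * one⌋₊ : ℝ) (one * β) := by
  rcases hβ0.eq_or_lt with rfl | hβ
  · simpa using Near.refl 0
  have h1 : 2 ≤ one * β := (div_le_iff₀ hβ).1 h
  rw [mul_comm β one]
  set z := one * β
  refine ⟨?_, (Nat.floor_le (by linarith)).trans (le_mul_of_one_le_left (by linarith) ?_)⟩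
  · have h2 := Nat.lt_floor_add_one z
    have h3 : 0 < z := by linarith
    have h4 : Real.exp (-(2 / z)) ≤ 1 - 1 / z := by
      have h5 : 1 + 2 / z ≤ Real.exp (2 / z) := by linarith [Real.add_one_le_exp (2 / z)]
      rw [Real.exp_neg]
      refine (inv_anti₀ (by positivity) h5).trans ?_
      rw [inv_le_iff_one_le_mul₀ (by positivity)]
      have : (1 - 1 / z) * (1 + 2 / z) - 1 = (z - 2) / z ^ 2 := by
        field_simp
        ring
      have h6 : 0 ≤ (z - 2) / z ^ 2 := div_nonneg (by linarith) (by positivity)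
      linarith
    have h5 := mul_le_mul_of_nonneg_right h4 h3.le
    have h6 : (1 - 1 / z) * z = z - 1 := by field_simp
    linarith
  · exact Real.one_le_exp (by positivity)

/-- The `c₀` digits make the clamps integral; the additional `n` digits make the rounding error
exponentially small. -/
theorem scaleOK (hq : 3 ≤ q) (hβ0 : 0 ≤ β) (hβ1 : β < 1)
    (hc₀ : (q : ℝ) * (q + 1) / (1 - β) ≤ 2 ^ c₀) (hc₀' : 2 / β ≤ 2 ^ c₀) :
    ScaleOK β q (2 ^ (n + c₀)) ⌊β * 2 ^ (n + c₀)⌋₊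
      (clampAt G (clampTable q c₀ β) (2 ^ (n + c₀)) (2 ^ c₀)) (fun w => G.degree w)
      (fun w => delta q β (G.degree w)) (rounding β n) (2 / (β * 2 ^ (n + c₀))) := by
  have hone : (0 : ℝ) < 2 ^ (n + c₀) := by positivity
  have hpow : (2 : ℝ) ^ n ≤ 2 ^ (n + c₀) := pow_le_pow_right₀ (by norm_num) (by omega)
  have hpow' : (2 : ℝ) ^ c₀ ≤ 2 ^ (n + c₀) := pow_le_pow_right₀ (by norm_num) (by omega)
  constructor
  · exact hβ0
  · exact hβ1
  · positivity
  · push_cast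
    rw [mul_comm]
    exact Nat.lt_floor_add_one _
  · push_cast
    rw [mul_comm]
    exact Nat.floor_le (by positivity)
  · push_cast
    exact near_floor hβ0 hone (hc₀'.trans hpow')
  · positivity
  · intro w
    have hdeg : (G.degree w : ℝ) ≤ n := by
      have := G.degree_lt_card_verts w
      simp only [Fintype.card_fin] at this
      exact_mod_cast this.le
    rw [rounding]
    have e : (2 : ℝ) / (β * 2 ^ (n + c₀)) = 2 / β / 2 ^ (n + c₀) := by rw [div_div]
    rw [e]
    calc (G.degree w : ℝ) * (2 / β / 2 ^ (n + c₀)) ≤ n * (2 / β / 2 ^ n) := by gcongr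
      _ = 2 / β * n / 2 ^ n := by ring
      _ ≤ _ := by gcongr; linarith
  · push_cast
    rw [rounding]
    have : 0 ≤ 2 / β * n := by positivity
    gcongr
    linarith
  · exact fun w => (delta_pos hq hβ0 hβ1 _).le
  · intro w hw
    have := isLowDegree_of_clampAt G hβ1 hw
    linarith
  · intro w hw
    exact delta_of_low hβ1 (isLowDegree_of_clampAt G hβ1 hw)
  all_goals
    intro w hw
    have h := clampNum_spec (by omega) hβ0 hβ1 hc₀ rfl (isLowDegree_of_clampAt G hβ1 hw)
    have h2n : (0 : ℝ) ≤ 2 ^ n := by positivity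
    rw [clampAt_clampTable]
    push_cast
    rw [pow_add]
  · have := mul_le_mul_of_nonneg_left h.1 h2n
    linarith
  · have := mul_le_mul_of_nonneg_left h.2.1 h2n
    linarith
  · have := mul_le_mul_of_nonneg_left h.2.2 h2n
    linarith

end Clamps

end Potts


namespace Potts

/-! ### Total error and total running time from the starting vertex -/

section Totals

variable {n q : ℕ} (G : SimpleGraph (Fin n)) [DecidableRel G.Adj] {ω : Fin n → ℝ}

theorem saw_anti (hω : ∀ i, 0 ≤ ω i) (ℓ : ℕ) {D D' : List (Fin n)} (hD : D ⊆ D') (v : Fin n) :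
    saw G ω ℓ D' v ≤ saw G ω ℓ D v := by
  induction ℓ generalizing D D' v with
  | zero => exact le_rfl
  | succ ℓ ih =>
    exact sum_map_le_sum_map_of_sublist (aliveNbrs_sublist G hD v)
      (fun i => mul_le_mul_of_nonneg_left (ih (List.cons_subset_cons _ hD) i) (hω i))
      (fun i => mul_nonneg (hω i) (saw_nonneg G hω _ _ _))

theorem saw_one_le {a : ℝ} (ha : 0 < a) (hω : ∀ i, a ≤ ω i) (ℓ : ℕ) (D : List (Fin n))
    (v : Fin n) : saw G 1 ℓ D v ≤ a⁻¹ ^ ℓ * saw G ω ℓ D v := by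
  induction ℓ generalizing D v with
  | zero => simp [saw]
  | succ ℓ ih =>
    rw [saw, saw, ← List.sum_map_mul_left]
    refine List.sum_le_sum fun i _ => ?_
    rw [Pi.one_apply, one_mul]
    have h1 : 0 ≤ saw G ω ℓ (i :: D) i := saw_nonneg G (fun i => ha.le.trans (hω i)) _ _ _
    have h2 : 1 ≤ a⁻¹ * ω i := by
      rw [inv_mul_eq_div, one_le_div ha]
      exact hω i
    calc saw G 1 ℓ (i :: D) i ≤ a⁻¹ ^ ℓ * saw G ω ℓ (i :: D) i := ih _ _
      _ ≤ a⁻¹ ^ ℓ * saw G ω ℓ (i :: D) i * (a⁻¹ * ω i) :=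
        le_mul_of_one_le_right (mul_nonneg (by positivity) h1) h2
      _ = _ := by ring

theorem IsContractionFunction.saw_le {δ : ℕ → ℝ} {𝒢 : GraphFamily}
    (h : IsContractionFunction δ 𝒢) (hδ : ∀ d, 0 ≤ δ d) :
    ∃ (c : ℕ) (γ : ℝ), 0 < γ ∧ γ < 1 ∧ ∀ (n : ℕ) (G : SimpleGraph (Fin n)) [DecidableRel G.Adj],
      G ∈ 𝒢 n → ∀ (v : Fin n) (D : List (Fin n)) (ℓ : ℕ), 1 ≤ ℓ →
        saw G (fun i => δ (G.degree i)) ℓ (v :: D) v ≤ (n : ℝ) ^ c * γ ^ ℓ := by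
  obtain ⟨C, γ, -, hγ0, hγ1, hs⟩ := h
  refine ⟨⌈C⌉₊, γ, hγ0, hγ1, fun n G _ hG v D ℓ hℓ => ?_⟩
  have hn : (1 : ℝ) ≤ n := by exact_mod_cast v.pos
  calc saw G (fun i => δ (G.degree i)) ℓ (v :: D) v
      ≤ saw G (fun i => δ (G.degree i)) ℓ [v] v := saw_anti G (fun i => hδ _) ℓ (by simp) v
    _ ≤ sawSum δ G v ℓ := saw_le_sawSum G δ hδ ℓ v
    _ ≤ (n : ℝ) ^ C * γ ^ ℓ := (hs n G hG v ℓ hℓ).le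
    _ ≤ _ := by
      refine mul_le_mul_of_nonneg_right ?_ (by positivity)
      rw [← Real.rpow_natCast]
      exact Real.rpow_le_rpow_of_exponent_le hn (Nat.le_ceil C)

theorem log_le_size (n : ℕ) : Real.log n ≤ n.size := by
  rcases Nat.eq_zero_or_pos n with rfl | hn
  · simp
  have h1 : (n : ℝ) ≤ 2 ^ n.size := by exact_mod_cast (Nat.lt_size_self n).le
  calc Real.log n ≤ Real.log (2 ^ n.size) := Real.log_le_log (by exact_mod_cast hn) h1
    _ = n.size * Real.log 2 := Real.log_pow _ _
    _ ≤ n.size * 1 := by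
      refine mul_le_mul_of_nonneg_left ?_ (by positivity)
      linarith [Real.log_two_lt_d9]
    _ = _ := mul_one _

/-- The logarithm is replaced by the bit length. The `+ 1` takes care of graphs on a single vertex.
-/
theorem LocallySparse.ncard_le {β : ℝ} {𝒢 : GraphFamily} (h : LocallySparse q β 𝒢) :
    ∃ K : ℕ, 1 ≤ K ∧ ∀ (n : ℕ) (G : SimpleGraph (Fin n)), G ∈ 𝒢 n →
      ∀ (u w : Fin n) (p : G.Walk u w), p.IsPath →
        (minBlock q β G ∅ {y | y ∈ p.support}).ncard ≤ K * (p.length + n.size) + 1 := by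
  obtain ⟨C, hC, hs⟩ := h
  refine ⟨⌈C⌉₊, Nat.one_le_ceil_iff.2 hC, fun n G hG u w p hp => ?_⟩
  rcases Nat.lt_or_ge n 2 with hn | hn
  · have h1 : (minBlock q β G ∅ {y | y ∈ p.support}).ncard ≤ n := by
      simpa using Set.ncard_le_card (minBlock q β G ∅ {y | y ∈ p.support})
    omega
  · have h1 := hs n hn G hG u w p hp
    have h2 : C * (p.length + Real.log n) ≤ ⌈C⌉₊ * (p.length + n.size) :=
      mul_le_mul (Nat.le_ceil C) (by linarith [log_le_size n])
        (add_nonneg (by positivity) (Real.log_natCast_nonneg n)) (by positivity)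
    have h3 : ((minBlock q β G ∅ {y | y ∈ p.support}).ncard : ℝ) ≤
        ((⌈C⌉₊ * (p.length + n.size) : ℕ) : ℝ) := by
      push_cast
      exact h1.trans h2
    have : (minBlock q β G ∅ {y | y ∈ p.support}).ncard ≤ ⌈C⌉₊ * (p.length + n.size) := by
      exact_mod_cast h3
    omega

variable {β : ℝ} {one b : ℕ} {cl : Fin n → ℕ} {δ : Fin n → ℝ} {r ρ : ℝ} {L : ℕ}
  {Bd : ℕ → ℕ}

theorem colored_init {Λ : List (Fin n)} {v : Fin n} (hv : v ∉ Λ) : colored Λ (v :: Λ) = 1 := by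
  rw [colored_cons hv]
  simp [colored]

theorem err_init_le (hB : ∀ (u w : Fin n) (p : G.Walk u w), p.IsPath →
      (minBlock q β G ∅ {y | y ∈ p.support}).ncard ≤ Bd p.length)
    (hcl : ∀ w, cl w = 0 → ¬ IsLowDegree q β G w)
    (hδ1 : ∀ w, cl w = 0 → δ w = 1) (hr : 0 ≤ r) {μ : ℝ} (hμ : 0 < μ) (hδ : ∀ w, μ ≤ δ w)
    {a : ℕ} (ha : ∀ h, L ≤ Bd h → a ≤ h) {D : List (Fin n)} (hD : D.Nodup) {v : Fin n}
    (hv : v ∉ D) {W γ : ℝ} (hW : 0 ≤ W) (hγ0 : 0 < γ) (hγ1 : γ < 1)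
    (hsaw : ∀ ℓ, 1 ≤ ℓ → saw G δ ℓ (v :: D) v ≤ W * γ ^ ℓ) :
    err G cl δ r (n + 1) (L - 1) (v :: D) (aliveNbrs G (v :: D) v) ≤
      W * (n + 1) * ((1 + μ⁻¹) * r + γ ^ a) := by
  have hδ0 : ∀ w, 0 ≤ δ w := fun w => hμ.le.trans (hδ w)
  -- The first part pays for rounding: `δ w * μ⁻¹ ≥ 1` turns the additive `r` into a multiple of `δ
  -- w`. The second part is the cut-off error, which arises only on walks longer than `a`.
  set g : ℕ → ℝ := fun j => (1 + μ⁻¹) * r + if a < j then 1 else 0 with hg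
  have hR : r ≤ (1 + μ⁻¹) * r := le_mul_of_one_le_left hr (by linarith [inv_pos.2 hμ])
  have hg' : ∀ j, (1 + μ⁻¹) * r ≤ g j := fun j => by
    simp only [hg]
    split_ifs <;> linarith
  have h1 := err_le (g := g) (Λ := D) (v₀ := v) (L := L) hB hcl hδ0 hδ1 hr
    (fun j => hR.trans (hg' j)) (fun w j => by
      refine le_trans ?_ (mul_le_mul_of_nonneg_left (hg' j) (hδ0 w))
      have h2 : 1 ≤ δ w * μ⁻¹ := by
        rw [← div_eq_mul_inv, one_le_div hμ]
        exact hδ w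
      nlinarith)
    (fun h hh => by
      simp only [hg, if_pos (Nat.lt_succ_of_le (ha h hh))]
      have : 0 ≤ (1 + μ⁻¹) * r := hr.trans hR
      linarith)
    (n + 1) (L - 1) (v :: D) ((aliveNbrs G (v :: D) v).map fun i => (i, 0))
    (List.nodup_cons.2 ⟨hv, hD⟩) (List.subset_cons_self _ _) (by rw [colored_init hv])
    (by
      simp only [List.mem_map, mem_aliveNbrs]
      rintro _ ⟨i, hi, rfl⟩
      exact Entry.init hv hi.1)
  simp only [List.map_map, Function.comp_def, List.map_id'] at h1
  rw [sum_pendingPot_aliveNbrs, sum_pot_eq] at h1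
  refine h1.trans ?_
  calc _ ≤ ∑ m ∈ Finset.range (n + 1), W * ((1 + μ⁻¹) * r + γ ^ a) := by
        refine Finset.sum_le_sum fun m _ => ?_
        have h2 := hsaw (m + 1) (by omega)
        have h3 : 0 ≤ g (0 + m + 1) := (hr.trans hR).trans (hg' _)
        refine (mul_le_mul_of_nonneg_left h2 h3).trans ?_
        rw [mul_left_comm]
        refine mul_le_mul_of_nonneg_left ?_ hW
        simp only [hg]
        rw [add_mul ((1 + μ⁻¹) * r)]
        refine add_le_add ?_ ?_
        · exact mul_le_of_le_one_right (hr.trans hR) (pow_le_one₀ hγ0.le hγ1.le)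
        · split_ifs with hh
          · rw [one_mul]
            exact pow_le_pow_of_le_one hγ0.le hγ1.le (by omega)
          · rw [zero_mul]
            positivity
    _ = _ := by
        rw [Finset.sum_const, Finset.card_range, nsmul_eq_mul]
        push_cast
        ring

theorem cost_init_le (hBm : Monotone Bd) (hB : ∀ (u w : Fin n) (p : G.Walk u w), p.IsPath →
      (minBlock q β G ∅ {y | y ∈ p.support}).ncard ≤ Bd p.length)
    (hcl : ∀ w, cl w = 0 → ¬ IsLowDegree q β G w) {μ : ℝ} (hμ : 0 < μ) (hμ1 : μ ≤ 1)
    (hδ : ∀ w, μ ≤ δ w) (a : ℕ) {D : List (Fin n)} (hD : D.Nodup) {v : Fin n}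
    (hv : v ∉ D) {W γ : ℝ} (hW : 0 ≤ W) (hγ0 : 0 < γ) (hγ1 : γ < 1)
    (hsaw : ∀ ℓ, 1 ≤ ℓ → saw G δ ℓ (v :: D) v ≤ W * γ ^ ℓ) :
    (cost G cl q a (n + 1) (L - 1) (v :: D) (aliveNbrs G (v :: D) v) : ℝ) ≤
      a * (2 * q + 3) ^ (Bd L + 1) * (1 + n + (n + 1) * ((n + 1) * (μ⁻¹ ^ Bd L * W))) := by
  -- Only walks of length at most `Bd L` matter for the running time, and for these the loss `μ⁻¹ ^
  -- Bd L` from dropping the weights is still polynomial.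
  set g : ℕ → ℝ := fun j => if j ≤ Bd L then (n : ℝ) + 1 else 0 with hg
  have hg0 : ∀ j, 0 ≤ g j := fun j => by
    simp only [hg]
    split_ifs <;> positivity
  have h1 := cost_le (g := g) (Λ := D) (v₀ := v) (L := L) hBm hB hcl a hg0
    (fun j hj => by simp only [hg, if_pos hj]; exact le_rfl)
    (n + 1) (L - 1) (v :: D) ((aliveNbrs G (v :: D) v).map fun i => (i, 0))
    (List.nodup_cons.2 ⟨hv, hD⟩) (List.subset_cons_self _ _) (by rw [colored_init hv])
    (by
      simp only [List.mem_map, mem_aliveNbrs]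
      rintro _ ⟨i, hi, rfl⟩
      exact Entry.init hv hi.1)
    Covered.init
  simp only [List.map_map, Function.comp_def, List.map_id'] at h1
  rw [List.sum_map_add, sum_pendingPot_aliveNbrs, sum_pot_eq] at h1
  have hμ' : 1 ≤ μ⁻¹ := (one_le_inv₀ hμ).2 hμ1
  have h2 : ∑ m ∈ Finset.range (n + 1), g (0 + m + 1) * saw G 1 (m + 1) (v :: D) v ≤
      (n + 1) * ((n + 1) * (μ⁻¹ ^ Bd L * W)) := by
    calc _ ≤ ∑ m ∈ Finset.range (n + 1), ((n : ℝ) + 1) * (μ⁻¹ ^ Bd L * W) := by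
          refine Finset.sum_le_sum fun m _ => ?_
          simp only [hg]
          split_ifs with hm
          · refine mul_le_mul_of_nonneg_left ?_ (by positivity)
            refine (saw_one_le G hμ hδ _ _ _).trans ?_
            have h3 := saw_nonneg G (fun i => hμ.le.trans (hδ i)) (m + 1) (v :: D) v
            refine mul_le_mul (pow_le_pow_right₀ hμ' (by omega)) ?_ h3 (by positivity)
            exact (hsaw _ (by omega)).trans
              (mul_le_of_le_one_right hW (pow_le_one₀ hγ0.le hγ1.le))
          · rw [zero_mul]
            positivity
      _ = _ := by
          rw [Finset.sum_const, Finset.card_range, nsmul_eq_mul]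
          push_cast
          ring
  have h3 : ((aliveNbrs G (v :: D) v).map fun _ => (1 : ℝ)).sum ≤ n := by
    simp only [List.map_const', List.sum_replicate, nsmul_eq_mul, mul_one]
    exact_mod_cast length_aliveNbrs_le (G := G) _ _
  refine h1.trans ?_
  have hX : (1 : ℝ) ≤ 2 * q + 3 := by
    have : (0 : ℝ) ≤ q := by positivity
    linarith
  refine mul_le_mul ?_ (by linarith) ?_ (by positivity)
  · exact mul_le_mul_of_nonneg_left (pow_le_pow_right₀ hX (by omega)) (by positivity)
  · have h4 : 0 ≤ ∑ m ∈ Finset.range (n + 1), g (0 + m + 1) * saw G 1 (m + 1) (v :: D) v :=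
      Finset.sum_nonneg fun m _ => mul_nonneg (hg0 _) (saw_nonneg G (fun _ => zero_le_one) _ _ _)
    have h5 : 0 ≤ ((aliveNbrs G (v :: D) v).map fun _ => (1 : ℝ)).sum :=
      List.sum_nonneg (by simp)
    linarith

/-- The ratio that the program returns approximates the marginal. -/
theorem ratio_init_near (h : ScaleOK β q one b cl (fun w => G.degree w) δ r ρ) (hq : 0 < q)
    {D : List (Fin n)} {F : List (Fin n × Fin q)} {v : Fin n} (hv : v ∉ D)
    (hZ : 0 < fieldZ G β D F) (hinv : DegreeInv G (fun w => G.degree w) D (F.map Prod.fst) [])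
    {E : ℝ} (hE : err G cl δ r (n + 1) (L - 1) (v :: D) (aliveNbrs G (v :: D) v) ≤ E)
    (x : Fin q) :
    (0 : ℝ) < (∑ y, colorStep G one b (val G one b cl (n + 1)) L D F [] v y : ℕ) ∧
    Near (2 * (r + E)) ((colorStep G one b (val G one b cl (n + 1)) L D F [] v x : ℝ) /
      (∑ y, colorStep G one b (val G one b cl (n + 1)) L D F [] v y : ℕ))
      (fieldZAt G β D F v x / fieldZ G β D F) := by
  have hZ' : 0 < fieldZ G β (v :: D) F :=
    hZ.trans_le (fieldZ_le_cons G h.beta_nonneg h.beta_lt.le hv F)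
  obtain ⟨κ, hκ, hnear⟩ := val_near h hq (n + 1) (L - 1) (v :: D)
    (Nat.lt_succ_of_le (alive_le _)) F (aliveNbrs G (v :: D) v) hZ'
  have h1 := ratio_near h hv hκ hZ hinv hnear x
  have hnn := fieldZAt_nonneg G h.beta_nonneg D F v x
  exact ⟨h1.1, h1.2.mono (div_nonneg hnn hZ.le) (by linarith)⟩

end Totals

end Potts


namespace Potts

open Cost

/-! ### Choice of constants and polynomial bounds -/

section Numerics

variable {n q c₀ c₁ k : ℕ} {β : ℝ}

theorem Near.bounds {E x y M N : ℝ} (h : Near E x y) (hy : 0 ≤ y) (hM : 0 ≤ M) (hN : 1 ≤ N)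
    (hE : E ≤ M / N) :
    (1 - M * Real.exp M / N) * y ≤ x ∧ x ≤ (1 + M * Real.exp M / N) * y := by
  have hE' := h.mono hy hE
  have hMN : M / N ≤ M := div_le_self hM hN
  have h0 : 0 ≤ M / N := by positivity
  have e : M * Real.exp M / N = M / N * Real.exp M := by ring
  rw [e]
  have h1 : 1 ≤ Real.exp M := Real.one_le_exp hM
  have h2 := Real.add_one_le_exp (-(M / N))
  have h3 : Real.exp (M / N) ≤ Real.exp M := Real.exp_le_exp.2 hMN
  have h4 := mul_le_mul_of_nonneg_left h3 h0
  have h5 : Real.exp (M / N) * (-(M / N) + 1) ≤ 1 := by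
    have := mul_le_mul_of_nonneg_left h2 (Real.exp_nonneg (M / N))
    rwa [← Real.exp_add, add_neg_cancel, Real.exp_zero] at this
  refine ⟨le_trans (mul_le_mul_of_nonneg_right ?_ hy) hE'.1,
    hE'.2.trans (mul_le_mul_of_nonneg_right ?_ hy)⟩ <;> nlinarith

theorem inv_two_pow_size_le (hn : 1 ≤ n) : ((1 : ℝ) / 2) ^ n.size ≤ 1 / n := by
  rw [div_pow, one_pow]
  exact one_div_le_one_div_of_le (by exact_mod_cast hn) (by exact_mod_cast (Nat.lt_size_self n).le)

theorem two_pow_size_le (hn : 1 ≤ n) : 2 ^ n.size ≤ 2 * n := by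
  obtain ⟨s, hs⟩ : ∃ s, n.size = s + 1 := ⟨n.size - 1, by have := Nat.size_pos.2 hn; omega⟩
  have := Nat.lt_size.1 (show s < n.size by omega)
  rw [hs, pow_succ]
  omega

theorem exists_error_bound (hβ0 : 0 ≤ β) (c : ℕ) {γ R : ℝ} (hγ0 : 0 < γ) (hγ1 : γ < 1)
    (hR : 1 ≤ R) : ∃ (c₂ : ℕ) (M : ℝ), 0 < M ∧ ∀ n : ℕ, 1 ≤ n →
      2 * (rounding β n + (n : ℝ) ^ c * (n + 1) * (R * rounding β n + γ ^ (c₂ * n.size))) ≤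
        M / (n : ℝ) ^ 3 := by
  -- The prefactor `n ^ c * (n + 1)` has degree `c + 1`, so decay of order `c + 4` leaves `n ^
  -- (-3)`.
  obtain ⟨c₂, hc₂⟩ := exists_pow_lt_of_lt_one (show (0 : ℝ) < (1 / 2) ^ (c + 4) by positivity) hγ1
  obtain ⟨B, hB⟩ := (tendsto_pow_const_div_const_pow_of_one_lt (c + 5)
    (show (1 : ℝ) < 2 by norm_num)).bddAbove_range
  have hB' : ∀ n : ℕ, (n : ℝ) ^ (c + 5) / 2 ^ n ≤ B := fun n => hB ⟨n, rfl⟩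
  have hB0 : 0 ≤ B := le_trans (by positivity) (hB' 0)
  set A : ℝ := 2 / β + 2 with hA
  have hA0 : 0 ≤ A := by positivity
  refine ⟨c₂, 2 * (4 * R * A * B + 2), by positivity, fun n hn => ?_⟩
  have hn' : (1 : ℝ) ≤ n := by exact_mod_cast hn
  have hn0 : (0 : ℝ) < n := by linarith
  have h1 : rounding β n ≤ A * n / 2 ^ n := by
    rw [rounding]
    gcongr
    rw [hA, add_mul]
    linarith
  have h0 := rounding_nonneg (n := n) hβ0
  have h2 : γ ^ (c₂ * n.size) ≤ 1 / (n : ℝ) ^ (c + 4) := by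
    calc γ ^ (c₂ * n.size) = (γ ^ c₂) ^ n.size := pow_mul _ _ _
      _ ≤ ((1 / 2) ^ (c + 4)) ^ n.size := pow_le_pow_left₀ (by positivity) hc₂.le _
      _ = ((1 / 2) ^ n.size) ^ (c + 4) := pow_right_comm _ _ _
      _ ≤ (1 / n) ^ (c + 4) := pow_le_pow_left₀ (by positivity) (inv_two_pow_size_le hn) _
      _ = _ := by rw [div_pow, one_pow]
  have hcoef : (n : ℝ) ^ c * (n + 1) ≤ 2 * (n : ℝ) ^ (c + 1) := by
    rw [pow_succ]
    have : 0 ≤ (n : ℝ) ^ c := by positivity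
    nlinarith
  have hcoef1 : 1 ≤ (n : ℝ) ^ c * (n + 1) := by
    have : 1 ≤ (n : ℝ) ^ c := one_le_pow₀ hn'
    nlinarith
  have h3 : (n : ℝ) ^ c * (n + 1) * γ ^ (c₂ * n.size) ≤ 2 / (n : ℝ) ^ 3 := by
    refine (mul_le_mul hcoef h2 (by positivity) (by positivity)).trans (le_of_eq ?_)
    rw [show c + 4 = c + 1 + 3 by ring, pow_add (n : ℝ) (c + 1) 3]
    field_simp
  have h4 : (n : ℝ) ^ c * (n + 1) * (R * rounding β n) ≤ 2 * R * A * B / (n : ℝ) ^ 3 := by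
    calc (n : ℝ) ^ c * (n + 1) * (R * rounding β n)
        ≤ 2 * (n : ℝ) ^ (c + 1) * (R * (A * n / 2 ^ n)) := by gcongr
      _ = 2 * R * A * ((n : ℝ) ^ (c + 5) / 2 ^ n) / (n : ℝ) ^ 3 := by
        rw [show c + 5 = c + 1 + 1 + 3 by ring, pow_add (n : ℝ) (c + 1 + 1) 3, pow_succ (n : ℝ) (c + 1)]
        field_simp
      _ ≤ _ := by gcongr; exact hB' n
  have h5 : rounding β n ≤ (n : ℝ) ^ c * (n + 1) * (R * rounding β n) := by
    have : rounding β n ≤ R * rounding β n := le_mul_of_one_le_left h0 hR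
    exact this.trans (le_mul_of_one_le_left (by positivity) hcoef1)
  have e : 2 * (4 * R * A * B + 2) / (n : ℝ) ^ 3 =
      2 * (2 * (2 * R * A * B / (n : ℝ) ^ 3) + 2 / (n : ℝ) ^ 3) := by ring
  rw [e, mul_add]
  linarith

/-- A bound for the sizes of all numbers that occur. -/
def sizeBound {R : Type*} [CommSemiring R] (q c₀ c₁ k : ℕ) (x : R) : R :=
  q + (x + 2) + (2 * x ^ 2 + 1) +
    ((x + c₀ + 1) + ((x * (q + (2 * (2 * x ^ 2) * (x + c₀ + 1) + 1)) + 1) +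
      (2 * x ^ 2 * (x + c₀ + 1) + 1))) + 2 ^ c₀ + (c₀ + 1 + (x + c₀ + 1)) + (c₁ * x + 1) + c₁ + k

/-- A bound for the number of steps. -/
def timeBound {R : Type*} [CommSemiring R] (q c e₁ e₂ : ℕ) (m x : R) : R :=
  (q + 1) * (2000 * m ^ 4 + 2000 * m ^ 3 * (2 * x) ^ e₁ *
    (1 + x + (x + 1) * ((x + 1) * ((2 * x) ^ e₂ * x ^ c)))) + 2

theorem eval_timeBound (c e₁ e₂ : ℕ) :
    (timeBound q c e₁ e₂ (sizeBound q c₀ c₁ k Polynomial.X) Polynomial.X : Polynomial ℕ).eval n =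
      timeBound q c e₁ e₂ (sizeBound q c₀ c₁ k n) n := by
  simp [timeBound, sizeBound]

theorem le_sizeBound {S : ℕ} (hS : S = sizeBound q c₀ c₁ k n) :
    q ≤ S ∧ n + 2 ≤ S ∧ 2 * n ^ 2 + 1 ≤ S ∧
      (n + c₀ + 1) + ((n * (q + (2 * (2 * n ^ 2) * (n + c₀ + 1) + 1)) + 1) +
        (2 * n ^ 2 * (n + c₀ + 1) + 1)) ≤ S ∧
      2 ^ c₀ ≤ S ∧ c₀ + 1 + (n + c₀ + 1) ≤ S ∧ c₁ * n + 1 ≤ S ∧ c₁ ≤ S ∧ k ≤ S := by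
  simp only [sizeBound, Nat.cast_id] at hS
  generalize n * (q + (2 * (2 * n ^ 2) * (n + c₀ + 1) + 1)) = a₁ at *
  generalize 2 * n ^ 2 * (n + c₀ + 1) = a₂ at *
  generalize 2 ^ c₀ = a₃ at *
  generalize c₁ * n = a₄ at *
  omega

theorem sizeOK (hq : 1 ≤ q) (hβ1 : β < 1) {tbl : List ℕ} (htbl : ∀ x ∈ tbl, x ≤ 2 ^ c₀) :
    SizeOK n q c₀ (2 ^ (n + c₀)) ⌊β * 2 ^ (n + c₀)⌋₊ (2 * n ^ 2) (sizeBound q c₀ c₁ k n) tbl := by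
  have hone : (2 ^ (n + c₀)).size = n + c₀ + 1 := Nat.size_pow
  have hc : (2 ^ c₀).size = c₀ + 1 := Nat.size_pow
  obtain ⟨h₁, h₂, h₃, h₄, h₅, h₆, -⟩ := le_sizeBound (q := q) (c₀ := c₀) (c₁ := c₁) (k := k)
    (n := n) rfl
  refine ⟨hq, h₁, h₂, h₃, ?_, Nat.one_le_two_pow, ?_, fun x hx => (htbl x hx).trans h₅, ?_, by omega⟩
  · refine Nat.floor_le_of_le ?_
    push_cast
    exact mul_le_of_le_one_left (by positivity) hβ1.le
  · refine size_numBound_le.trans (le_trans ?_ h₄)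
    rw [hone]
    have : n * (q.size + (2 * (2 * n ^ 2) * (n + c₀ + 1) + 1)) ≤
        n * (q + (2 * (2 * n ^ 2) * (n + c₀ + 1) + 1)) :=
      Nat.mul_le_mul_left _ (Nat.add_le_add_right (size_le_self q) _)
    omega
  · intro x hx
    have h1 := size_mul_le x (2 ^ (n + c₀))
    have h2 := size_mono (htbl x hx)
    omega

/-- An exponential in a multiple of the bit length is polynomial, because `2 ^ n.size ≤ 2 * n`. -/
theorem pow_size_le (hn : 1 ≤ n) {X : ℝ} (hX : 1 ≤ X) {e : ℕ} (he : X ≤ 2 ^ e) {N a : ℕ}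
    (hN : N ≤ a * n.size) : X ^ N ≤ (2 * n : ℝ) ^ (e * a) := by
  calc X ^ N ≤ X ^ (a * n.size) := pow_le_pow_right₀ hX hN
    _ ≤ (2 ^ e) ^ (a * n.size) := pow_le_pow_left₀ (by linarith) he _
    _ = (2 ^ n.size) ^ (e * a) := by rw [← pow_mul, ← pow_mul]; ring_nf
    _ ≤ _ := pow_le_pow_left₀ (by positivity) (by exact_mod_cast two_pow_size_le hn) _

end Numerics

end Potts

/-! ### The main theorem -/

open Potts in
theorem mainTheorem4 (q : ℕ) (hq : 3 ≤ q) (β : ℝ) (hβ0 : 0 ≤ β) (hβ1 : β < 1)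
    (𝒢 : Potts.GraphFamily)
    (hcontr : Potts.IsContractionFunction (Potts.delta q β) 𝒢)
    (hcol : β = 0 → ∀ n : ℕ, ∀ G ∈ 𝒢 n, G.Colorable q)
    (hsparse : Potts.LocallySparse q β 𝒢) :
    ∃ (P : Cost.Program) (T : Polynomial ℕ) (C : ℝ), 0 < C ∧
      ∀ (n : ℕ) (Ω : Potts.Instance q n), Ω.graph ∈ 𝒢 n → Ω.Feasible β →
        ∀ (v : Fin n) (x : Fin q),
          ∃ a b t : ℕ, b ≠ 0 ∧ t ≤ T.eval n ∧
            P.RunsIn β (Ω.encode v x) (.pair (.nat a) (.nat b)) t ∧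
            (1 - C / (n : ℝ) ^ 3) * Ω.marginal β v x ≤ (a : ℝ) / b ∧
            (a : ℝ) / b ≤ (1 + C / (n : ℝ) ^ 3) * Ω.marginal β v x := by
  have hq' : (3 : ℝ) ≤ q := by exact_mod_cast hq
  have hδ0 : ∀ d, 0 ≤ delta q β d := fun d => (delta_pos hq hβ0 hβ1 d).le
  obtain ⟨c, γ, hγ0, hγ1, hsaw⟩ := hcontr.saw_le hδ0
  obtain ⟨K, hK, hB⟩ := hsparse.ncard_le
  set μ : ℝ := 2 * (1 - β) / (q - 1) with hμdef
  have hμ : 0 < μ := div_pos (by linarith) (by linarith)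
  have hμ1 : μ ≤ 1 := by
    rw [hμdef, div_le_one (by linarith)]
    linarith
  have hδ : ∀ d, μ ≤ delta q β d := le_delta hq hβ0 hβ1
  obtain ⟨c₂, M, hM, herr⟩ := exists_error_bound hβ0 c hγ0 hγ1
    (show 1 ≤ 1 + μ⁻¹ by linarith [inv_pos.2 hμ])
  obtain ⟨c₀, hc₀⟩ := pow_unbounded_of_one_lt (max ((q : ℝ) * (q + 1) / (1 - β)) (2 / β))
    (show (1 : ℝ) < 2 by norm_num)
  have hc₀₁ := ((le_max_left _ _).trans_lt hc₀).le
  have hc₀₂ := ((le_max_right _ _).trans_lt hc₀).le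
  obtain ⟨d₁, hd₁⟩ := pow_unbounded_of_one_lt (2 * (q : ℝ) + 3) (show (1 : ℝ) < 2 by norm_num)
  obtain ⟨d₂, hd₂⟩ := pow_unbounded_of_one_lt μ⁻¹ (show (1 : ℝ) < 2 by norm_num)
  -- With this depth, a block bound `K * (h + n.size) + 1` that reaches `c₁ * n.size + 1` forces `h
  -- ≥ c₂ * n.size`, the walk length at which the error is small.
  set c₁ := K * (c₂ + 1) with hc₁
  set c₄ := K * (c₁ + 2) + 1 with hc₄
  set k := (clampTable q c₀ β).length with hk
  refine ⟨pottsProgram q c₀ c₁ (clampTable q c₀ β),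
    timeBound q c (d₁ * (c₄ + 1)) (d₂ * c₄) (sizeBound q c₀ c₁ k Polynomial.X) Polynomial.X,
    M * Real.exp M, by positivity, fun n Ω hG hΩ v x => ?_⟩
  classical
  have hn : 1 ≤ n := v.pos
  have hn3 : (1 : ℝ) ≤ (n : ℝ) ^ 3 := one_le_pow₀ (by exact_mod_cast hn)
  rw [eval_timeBound, Ω.encode_eq]
  set m := sizeBound q c₀ c₁ k n with hm
  have hsize : SizeOK n q c₀ (2 ^ (n + c₀)) ⌊β * 2 ^ (n + c₀)⌋₊ (2 * n ^ 2) m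
      (clampTable q c₀ β) := sizeOK (by omega) hβ1 (by
    simp only [clampTable, List.mem_map]
    rintro _ ⟨d, _, rfl⟩
    exact clampNum_le hβ1 d)
  have hnm := hsize.n_le
  obtain ⟨-, -, -, -, -, hm₁, hm₂, hm₃, hm₄⟩ := le_sizeBound hm
  cases hv : Ω.fixedColor v with
  | some y =>
    obtain ⟨t, ht, hrun⟩ := (main_runs_of_fixed (c₀ := c₀) (c₁ := c₁) (tbl := clampTable q c₀ β)
      (β := β) Ω.graph Ω.fixedColor (m := m) (by omega) (by omega) hsize.q_le hv x).runsIn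
    refine ⟨_, _, t, one_ne_zero, ht.trans ?_, hrun, ?_⟩
    · have h1 : m ^ 2 ≤ m ^ 4 := Nat.pow_le_pow_right (by omega) (by norm_num)
      have h2 : 200 * m ^ 2 ≤ (q + 1) * (2000 * m ^ 4) :=
        le_trans (by omega) (Nat.le_mul_of_pos_left (2000 * m ^ 4) (Nat.succ_pos q))
      rw [timeBound, mul_add, Nat.cast_id]
      omega
    · have h0 : 0 ≤ M * Real.exp M / (n : ℝ) ^ 3 := by positivity
      rw [hΩ.marginal_of_fixed hβ0 hv]
      split_ifs <;> simp [h0]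
  | none =>
    set D := fixedVerts Ω.fixedColor (List.finRange n) with hD
    set F := fixedFields Ω.graph Ω.fixedColor D (List.finRange n) with hF
    have hvD : v ∉ D := by simp [hD, mem_fixedVerts, hv]
    have hDn : D.Nodup := (List.nodup_finRange n).filter _
    obtain ⟨hZ, hmarg⟩ := hΩ.marginal_of_free hβ0 hD hF hvD x
    set cl := clampAt Ω.graph (clampTable q c₀ β) (2 ^ (n + c₀)) (2 ^ c₀) with hcl
    set L := c₁ * n.size + 1 with hL
    have hcl0 : ∀ w, cl w = 0 → ¬ IsLowDegree q β Ω.graph w :=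
      fun w => clampAt_eq_zero Ω.graph (by omega) hβ0 hβ1 hc₀₁
    have hY : F.length + n * alive D ≤ 2 * n ^ 2 := by
      have h1 : F.length ≤ n * n := length_fixedFields_le Ω.graph Ω.fixedColor D
      have h2 : n * alive D ≤ n * n := Nat.mul_le_mul_left _ (alive_le D)
      have h3 : n ^ 2 = n * n := sq n
      omega
    have hs := hsaw n Ω.graph hG v D
    have hBG := hB n Ω.graph hG
    obtain ⟨t, ht, hrun⟩ := (main_runs_of_free (c₁ := c₁) (N := n + 1) Ω.graph Ω.fixedColor hsize
      (by omega)
      (by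
        have h1 : c₁ * n.size ≤ c₁ * n := Nat.mul_le_mul_left _ (Cost.size_le_self n)
        omega) hm₃ hm₄
      (clampAt_le Ω.graph hβ1) hD hF hY hv x hL (Nat.lt_succ_self n) rfl rfl rfl).runsIn
    have herr' := err_init_le (cl := cl) (δ := fun w => delta q β (Ω.graph.degree w)) (L := L)
      (Bd := fun h => K * (h + n.size) + 1) (r := rounding β n) (a := c₂ * n.size) Ω.graph hBG hcl0
      (fun w hw => delta_of_not_low hβ1 ((isLowDegree_iff Ω.graph).not.1 (hcl0 w hw)))
      (rounding_nonneg hβ0) hμ (fun w => hδ _)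
      (fun h hh => by
        rw [hL, hc₁, mul_assoc] at hh
        have h1 := Nat.le_of_mul_le_mul_left (Nat.le_of_succ_le_succ hh) (by omega)
        rw [add_mul, one_mul] at h1
        omega)
      hDn hvD (by positivity) hγ0 hγ1 hs
    have hcost := cost_init_le (q := q) (cl := cl) (δ := fun w => delta q β (Ω.graph.degree w))
      (L := L) (Bd := fun h => K * (h + n.size) + 1) Ω.graph
      (fun a b hab => by
        have := Nat.mul_le_mul_left K (Nat.add_le_add_right hab n.size)
        simp only
        omega) hBG hcl0 hμ hμ1 (fun w => hδ _) (2000 * m ^ 3) hDn hvD (by positivity) hγ0 hγ1 hs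
    obtain ⟨hpos, hnear⟩ := ratio_init_near Ω.graph
      (scaleOK (n := n) Ω.graph hq hβ0 hβ1 hc₀₁ hc₀₂) (by omega) hvD hZ
      (degreeInv_fixedFields Ω.graph Ω.fixedColor hD) herr' x
    rw [← hmarg] at hnear
    refine ⟨_, _, t, ?_, ht.trans ?_, hrun, hnear.bounds ?_ hM.le hn3 (herr n hn)⟩
    · intro h0
      rw [h0] at hpos
      simp at hpos
    · have hsz : 1 ≤ n.size := Nat.size_pos.2 hn
      -- As `n.size ≥ 1`, the additive constants can be absorbed: the `+ 1` in `L` costs another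
      -- `K`, and the last `+ 1` costs 1.
      have hBd : K * (L + n.size) + 1 ≤ c₄ * n.size := by
        have e : c₄ * n.size = K * (c₁ * n.size + n.size + n.size) + n.size := by rw [hc₄]; ring
        have h1 : K * (L + n.size) ≤ K * (c₁ * n.size + n.size + n.size) :=
          Nat.mul_le_mul_left _ (by omega)
        omega
      have h1 := pow_size_le hn (show (1 : ℝ) ≤ 2 * q + 3 by linarith) hd₁.le
        (show K * (L + n.size) + 1 + 1 ≤ (c₄ + 1) * n.size by rw [add_mul]; omega)
      have h2 := pow_size_le hn ((one_le_inv₀ hμ).2 hμ1) hd₂.le hBd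
      have h3 : (Potts.cost Ω.graph cl q (2000 * m ^ 3) (n + 1) (L - 1) (v :: D)
          (aliveNbrs Ω.graph (v :: D) v) : ℝ) ≤ ((2000 * m ^ 3 * (2 * n) ^ (d₁ * (c₄ + 1)) *
            (1 + n + (n + 1) * ((n + 1) * ((2 * n) ^ (d₂ * c₄) * n ^ c))) : ℕ) : ℝ) := by
        refine hcost.trans ?_
        push_cast
        gcongr
      have h4 := Nat.mul_le_mul_left (q + 1) (Nat.add_le_add_left (Nat.cast_le.1 h3) (2000 * m ^ 4))
      rw [timeBound, Nat.cast_id]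
      exact Nat.add_le_add_right h4 2
    · rw [hmarg]
      exact div_nonneg (fieldZAt_nonneg _ hβ0 _ _ _ _) hZ.le
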